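/- **Theorem (column subset selection for the entrywise Huber loss).** Let $H(x)=x^2/2$ for $|x|\le 1$ and $H(x)=|x|-\tfrac12$ for $|x|>1$, and for a real matrix $M$ put $\|M\|_H=\sum_{i,j}H(M_{ij})$. For $A\in\mathbb{R}^{n\times d}$ and $S\subseteq\{1,\dots,d\}$ let $A|^S$ be the matrix whose columns are the columns of $A$ indexed by $S$. There are a randomized algorithm (a single program of a real RAM, that is, a machine with unit-cost exact arithmetic and comparison of real numbers, unit-cost addition, subtraction and comparison of natural numbers, indexed memory and fair coin tosses), an absolute constant $C$ and a polynomial $q$ such that the following holds for all integers $n,d,t\ge 0$ and $k\ge 1$ and every $A\in\mathbb{R}^{n\times d}$. On input $(A,k,t)$ the algorithm always halts after at most $q(n+d+t)$ operations and outputs a set $S\subseteq\{1,\dots,d\}$ with $$|S|\le C\,k\,\log(\max\{d,2\})$$ and a matrix $X\in\mathbb{R}^{S\times d}$; and with probability at least $1-2^{-t}$ over its coin tosses, $$\|A-A|^S X\|_H\le C\,k\cdot\min_{\operatorname{rank}(A_k)\le k}\|A-A_k\|_H .$$ -/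

import Mathlib

/-! ### A randomized real RAM

A structured programming language over a memory of natural numbers (indices and counters) and exact
real numbers. A program is a fixed finite object, the same for all inputs. Every arithmetic
operation, comparison, memory access and coin toss is charged. Naturals may be added and subtracted
but not multiplied, and there is no passage from reals to naturals (no rounding), so that the
unit-cost convention is the usual harmless one. The only constants are natural numbers. -/

namespace RealRAM

/-- Memory: one-dimensional arrays of naturals and two-dimensional arrays of reals (the first
argument is the name of the array), and the part of the coin tape that has not been read. -/
structure State where
  nats : ℕ → ℕ → ℕ
  reals : ℕ → ℕ → ℕ → ℝ
  coins : ℕ → Bool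

/-- Natural-number expressions; `sub` is truncated subtraction. -/
inductive NExpr : Type
  | const (c : ℕ) : NExpr
  | get (a : ℕ) (i : NExpr) : NExpr
  | add (e f : NExpr) : NExpr
  | sub (e f : NExpr) : NExpr

/-- Real-number expressions; a division by zero returns zero. -/
inductive RExpr : Type
  | cast (e : NExpr) : RExpr
  | get (a : ℕ) (i j : NExpr) : RExpr
  | add (e f : RExpr) : RExpr
  | sub (e f : RExpr) : RExpr
  | mul (e f : RExpr) : RExpr
  | div (e f : RExpr) : RExpr

/-- Tests. -/
inductive BExpr : Type
  | natLe (e f : NExpr) : BExpr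
  | realLe (e f : RExpr) : BExpr
  | not (b : BExpr) : BExpr
  | and (b c : BExpr) : BExpr

/-- Programs. -/
inductive Prog : Type
  | skip : Prog
  | setNat (a : ℕ) (i e : NExpr) : Prog
  | setReal (a : ℕ) (i j : NExpr) (e : RExpr) : Prog
  | flip (a : ℕ) (i : NExpr) : Prog
  | seq (p q : Prog) : Prog
  | branch (b : BExpr) (p q : Prog) : Prog
  | loop (b : BExpr) (p : Prog) : Prog

def NExpr.eval (s : State) : NExpr → ℕ
  | .const c => c
  | .get a i => s.nats a (i.eval s)
  | .add e f => e.eval s + f.eval s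
  | .sub e f => e.eval s - f.eval s

/-- Number of operations in an expression. -/
def NExpr.cost : NExpr → ℕ
  | .const _ => 1
  | .get _ i => i.cost + 1
  | .add e f => e.cost + f.cost + 1
  | .sub e f => e.cost + f.cost + 1

noncomputable def RExpr.eval (s : State) : RExpr → ℝ
  | .cast e => (e.eval s : ℝ)
  | .get a i j => s.reals a (i.eval s) (j.eval s)
  | .add e f => e.eval s + f.eval s
  | .sub e f => e.eval s - f.eval s
  | .mul e f => e.eval s * f.eval s
  | .div e f => e.eval s / f.eval s

def RExpr.cost : RExpr → ℕ
  | .cast e => e.cost + 1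
  | .get _ i j => i.cost + j.cost + 1
  | .add e f => e.cost + f.cost + 1
  | .sub e f => e.cost + f.cost + 1
  | .mul e f => e.cost + f.cost + 1
  | .div e f => e.cost + f.cost + 1

/-- The test `b` holds in the state `s`. -/
def BExpr.Holds (s : State) : BExpr → Prop
  | .natLe e f => e.eval s ≤ f.eval s
  | .realLe e f => e.eval s ≤ f.eval s
  | .not b => ¬ b.Holds s
  | .and b c => b.Holds s ∧ c.Holds s

def BExpr.cost : BExpr → ℕ
  | .natLe e f => e.cost + f.cost + 1
  | .realLe e f => e.cost + f.cost + 1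
  | .not b => b.cost + 1
  | .and b c => b.cost + c.cost + 1

def State.setNat (s : State) (a i v : ℕ) : State :=
  { s with nats := fun a' i' => if a' = a ∧ i' = i then v else s.nats a' i' }

noncomputable def State.setReal (s : State) (a i j : ℕ) (v : ℝ) : State :=
  { s with reals := fun a' i' j' => if a' = a ∧ i' = i ∧ j' = j then v else s.reals a' i' j' }

/-- Store the next coin (as `0` or `1`) in cell `i` of the natural array `a`, and advance the
tape. -/
def State.flip (s : State) (a i : ℕ) : State :=
  { s.setNat a i (s.coins 0).toNat with coins := fun m => s.coins (m + 1) }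

/-- `Exec p s s' τ`: started in the state `s`, the program `p` halts in the state `s'` after
exactly `τ` operations. -/
inductive Exec : Prog → State → State → ℕ → Prop
  | skip (s : State) : Exec .skip s s 1
  | setNat (a : ℕ) (i e : NExpr) (s : State) :
      Exec (.setNat a i e) s (s.setNat a (i.eval s) (e.eval s)) (i.cost + e.cost + 1)
  | setReal (a : ℕ) (i j : NExpr) (e : RExpr) (s : State) :
      Exec (.setReal a i j e) s (s.setReal a (i.eval s) (j.eval s) (e.eval s))
        (i.cost + j.cost + e.cost + 1)
  | flip (a : ℕ) (i : NExpr) (s : State) :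
      Exec (.flip a i) s (s.flip a (i.eval s)) (i.cost + 1)
  | seq {p q : Prog} {s s' s'' : State} {τ τ' : ℕ} :
      Exec p s s' τ → Exec q s' s'' τ' → Exec (.seq p q) s s'' (τ + τ' + 1)
  | branchTrue {b : BExpr} {p q : Prog} {s s' : State} {τ : ℕ} :
      b.Holds s → Exec p s s' τ → Exec (.branch b p q) s s' (b.cost + τ + 1)
  | branchFalse {b : BExpr} {p q : Prog} {s s' : State} {τ : ℕ} :
      ¬ b.Holds s → Exec q s s' τ → Exec (.branch b p q) s s' (b.cost + τ + 1)
  | loopDone {b : BExpr} {p : Prog} {s : State} :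
      ¬ b.Holds s → Exec (.loop b p) s s (b.cost + 1)
  | loopStep {b : BExpr} {p : Prog} {s s' s'' : State} {τ τ' : ℕ} :
      b.Holds s → Exec p s s' τ → Exec (.loop b p) s' s'' τ' →
        Exec (.loop b p) s s'' (b.cost + τ + τ' + 1)

/-- Started in the state `s`, the program `p` halts within `T` operations, and its (unique) final
state satisfies `Q`. -/
def HaltsWithin (p : Prog) (s : State) (T : ℕ) (Q : State → Prop) : Prop :=
  ∃ s' τ, Exec p s s' τ ∧ τ ≤ T ∧ Q s'

/-- The probability of an event that depends on `T` independent fair coins. -/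
noncomputable def coinProb (T : ℕ) (E : (Fin T → Bool) → Prop) : ℝ :=
  (Nat.card {ω : Fin T → Bool // E ω} : ℝ) / 2 ^ T

end RealRAM

/-! ### Column subset selection for the entrywise Huber loss -/

namespace HuberCSS

/-- The Huber function. -/
noncomputable def huber (x : ℝ) : ℝ :=
  if |x| ≤ 1 then x ^ 2 / 2 else |x| - 1 / 2

/-- The entrywise Huber loss of a matrix. -/
noncomputable def huberLoss {n d : ℕ} (M : Matrix (Fin n) (Fin d) ℝ) : ℝ :=
  ∑ i, ∑ j, huber (M i j)

/-- The matrix of the columns of `A` indexed by `S`. -/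
def colSubmatrix {n d : ℕ} (A : Matrix (Fin n) (Fin d) ℝ) (S : Finset (Fin d)) :
    Matrix (Fin n) S ℝ :=
  A.submatrix id Subtype.val

/-- The initial memory: `n, d, k, t` in the first four cells of the natural array `0`, the matrix in
the real array `0`, zeros elsewhere; the coin tape carries `ω` (a run of at most `T` operations
never reads beyond it). -/
def input {n d : ℕ} (A : Matrix (Fin n) (Fin d) ℝ) (k t : ℕ) {T : ℕ} (ω : Fin T → Bool) :
    RealRAM.State where
  nats := fun a i =>
    if a = 0 then
      if i = 0 then n else if i = 1 then d else if i = 2 then k else if i = 3 then t else 0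
    else 0
  reals := fun a i j =>
    if h : a = 0 ∧ i < n ∧ j < d then A ⟨i, h.2.1⟩ ⟨j, h.2.2⟩ else 0
  coins := fun m => if h : m < T then ω ⟨m, h⟩ else false

/-- The set of columns written by a program: its indicator vector is the natural array `1`. -/
def outputS (d : ℕ) (s : RealRAM.State) : Finset (Fin d) :=
  Finset.univ.filter fun j => s.nats 1 j ≠ 0

/-- The coefficient matrix written by a program: the rows of the real array `1` whose index lies in
the chosen set of columns. -/
def outputX (d : ℕ) (s : RealRAM.State) : Matrix (outputS d s) (Fin d) ℝ :=
  fun i j => s.reals 1 (i : Fin d) j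

end HuberCSS

/-! ### Reasoning about programs -/

namespace RealRAM

/-! The algorithm keeps a set `T` of untreated columns. In a round it samples each column of `T`
with probability `p = 2 ^ (-l)`, where `l` is the least number with `p * #T ≤ 64 k`, and discards a
sample of more than `256 k` columns. It regresses every column on the sample, keeps the coefficients
of the quarter of `T` with the smallest losses, and removes that quarter. This takes `O(log d)`
rounds, hence `O(k log d)` chosen columns.

Fix `M` of rank at most `k` and let `g j` be the Huber loss of column `j` of `A - M`. Let `θ'` be
the median of `g` on `T` and `G` the columns with `g ≤ θ'`. Leverage scores show that in any set of
columns all but `2 k` columns of `M` are combinations of the others with coefficients of Euclidean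
norm at most `1` (`card_long_combination_le`). By exchangeability of sampled and unsampled columns,
with probability at least `1 / 2` the sample `H` is small and at most a quarter of `#T` columns of
`G \ H` fail to be such short combinations of `H ∩ G` (`half_le_sampleAvg`). If column `l` is one,
its residual is a combination of at most `257 k` columns of `A - M` with square sum of coefficients
at most `2`. The Huber loss at most doubles the sum of the losses under such a combination
(`huber_sum_le`): Cauchy–Schwarz handles its quadratic part, the bound on single coefficients its
linear part. So a quarter of `T` admits loss `O(k θ')`, and therefore the selected quarter has it
(`card_le_good`).

Bounding each round separately by the total loss would cost a factor `log d`. The potential `8 ∑ max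
(g j - θ) 0 + 4 N θ` avoids it: it pays `N θ'` in each round and starts at `8 ∑ g j`
(`potential_step`). Thus a trial in which all rounds are good has loss `O(k) ∑ g j`. Its probability
is at least `2 ^ (-roundCount d)`, which is inverse polynomial in `d`, so polynomially many trials,
of which the best is kept, reach failure probability `2 ^ (-t)`.

Regression is only needed up to a factor `3`. It starts from least squares and performs gradient
descent on a Huber loss with a rescaled threshold, each gradient being projected on the span of the
sample; `2 n ^ 2 + 1` steps suffice (`Descent.vecLoss_le`). Only field operations and comparisons
occur.

On the machine side, `Run` is a Hoare-style calculus in which time is bounded by the shape of the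
program and a bound on all loop lengths. The numbers of columns, rounds and coins are deterministic,
so coin tapes can be split round by round and trial by trial (`Run.exists_split`, `coinAvg_append`).
-/

theorem Exec.det {p : Prog} {s s₁ : State} {τ₁ : ℕ} (h₁ : Exec p s s₁ τ₁) :
    ∀ {s₂ : State} {τ₂ : ℕ}, Exec p s s₂ τ₂ → s₁ = s₂ := by
  induction h₁ with
  | skip | setNat | setReal | flip => intro s₂ τ₂ h; cases h; rfl
  | seq _ _ ih₁ ih₂ =>
    intro s₂ τ₂ h
    cases h with
    | seq h h' =>
      obtain rfl := ih₁ h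
      exact ih₂ h'
  | branchTrue hb _ ih =>
    intro s₂ τ₂ h
    cases h with
    | branchTrue _ h => exact ih h
    | branchFalse hb' _ => exact absurd hb hb'
  | branchFalse hb _ ih =>
    intro s₂ τ₂ h
    cases h with
    | branchTrue hb' _ => exact absurd hb' hb
    | branchFalse _ h => exact ih h
  | loopDone hb =>
    intro s₂ τ₂ h
    cases h with
    | loopDone _ => rfl
    | loopStep hb' _ _ => exact absurd hb' hb
  | loopStep hb _ _ ih₁ ih₂ =>
    intro s₂ τ₂ h
    cases h with
    | loopDone hb' => exact absurd hb hb'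
    | loopStep _ h h' =>
      obtain rfl := ih₁ h
      exact ih₂ h'

/-- The time bound of a program all of whose loops make at most `B` iterations. -/
def Prog.timeBound (B : ℕ) : Prog → ℕ
  | .skip => 1
  | .setNat _ i e => i.cost + e.cost + 1
  | .setReal _ i j e => i.cost + j.cost + e.cost + 1
  | .flip _ i => i.cost + 1
  | .seq p q => p.timeBound B + q.timeBound B + 1
  | .branch b p q => b.cost + (p.timeBound B + q.timeBound B) + 1
  | .loop b p => B * (b.cost + p.timeBound B + 1) + (b.cost + 1)

/-- A loop only multiplies the bound of its body by `B`, so the degree is the nesting depth, fixed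
with the program. This is the source of the polynomial running time. -/
theorem Prog.exists_timeBound_poly (p : Prog) :
    ∃ q : Polynomial ℕ, ∀ B, p.timeBound B = q.eval B := by
  induction p with
  | skip => exact ⟨1, fun B => by simp [timeBound]⟩
  | setNat a i e => exact ⟨.C (i.cost + e.cost + 1), fun B => by rw [Polynomial.eval_C, timeBound]⟩
  | setReal a i j e =>
    exact ⟨.C (i.cost + j.cost + e.cost + 1), fun B => by rw [Polynomial.eval_C, timeBound]⟩
  | flip a i => exact ⟨.C (i.cost + 1), fun B => by rw [Polynomial.eval_C, timeBound]⟩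
  | seq p q hp hq =>
    obtain ⟨f, hf⟩ := hp
    obtain ⟨g, hg⟩ := hq
    exact ⟨f + g + 1, fun B => by simp [timeBound, hf, hg]⟩
  | branch b p q hp hq =>
    obtain ⟨f, hf⟩ := hp
    obtain ⟨g, hg⟩ := hq
    exact ⟨.C b.cost + (f + g) + 1, fun B => by
      simp only [timeBound, hf, hg, Polynomial.eval_add, Polynomial.eval_C, Polynomial.eval_one]⟩
  | loop b p hp =>
    obtain ⟨f, hf⟩ := hp
    exact ⟨.X * (.C b.cost + f + 1) + (.C b.cost + 1), fun B => by
      simp only [timeBound, hf, Polynomial.eval_add, Polynomial.eval_mul, Polynomial.eval_X,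
        Polynomial.eval_C, Polynomial.eval_one]⟩

/-- Started in `s`, the program halts within `timeBound B` operations in a state satisfying `Q`. -/
def Run (B : ℕ) (p : Prog) (s : State) (Q : State → Prop) : Prop :=
  HaltsWithin p s (p.timeBound B) Q

/-- The names of the arrays of naturals that a program may write. -/
def Prog.natTargets : Prog → List ℕ
  | .skip => []
  | .setNat a _ _ => [a]
  | .setReal _ _ _ _ => []
  | .flip a _ => [a]
  | .seq p q => p.natTargets ++ q.natTargets
  | .branch _ p q => p.natTargets ++ q.natTargets
  | .loop _ p => p.natTargets

/-- The names of the arrays of reals that a program may write. -/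
def Prog.realTargets : Prog → List ℕ
  | .skip => []
  | .setNat _ _ _ => []
  | .setReal a _ _ _ => [a]
  | .flip _ _ => []
  | .seq p q => p.realTargets ++ q.realTargets
  | .branch _ p q => p.realTargets ++ q.realTargets
  | .loop _ p => p.realTargets

/-- The program tosses no coins. -/
def Prog.coinFree : Prog → Bool
  | .skip => true
  | .setNat _ _ _ => true
  | .setReal _ _ _ _ => true
  | .flip _ _ => false
  | .seq p q => p.coinFree && q.coinFree
  | .branch _ p q => p.coinFree && q.coinFree
  | .loop _ p => p.coinFree

/-- `s'` differs from `s` only where the program `p` may write. -/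
structure Agree (p : Prog) (s s' : State) : Prop where
  nats : ∀ a, a ∉ p.natTargets → s'.nats a = s.nats a
  reals : ∀ a, a ∉ p.realTargets → s'.reals a = s.reals a
  coins : p.coinFree = true → s'.coins = s.coins

theorem Agree.refl (p : Prog) (s : State) : Agree p s s :=
  ⟨fun _ _ => rfl, fun _ _ => rfl, fun _ => rfl⟩

theorem Agree.trans {p : Prog} {s s' s'' : State} (h : Agree p s s') (h' : Agree p s' s'') :
    Agree p s s'' :=
  ⟨fun a ha => (h'.nats a ha).trans (h.nats a ha), fun a ha => (h'.reals a ha).trans (h.reals a ha),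
    fun hp => (h'.coins hp).trans (h.coins hp)⟩

theorem Agree.of_subset {p q : Prog} {s s' : State} (h : Agree p s s')
    (hn : p.natTargets ⊆ q.natTargets) (hr : p.realTargets ⊆ q.realTargets)
    (hc : q.coinFree = true → p.coinFree = true) : Agree q s s' :=
  ⟨fun a ha => h.nats a fun h' => ha (hn h'), fun a ha => h.reals a fun h' => ha (hr h'),
    fun hq => h.coins (hc hq)⟩

theorem Agree.seq_left {p q : Prog} {s s' : State} (h : Agree p s s') : Agree (.seq p q) s s' :=
  h.of_subset (by simp [Prog.natTargets]) (by simp [Prog.realTargets])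
    (by simp +contextual [Prog.coinFree])

theorem Agree.seq_right {p q : Prog} {s s' : State} (h : Agree q s s') : Agree (.seq p q) s s' :=
  h.of_subset (by simp [Prog.natTargets]) (by simp [Prog.realTargets])
    (by simp +contextual [Prog.coinFree])

theorem Agree.setNat (a : ℕ) (i e : NExpr) (s : State) (x v : ℕ) :
    Agree (.setNat a i e) s (s.setNat a x v) := by
  refine ⟨fun b hb => ?_, fun _ _ => rfl, fun _ => rfl⟩
  have : b ≠ a := by simpa [Prog.natTargets] using hb
  funext j
  simp [State.setNat, this]

/-- The frame rule: cells that do not occur as targets in the program text are unchanged. It reduces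
all later non-interference claims to membership questions closed by `decide`. -/
theorem Exec.agree {p : Prog} {s s' : State} {τ : ℕ} (h : Exec p s s' τ) : Agree p s s' := by
  induction h with
  | skip s => exact .refl _ _
  | setNat a i e s => exact .setNat ..
  | setReal a i j e s =>
    refine ⟨fun _ _ => rfl, fun b hb => ?_, fun _ => rfl⟩
    have : b ≠ a := by simpa [Prog.realTargets] using hb
    funext x y
    simp [State.setReal, this]
  | flip a i s =>
    refine ⟨fun b hb => ?_, fun _ _ => rfl, fun h => by simp [Prog.coinFree] at h⟩
    have : b ≠ a := by simpa [Prog.natTargets] using hb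
    funext x
    simp [State.flip, State.setNat, this]
  | seq _ _ ih₁ ih₂ => exact ih₁.seq_left.trans ih₂.seq_right
  | branchTrue _ _ ih =>
    exact ih.of_subset (by simp [Prog.natTargets]) (by simp [Prog.realTargets])
      (by simp +contextual [Prog.coinFree])
  | branchFalse _ _ ih =>
    exact ih.of_subset (by simp [Prog.natTargets]) (by simp [Prog.realTargets])
      (by simp +contextual [Prog.coinFree])
  | loopDone _ => exact .refl _ _
  | loopStep _ _ _ ih₁ ih₂ =>
    exact (ih₁.of_subset (by simp [Prog.natTargets]) (by simp [Prog.realTargets])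
      (by simp [Prog.coinFree])).trans ih₂

theorem Run.mono {B : ℕ} {p : Prog} {s : State} {Q Q' : State → Prop} (h : Run B p s Q)
    (hQ : ∀ s', Agree p s s' → Q s' → Q' s') : Run B p s Q' := by
  obtain ⟨s', τ, he, ht, hq⟩ := h
  exact ⟨s', τ, he, ht, hQ s' he.agree hq⟩

theorem Run.skip {B : ℕ} {s : State} {Q : State → Prop} (h : Q s) : Run B .skip s Q :=
  ⟨s, 1, .skip s, le_rfl, h⟩

theorem Run.setNat {B a : ℕ} {i e : NExpr} {s : State} {Q : State → Prop}
    (h : Q (s.setNat a (i.eval s) (e.eval s))) : Run B (.setNat a i e) s Q :=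
  ⟨_, _, .setNat a i e s, le_rfl, h⟩

theorem Run.setReal {B a : ℕ} {i j : NExpr} {e : RExpr} {s : State} {Q : State → Prop}
    (h : Q (s.setReal a (i.eval s) (j.eval s) (e.eval s))) : Run B (.setReal a i j e) s Q :=
  ⟨_, _, .setReal a i j e s, le_rfl, h⟩

theorem Run.flip {B a : ℕ} {i : NExpr} {s : State} {Q : State → Prop}
    (h : Q (s.flip a (i.eval s))) : Run B (.flip a i) s Q :=
  ⟨_, _, .flip a i s, le_rfl, h⟩

theorem Run.seq {B : ℕ} {p q : Prog} {s : State} {Q : State → Prop}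
    (h : Run B p s fun s' => Run B q s' Q) : Run B (.seq p q) s Q := by
  obtain ⟨s', τ, he, ht, s'', τ', he', ht', hq⟩ := h
  exact ⟨s'', _, he.seq he', by rw [Prog.timeBound]; lia, hq⟩

theorem Run.branch {B : ℕ} {b : BExpr} {p q : Prog} {s : State} {Q : State → Prop}
    (hp : b.Holds s → Run B p s Q) (hq : ¬ b.Holds s → Run B q s Q) :
    Run B (.branch b p q) s Q := by
  by_cases hb : b.Holds s
  · obtain ⟨s', τ, he, ht, h⟩ := hp hb
    exact ⟨s', _, .branchTrue hb he, by rw [Prog.timeBound]; lia, h⟩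
  · obtain ⟨s', τ, he, ht, h⟩ := hq hb
    exact ⟨s', _, .branchFalse hb he, by rw [Prog.timeBound]; lia, h⟩

/-- Started in `s`, the loop halts after at most `m` iterations in a state satisfying `Q`. -/
def LoopRun (B m : ℕ) (b : BExpr) (p : Prog) (s : State) (Q : State → Prop) : Prop :=
  HaltsWithin (.loop b p) s (m * (b.cost + p.timeBound B + 1) + (b.cost + 1)) Q

theorem LoopRun.run {B m : ℕ} {b : BExpr} {p : Prog} {s : State} {Q : State → Prop}
    (h : LoopRun B m b p s Q) (hm : m ≤ B) : Run B (.loop b p) s Q := by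
  obtain ⟨s', τ, he, ht, hq⟩ := h
  refine ⟨s', τ, he, ht.trans ?_, hq⟩
  rw [Prog.timeBound]
  gcongr

theorem LoopRun.done {B m : ℕ} {b : BExpr} {p : Prog} {s : State} {Q : State → Prop}
    (hb : ¬ b.Holds s) (h : Q s) : LoopRun B m b p s Q :=
  ⟨s, _, .loopDone hb, by lia, h⟩

theorem LoopRun.step {B m : ℕ} {b : BExpr} {p : Prog} {s : State} {Q : State → Prop}
    (hb : b.Holds s) (h : Run B p s fun s' => LoopRun B m b p s' Q) :
    LoopRun B (m + 1) b p s Q := by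
  obtain ⟨s', τ, he, ht, s'', τ', he', ht', hq⟩ := h
  exact ⟨s'', _, .loopStep hb he he', by rw [add_mul]; lia, hq⟩

/-! #### Counted loops -/

/-- A scalar variable of natural type: the cell `0` of the array `a`. -/
abbrev nvar (a : ℕ) : NExpr := .get a (.const 0)

/-- A scalar variable of real type: the cell `(0, 0)` of the array `a`. -/
abbrev rvar (a : ℕ) : RExpr := .get a (.const 0) (.const 0)

abbrev natLt (e f : NExpr) : BExpr := .not (.natLe f e)

/-- Advance the scalar variable `v`. -/
abbrev Prog.incr (v : ℕ) : Prog := .setNat v (.const 0) (.add (nvar v) (.const 1))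

/-- Run the body with `v = 0, 1, …` as long as the test `b` holds. -/
abbrev Prog.forWhile (v : ℕ) (b : BExpr) (body : Prog) : Prog :=
  .seq (.setNat v (.const 0) (.const 0)) (.loop b (.seq body (Prog.incr v)))

/-- Run the body with `v = 0, …, e - 1`. -/
abbrev Prog.forLt (v : ℕ) (e : NExpr) (body : Prog) : Prog := Prog.forWhile v (natLt (nvar v) e) body

section Lemmas

variable {B : ℕ}

@[simp] theorem State.setNat_reals (s : State) (a i v : ℕ) : (s.setNat a i v).reals = s.reals := rfl

@[simp] theorem State.setNat_coins (s : State) (a i v : ℕ) : (s.setNat a i v).coins = s.coins := rfl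

@[simp] theorem State.setReal_nats (s : State) (a i j : ℕ) (v : ℝ) :
    (s.setReal a i j v).nats = s.nats := rfl

@[simp] theorem State.setReal_coins (s : State) (a i j : ℕ) (v : ℝ) :
    (s.setReal a i j v).coins = s.coins := rfl

theorem State.setNat_nats (s : State) (a i v a' i' : ℕ) :
    (s.setNat a i v).nats a' i' = if a' = a ∧ i' = i then v else s.nats a' i' := rfl

theorem State.setReal_reals (s : State) (a i j : ℕ) (v : ℝ) (a' i' j' : ℕ) :
    (s.setReal a i j v).reals a' i' j' =
      if a' = a ∧ i' = i ∧ j' = j then v else s.reals a' i' j' := rfl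

theorem State.setNat_nats_of_ne (s : State) {a a' : ℕ} (i v : ℕ) (h : a' ≠ a) :
    (s.setNat a i v).nats a' = s.nats a' := by
  funext; simp [setNat_nats, h]

theorem State.setReal_reals_of_ne (s : State) {a a' : ℕ} (i j : ℕ) (v : ℝ) (h : a' ≠ a) :
    (s.setReal a i j v).reals a' = s.reals a' := by
  funext; simp [setReal_reals, h]

/-- The invariant refers to the moment of the test. The counter is advanced after the body, hence
the body must establish `I (i + 1)` for the state with the counter already updated. Agreement with
the start of the loop is carried along, so that invariants need not mention untouched arrays. -/
theorem Run.forWhile {v N : ℕ} {b : BExpr} {body : Prog} {s : State} (I : ℕ → State → Prop)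
    (hN : N ≤ B) (hv : v ∉ body.natTargets)
    (hb : ∀ i s', i ≤ N → I i s' → s'.nats v 0 = i → Agree (Prog.forWhile v b body) s s' →
      (b.Holds s' ↔ i < N))
    (h0 : I 0 (s.setNat v 0 0))
    (hs : ∀ i s', i < N → I i s' → s'.nats v 0 = i → Agree (Prog.forWhile v b body) s s' →
      Run B body s' fun s'' => I (i + 1) (s''.setNat v 0 (i + 1))) :
    Run B (Prog.forWhile v b body) s (I N) := by
  refine .seq (.setNat (LoopRun.run (m := N) ?_ hN))
  simp only [NExpr.eval]
  have key : ∀ m i s', i + m = N → I i s' → s'.nats v 0 = i → Agree (Prog.forWhile v b body) s s' →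
      LoopRun B m b (.seq body (Prog.incr v)) s' (I N) := by
    intro m
    induction m with
    | zero =>
      intro i s' him hI hi hA
      obtain rfl : i = N := by lia
      exact .done (by rw [hb i s' le_rfl hI hi hA]; lia) hI
    | succ m ih =>
      intro i s' him hI hi hA
      refine .step ((hb i s' (by lia) hI hi hA).2 (by lia)) (.seq ?_)
      refine (hs i s' (by lia) hI hi hA).mono fun s'' hA' hI' => .setNat ?_
      have hi' : s''.nats v 0 = i := by rw [hA'.nats v hv, hi]
      simp only [NExpr.eval, hi']
      refine ih (i + 1) _ (by lia) hI' (by simp [State.setNat_nats]) (hA.trans ?_)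
      refine .trans (s' := s'') ?_ ?_
      · exact hA'.of_subset (by simp [Prog.natTargets]) (by simp [Prog.realTargets])
          (by simp [Prog.coinFree])
      · exact (Agree.setNat v (.const 0) (.const 0) s'' _ _).seq_left
  exact key N 0 _ (by simp) h0 (by simp [State.setNat_nats])
    (Agree.setNat v (.const 0) (.const 0) s _ _).seq_left

theorem Run.forLt {v N : ℕ} {e : NExpr} {body : Prog} {s : State} (I : ℕ → State → Prop)
    (hN : N ≤ B) (hv : v ∉ body.natTargets)
    (he : ∀ s', Agree (Prog.forLt v e body) s s' → e.eval s' = N)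
    (h0 : I 0 (s.setNat v 0 0))
    (hs : ∀ i s', i < N → I i s' → s'.nats v 0 = i → Agree (Prog.forLt v e body) s s' →
      Run B body s' fun s'' => I (i + 1) (s''.setNat v 0 (i + 1))) :
    Run B (Prog.forLt v e body) s (I N) :=
  .forWhile I hN hv (fun i s' _ _ hi hA => by simp [BExpr.Holds, NExpr.eval, hi, he s' hA]) h0 hs

/-- A loop that adds `f i` to the scalar `acc` in its `i`-th iteration. -/
theorem Run.sum {v N acc : ℕ} {e : NExpr} {body : Prog} {s : State} (f : ℕ → ℝ)
    (hN : N ≤ B) (hv : v ∉ body.natTargets)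
    (he : ∀ s', Agree (.seq (.setReal acc (.const 0) (.const 0) (.cast (.const 0)))
      (Prog.forLt v e body)) s s' → e.eval s' = N)
    (hs : ∀ i s', i < N → s'.nats v 0 = i →
      Agree (.seq (.setReal acc (.const 0) (.const 0) (.cast (.const 0)))
        (Prog.forLt v e body)) s s' →
      Run B body s' fun s'' => s''.reals acc 0 0 = s'.reals acc 0 0 + f i) :
    Run B (.seq (.setReal acc (.const 0) (.const 0) (.cast (.const 0))) (Prog.forLt v e body)) s
      fun s' => s'.reals acc 0 0 = ∑ i ∈ Finset.range N, f i := by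
  refine .seq (.setReal ?_)
  have hA0 := (Exec.setReal acc (.const 0) (.const 0) (.cast (.const 0)) s).agree.seq_left
    (q := Prog.forLt v e body)
  refine .forLt (fun i s' => s'.reals acc 0 0 = ∑ i ∈ Finset.range i, f i) hN hv
    (fun s' hA => he s' (hA0.trans hA.seq_right)) ?_ ?_
  · simp [NExpr.eval, RExpr.eval, State.setReal_reals]
  · intro i s' hi hI hvi hA
    refine (hs i s' hi hvi (hA0.trans hA.seq_right)).mono fun s'' _ h => ?_
    rw [State.setNat_reals, h, hI, Finset.sum_range_succ]

/-- A loop that writes `f i` to the cell `(i, J)` of the array `a` in its `i`-th iteration. -/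
theorem Run.map {v N a J : ℕ} {e : NExpr} {body : Prog} {s : State} (f : ℕ → ℝ)
    (hN : N ≤ B) (hv : v ∉ body.natTargets)
    (he : ∀ s', Agree (Prog.forLt v e body) s s' → e.eval s' = N)
    (hs : ∀ i s', i < N → s'.nats v 0 = i → s'.reals a i J = s.reals a i J →
      Agree (Prog.forLt v e body) s s' →
      Run B body s' fun s'' => s''.reals a = (s'.setReal a i J (f i)).reals a) :
    Run B (Prog.forLt v e body) s fun s' => ∀ x y, s'.reals a x y =
      if x < N ∧ y = J then f x else s.reals a x y := by
  refine .forLt (fun i s' => ∀ x y, s'.reals a x y =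
      if x < i ∧ y = J then f x else s.reals a x y) hN hv he (by simp) ?_
  intro i s' hi hI hvi hA
  refine (hs i s' hi hvi (by simp [hI]) hA).mono fun s'' _ h x y => ?_
  rw [State.setNat_reals, h, State.setReal_reals, hI]
  grind

end Lemmas

/-! #### Locality of the coin tape -/

def State.withCoins (s : State) (ω : ℕ → Bool) : State := { s with coins := ω }

/-- The tape that starts with the first `m` coins of `ω` and goes on with `ρ`. -/
def appendCoins (m : ℕ) (ω ρ : ℕ → Bool) : ℕ → Bool := fun i => if i < m then ω i else ρ (i - m)

theorem NExpr.eval_withCoins (e : NExpr) (s : State) (ω : ℕ → Bool) :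
    e.eval (s.withCoins ω) = e.eval s := by
  induction e <;> simp_all [NExpr.eval, State.withCoins]

theorem RExpr.eval_withCoins (e : RExpr) (s : State) (ω : ℕ → Bool) :
    e.eval (s.withCoins ω) = e.eval s := by
  induction e <;> simp_all [RExpr.eval, NExpr.eval_withCoins]
  simp [State.withCoins]

theorem BExpr.holds_withCoins (b : BExpr) (s : State) (ω : ℕ → Bool) :
    b.Holds (s.withCoins ω) ↔ b.Holds s := by
  induction b <;> simp_all [BExpr.Holds, NExpr.eval_withCoins, RExpr.eval_withCoins]

/-- Expressions never look at the tape; only `flip` reads its head. So a run that consumes `m` coins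
is repeated verbatim on every tape with the same first `m` coins. -/
theorem Exec.exists_local {p : Prog} {s s' : State} {τ : ℕ} (h : Exec p s s' τ) :
    ∃ m, (s'.coins = fun i => s.coins (i + m)) ∧ ∀ ω : ℕ → Bool, (∀ i < m, ω i = s.coins i) →
      Exec p (s.withCoins ω) (s'.withCoins fun i => ω (i + m)) τ := by
  induction h with
  | skip s => exact ⟨0, rfl, fun ω _ => .skip _⟩
  | setNat a i e s =>
    refine ⟨0, rfl, fun ω _ => ?_⟩
    have := Exec.setNat a i e (s.withCoins ω)
    rwa [NExpr.eval_withCoins, NExpr.eval_withCoins] at this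
  | setReal a i j e s =>
    refine ⟨0, rfl, fun ω _ => ?_⟩
    have := Exec.setReal a i j e (s.withCoins ω)
    rwa [NExpr.eval_withCoins, NExpr.eval_withCoins, RExpr.eval_withCoins] at this
  | flip a i s =>
    refine ⟨1, rfl, fun ω hω => ?_⟩
    have := Exec.flip a i (s.withCoins ω)
    rw [NExpr.eval_withCoins] at this
    convert this using 1
    simp [State.flip, State.withCoins, State.setNat, hω]
  | @seq p q s s' s'' τ τ' _ _ ih₁ ih₂ =>
    obtain ⟨m₁, h₁, ih₁⟩ := ih₁
    obtain ⟨m₂, h₂, ih₂⟩ := ih₂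
    refine ⟨m₂ + m₁, ?_, fun ω hω => ?_⟩
    · rw [h₂, h₁]; funext i; simp only [add_assoc]
    · have e₂ := ih₂ (fun i => ω (i + m₁)) (fun i hi => by rw [h₁, hω _ (by lia)])
      have e₁ := ih₁ ω (fun i hi => hω i (by lia))
      convert e₁.seq e₂ using 2
      funext i
      rw [add_assoc]
  | branchTrue hb _ ih =>
    obtain ⟨m, h, ih⟩ := ih
    exact ⟨m, h, fun ω hω => .branchTrue ((BExpr.holds_withCoins _ _ _).2 hb) (ih ω hω)⟩
  | branchFalse hb _ ih =>
    obtain ⟨m, h, ih⟩ := ih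
    exact ⟨m, h, fun ω hω => .branchFalse (mt (BExpr.holds_withCoins _ _ _).1 hb) (ih ω hω)⟩
  | loopDone hb =>
    exact ⟨0, rfl, fun ω _ => .loopDone (mt (BExpr.holds_withCoins _ _ _).1 hb)⟩
  | loopStep hb _ _ ih₁ ih₂ =>
    obtain ⟨m₁, h₁, ih₁⟩ := ih₁
    obtain ⟨m₂, h₂, ih₂⟩ := ih₂
    refine ⟨m₂ + m₁, ?_, fun ω hω => ?_⟩
    · rw [h₂, h₁]; funext i; simp only [add_assoc]
    · have e₂ := ih₂ (fun i => ω (i + m₁)) (fun i hi => by rw [h₁, hω _ (by lia)])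
      have e₁ := ih₁ ω (fun i hi => hω i (by lia))
      convert Exec.loopStep ((BExpr.holds_withCoins _ _ ω).2 hb) e₁ e₂ using 2
      funext i
      rw [add_assoc]

/-- A tape that differs from all its shifts. -/
def markedTape : ℕ → Bool := fun i => decide (i = 0)

/-- If a program always consumes exactly `K` coins, then apart from the tape its final state
depends only on these. -/
theorem Run.exists_split {B K : ℕ} {p : Prog} {s : State} {Q : (ℕ → Bool) → State → Prop}
    (h : ∀ ω, Run B p (s.withCoins ω) fun s' => (s'.coins = fun i => ω (i + K)) ∧ Q ω s')
    (ω : ℕ → Bool) : ∃ s₁, Q (appendCoins K ω markedTape) s₁ ∧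
      ∀ ρ, Run B p (s.withCoins (appendCoins K ω ρ)) fun s' => s' = s₁.withCoins ρ := by
  obtain ⟨s₁, τ, he, ht, hc, hq⟩ := h (appendCoins K ω markedTape)
  obtain ⟨m, hm, hl⟩ := he.exists_local
  have hsh : ∀ i, appendCoins K ω markedTape (i + m) = appendCoins K ω markedTape (i + K) :=
    fun i => congrFun (hm.symm.trans hc) i
  -- The actual consumption `m` and the specified consumption `K` produce the same remaining tape.
  -- The single `true` that `markedTape` places right after the first `K` coins can be aligned only
  -- if they are equal.
  obtain rfl : m = K := by
    rcases lt_trichotomy m K with hlt | heq | hgt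
    · have := hsh (K - m)
      simp [appendCoins, markedTape] at this
      lia
    · exact heq
    · have := hsh 0
      simp [appendCoins, markedTape] at this
      lia
  refine ⟨s₁, hq, fun ρ => ⟨_, τ, hl _ fun i hi => ?_, ht, ?_⟩⟩
  · simp [appendCoins, hi, State.withCoins]
  · congr 1
    funext i
    simp [appendCoins]

end RealRAM

/-! ### The Huber function -/

namespace HuberCSS

open Finset

/-- Truncation of `x` to the interval `[-c, c]`. -/
noncomputable def clip (c x : ℝ) : ℝ := if x ≤ c then if -c ≤ x then x else -c else c

/-- The Huber function with threshold `c`, normalised to have second derivative `1` at `0`. -/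
noncomputable def scaledHuber (c x : ℝ) : ℝ :=
  if |x| ≤ c then x ^ 2 / 2 else c * |x| - c ^ 2 / 2

theorem scaledHuber_one (x : ℝ) : scaledHuber 1 x = huber x := by
  simp [scaledHuber, huber]

/-- The Huber function is the infimal convolution of `x ^ 2 / 2` and `c * |x|`: each splitting of
`x` gives an upper bound, and `scaledHuber_eq` says that truncation is an optimal splitting. Most
inequalities below follow by choosing a splitting. -/
theorem scaledHuber_le {c : ℝ} (hc : 0 ≤ c) (x w : ℝ) :
    scaledHuber c x ≤ (x - w) ^ 2 / 2 + c * |w| := by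
  unfold scaledHuber
  split_ifs with h
  · have h1 : |x| * |w| ≤ c * |w| := by gcongr
    have h2 : x * w ≤ |x| * |w| := (le_abs_self _).trans_eq (abs_mul x w)
    nlinarith [sq_nonneg w]
  · have h1 : |x| ≤ |x - w| + |w| := by
      simpa using abs_add_le (x - w) w
    nlinarith [sq_nonneg (|x - w| - c), sq_abs (x - w)]

theorem scaledHuber_eq {c : ℝ} (hc : 0 ≤ c) (x : ℝ) :
    scaledHuber c x = clip c x ^ 2 / 2 + c * |x - clip c x| := by
  unfold scaledHuber clip
  split_ifs with h h1 h2 h2 h1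
  · simp
  · exact absurd (abs_le.1 h).1 h2
  · exact absurd (abs_le.1 h).2 h1
  · exact absurd (abs_le.2 ⟨h1, h2⟩) h
  · rw [abs_of_neg (by linarith), abs_of_neg (by linarith)]; ring
  · rw [abs_of_pos (by linarith), abs_of_pos (by linarith)]; ring

/-- Smoothness with constant `1`, the derivative being `clip c`: the linear part of the optimal
splitting of `u` is also used for `u - δ`. -/
theorem scaledHuber_sub_le {c : ℝ} (hc : 0 ≤ c) (u δ : ℝ) :
    scaledHuber c (u - δ) ≤ scaledHuber c u - clip c u * δ + δ ^ 2 / 2 := by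
  have := scaledHuber_le hc (u - δ) (u - clip c u)
  rw [scaledHuber_eq hc u]
  nlinarith

/-- Convexity: the graph lies above its tangent, whose slope is `clip c u`. -/
theorem le_scaledHuber_sub {c : ℝ} (hc : 0 ≤ c) (u e : ℝ) :
    scaledHuber c u - clip c u * e ≤ scaledHuber c (u - e) := by
  rw [scaledHuber_eq hc u, scaledHuber_eq hc (u - e)]
  have h1 : ∀ g y : ℝ, |g| ≤ c → g * y ≤ c * |y| := fun g y hg =>
    (le_abs_self _).trans (by rw [abs_mul]; gcongr)
  have hg : |clip c u| ≤ c := by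
    unfold clip; split_ifs with h h' <;> rw [abs_le] <;> constructor <;> linarith
  have h2 := h1 (clip c u) (u - e - clip c (u - e)) hg
  have h3 : c * |u - clip c u| = clip c u * (u - clip c u) := by
    unfold clip
    split_ifs with h h'
    · simp
    · rw [abs_of_neg (by linarith)]; ring
    · rw [abs_of_pos (by linarith)]
  nlinarith [sq_nonneg (clip c u - clip c (u - e))]

theorem huber_nonneg (x : ℝ) : 0 ≤ huber x := by
  unfold huber
  split_ifs with h
  · positivity
  · linarith

theorem huber_zero : huber 0 = 0 := by simp [huber]

theorem huber_le_abs (x : ℝ) : huber x ≤ |x| := by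
  unfold huber
  split_ifs with h
  · nlinarith [abs_nonneg x, sq_abs x]
  · linarith

theorem abs_le_huber_add (x : ℝ) : |x| ≤ huber x + 1 / 2 := by
  unfold huber
  split_ifs with h
  · nlinarith [sq_nonneg (|x| - 1), sq_abs x]
  · linarith

theorem sq_le_mul_huber {x K : ℝ} (hK : 1 ≤ K) (hx : |x| ≤ K) : x ^ 2 ≤ 2 * K * huber x := by
  unfold huber
  split_ifs with h
  · nlinarith [sq_nonneg x]
  · rw [← sq_abs]; nlinarith [abs_nonneg x]

/-- The splitting that is optimal for threshold `1` is admissible for threshold `c`. Together with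
the next lemma this compares the rescaled loss with `c` times the original one, up to an additive
error `c ^ 2 / 2` per entry. -/
theorem scaledHuber_le_mul_huber {c : ℝ} (hc : 1 ≤ c) (x : ℝ) : scaledHuber c x ≤ c * huber x := by
  have h := scaledHuber_le (by linarith : 0 ≤ c) x (x - clip 1 x)
  have h2 := scaledHuber_eq zero_le_one x
  rw [scaledHuber_one] at h2
  rw [h2]
  nlinarith [sq_nonneg (clip 1 x)]

theorem mul_huber_le_scaledHuber {c : ℝ} (hc : 1 ≤ c) (x : ℝ) :
    c * huber x ≤ scaledHuber c x + c ^ 2 / 2 := by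
  have h1 := huber_le_abs x
  unfold scaledHuber
  split_ifs with h
  · nlinarith [sq_nonneg (|x| - c), sq_abs x]
  · nlinarith

/-- The Huber function of a linear combination with square-summable coefficients. -/
theorem huber_sum_le {ι : Type*} (s : Finset ι) (c x : ι → ℝ) (hc : ∑ j ∈ s, c j ^ 2 ≤ 2) :
    huber (∑ j ∈ s, c j * x j) ≤ 2 * ∑ j ∈ s, huber (x j) := by
  -- Split every `x j` optimally and combine the parts: the truncated parts go to the quadratic
  -- term, where Cauchy–Schwarz applies, and the remainders to the linear term, where `|c j| ≤ 2` is
  -- enough.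
  have h := scaledHuber_le zero_le_one (∑ j ∈ s, c j * x j) (∑ j ∈ s, c j * (x j - clip 1 (x j)))
  rw [scaledHuber_one, one_mul, ← sum_sub_distrib] at h
  have e : ∀ j, huber (x j) = clip 1 (x j) ^ 2 / 2 + |x j - clip 1 (x j)| := fun j => by
    rw [← scaledHuber_one, scaledHuber_eq zero_le_one, one_mul]
  have h1 : (∑ j ∈ s, c j * clip 1 (x j)) ^ 2 ≤ 2 * ∑ j ∈ s, clip 1 (x j) ^ 2 :=
    (sum_mul_sq_le_sq_mul_sq s c _).trans (by gcongr)
  have h2 : |∑ j ∈ s, c j * (x j - clip 1 (x j))| ≤ ∑ j ∈ s, 2 * |x j - clip 1 (x j)| := by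
    refine (abs_sum_le_sum_abs _ _).trans (sum_le_sum fun j hj => ?_)
    rw [abs_mul]
    gcongr
    have : c j ^ 2 ≤ 2 := (single_le_sum (fun i _ => sq_nonneg (c i)) hj).trans hc
    exact abs_le_of_sq_le_sq (by nlinarith) (by norm_num)
  have h3 : ∑ j ∈ s, (c j * x j - c j * (x j - clip 1 (x j))) = ∑ j ∈ s, c j * clip 1 (x j) :=
    sum_congr rfl fun j _ => by ring
  rw [h3] at h
  simp only [e, sum_add_distrib, ← sum_div, mul_add]
  rw [← mul_sum] at h2
  linarith

/-! ### Regression by preconditioned gradient descent -/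

/-- The Huber loss of the first `n` entries of a vector. -/
noncomputable def vecLoss (n : ℕ) (r : ℕ → ℝ) : ℝ := ∑ i ∈ range n, huber (r i)

theorem vecLoss_nonneg (n : ℕ) (r : ℕ → ℝ) : 0 ≤ vecLoss n r :=
  sum_nonneg fun _ _ => huber_nonneg _

/-- The scaled Huber loss of the first `n` entries of a vector. -/
noncomputable def scaledLoss (n : ℕ) (c : ℝ) (r : ℕ → ℝ) : ℝ := ∑ i ∈ range n, scaledHuber c (r i)

/-- The inner product of the first `n` entries. -/
def dot (n : ℕ) (u w : ℕ → ℝ) : ℝ := ∑ i ∈ range n, u i * w i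

/-- Smoothness at `δ` minus the tangent bound at `e` leaves the product of `clip c r - δ` and `e -
δ` plus a difference of squares. The product vanishes when `δ` is the projection of the gradient on
a space containing `e`. -/
theorem scaledLoss_step {n : ℕ} {c : ℝ} (hc : 0 ≤ c) {r δ e : ℕ → ℝ}
    (h : dot n (fun i => clip c (r i) - δ i) (fun i => e i - δ i) = 0) :
    scaledLoss n c (fun i => r i - δ i) - scaledLoss n c (fun i => r i - e i) ≤
      (∑ i ∈ range n, e i ^ 2 - ∑ i ∈ range n, (e i - δ i) ^ 2) / 2 := by
  have key : ∑ i ∈ range n, (scaledHuber c (r i - δ i) - scaledHuber c (r i - e i)) ≤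
      ∑ i ∈ range n, ((clip c (r i) - δ i) * (e i - δ i) + (e i ^ 2 - (e i - δ i) ^ 2) / 2) := by
    refine sum_le_sum fun i _ => ?_
    have h1 := scaledHuber_sub_le hc (r i) (δ i)
    have h2 := le_scaledHuber_sub hc (r i) (e i)
    nlinarith
  rw [sum_add_distrib, sum_sub_distrib, ← sum_div, sum_sub_distrib] at key
  unfold dot at h
  unfold scaledLoss
  linarith

/-- The progress guarantee of `τ` steps of gradient descent that lead from the residual `r₀` to the
residual `r`, where the admissible residuals are those satisfying `V`. -/
structure Descent (n : ℕ) (c : ℝ) (V : (ℕ → ℝ) → Prop) (r₀ : ℕ → ℝ) (τ : ℕ) (r : ℕ → ℝ) :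
    Prop where
  le : scaledLoss n c r ≤ scaledLoss n c r₀
  bound : ∀ z, V z → τ * (scaledLoss n c r - scaledLoss n c z) +
    (∑ i ∈ range n, (r i - z i) ^ 2) / 2 ≤ (∑ i ∈ range n, (r₀ i - z i) ^ 2) / 2

theorem Descent.zero (n : ℕ) (c : ℝ) (V : (ℕ → ℝ) → Prop) (r₀ : ℕ → ℝ) : Descent n c V r₀ 0 r₀ :=
  ⟨le_rfl, fun z _ => by simp⟩

/-- The distances to `z` telescope. Comparison with `r` itself shows that the loss does not
increase, so the newest loss can replace all earlier ones in the sum. -/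
theorem Descent.succ {n : ℕ} {c : ℝ} (hc : 0 ≤ c) {V : (ℕ → ℝ) → Prop} {r₀ r δ : ℕ → ℝ} {τ : ℕ}
    (h : Descent n c V r₀ τ r) (hr : V r)
    (hδ : ∀ z, V z → dot n (fun i => clip c (r i) - δ i) (fun i => r i - z i - δ i) = 0) :
    Descent n c V r₀ (τ + 1) (fun i => r i - δ i) := by
  have mono : scaledLoss n c (fun i => r i - δ i) ≤ scaledLoss n c r := by
    have := scaledLoss_step hc (r := r) (δ := δ) (e := fun i => r i - r i) (hδ r hr)
    simp only [sub_self, sub_zero, zero_sub, even_two.neg_pow] at this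
    have h0 : 0 ≤ ∑ i ∈ range n, δ i ^ 2 := sum_nonneg fun _ _ => sq_nonneg _
    have h1 : ∑ i ∈ range n, (0 : ℝ) ^ 2 = 0 := by simp
    rw [h1] at this
    linarith
  refine ⟨mono.trans h.le, fun z hz => ?_⟩
  have h1 := scaledLoss_step hc (r := r) (δ := δ) (e := fun i => r i - z i) (hδ z hz)
  simp only [sub_sub_cancel] at h1
  have h2 := h.bound z hz
  have h3 : (τ : ℝ) * (scaledLoss n c (fun i => r i - δ i) - scaledLoss n c z) ≤
      τ * (scaledLoss n c r - scaledLoss n c z) := by gcongr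
  have h4 : ∑ i ∈ range n, (r i - z i - δ i) ^ 2 = ∑ i ∈ range n, (r i - δ i - z i) ^ 2 :=
    sum_congr rfl fun i _ => by ring
  push_cast
  linarith

/-- The threshold used in gradient descent started at the residual `r₀`. -/
noncomputable def threshold (n : ℕ) (F : ℝ) : ℝ := if F / (n * n) ≤ 1 then 1 else F / (n * n)

theorem one_le_threshold (n : ℕ) (F : ℝ) : 1 ≤ threshold n F := by
  unfold threshold; split_ifs <;> linarith

/-- The orthogonality hypothesis says that the start is the least squares residual, so by Pythagoras
the initial distance to `z` is at most the norm of `z`. It remains to bound that norm by the Huber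
loss `E` of `z`; the threshold, which depends on the starting loss `F`, is chosen to make this
possible. -/
theorem Descent.vecLoss_le {n : ℕ} {V : (ℕ → ℝ) → Prop} {r₀ r z : ℕ → ℝ}
    (h : Descent n (threshold n (vecLoss n r₀)) V r₀ (2 * n * n + 1) r) (hz : V z)
    (horth : dot n r₀ (fun i => r₀ i - z i) = 0) : vecLoss n r ≤ 3 * vecLoss n z := by
  set F := vecLoss n r₀ with hF
  set E := vecLoss n z with hE
  have hF0 : 0 ≤ F := vecLoss_nonneg _ _
  have hE0 : 0 ≤ E := vecLoss_nonneg _ _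
  have pyth : ∑ i ∈ range n, r₀ i ^ 2 + ∑ i ∈ range n, (r₀ i - z i) ^ 2 = ∑ i ∈ range n, z i ^ 2 := by
    have : ∑ i ∈ range n, (r₀ i ^ 2 + (r₀ i - z i) ^ 2 - z i ^ 2) = ∑ i ∈ range n,
        2 * (r₀ i * (r₀ i - z i)) := sum_congr rfl fun i _ => by ring
    rw [← mul_sum, sum_sub_distrib, sum_add_distrib] at this
    unfold dot at horth
    linarith
  have hsq : ∀ u : ℕ → ℝ, 0 ≤ ∑ i ∈ range n, u i ^ 2 := fun u => sum_nonneg fun _ _ => sq_nonneg _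
  have h0 := hsq r₀
  have h1 := hsq (fun i => r₀ i - z i)
  have h2 := hsq (fun i => r i - z i)
  have hb := h.bound z hz
  have hm := h.le
  set c := threshold n F with hc
  have hc1 : 1 ≤ c := one_le_threshold n F
  push_cast at hb
  have hn0 : (0 : ℝ) ≤ n := by positivity
  have hTc : scaledLoss n c r₀ ≤ c * F := by
    rw [hF, vecLoss, mul_sum]
    exact sum_le_sum fun i _ => scaledHuber_le_mul_huber hc1 _
  have hzc : scaledLoss n c z ≤ c * E := by
    rw [hE, vecLoss, mul_sum]
    exact sum_le_sum fun i _ => scaledHuber_le_mul_huber hc1 _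
  -- If the start has loss at most `n ^ 2`, the threshold is `1` and the descent is for the true
  -- loss. The case `n = 0` falls here, as division by zero gives zero.
  by_cases hcase : F / (n * n) ≤ 1
  · have hc' : c = 1 := by rw [hc, threshold, if_pos hcase]
    have hv : ∀ u, scaledLoss n c u = vecLoss n u := fun u => by
      simp [scaledLoss, vecLoss, hc', scaledHuber_one]
    rw [hv, hv, ← hF] at hm
    rw [hv, hv, ← hE] at hb
    have hFn : F ≤ n * n := by
      rcases Nat.eq_zero_or_pos n with rfl | hn
      · simp [hF, vecLoss]
      · have : (0 : ℝ) < n * n := by positivity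
        rwa [div_le_one this] at hcase
    -- With all entries of `z` at most `n ^ 2 + 1`, squares are controlled by the Huber loss and the
    -- `2 n ^ 2 + 1` steps suffice. An entry beyond that makes `E` exceed `F`, and monotonicity of
    -- the descent suffices.
    by_cases hbig : ∀ i ∈ range n, |z i| ≤ n * n + 1
    · have hz2 : ∑ i ∈ range n, z i ^ 2 ≤ 2 * (n * n + 1) * E := by
        rw [hE, vecLoss, mul_sum]
        exact sum_le_sum fun i hi => sq_le_mul_huber (by nlinarith) (hbig i hi)
      by_contra! hcon
      nlinarith [mul_nonneg hn0 hn0, mul_nonneg (mul_nonneg hn0 hn0) hE0]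
    · push Not at hbig
      obtain ⟨i, hi, hzi⟩ := hbig
      have : huber (z i) ≤ E := single_le_sum (f := fun i => huber (z i))
        (fun i _ => huber_nonneg _) hi
      have := abs_le_huber_add (z i)
      linarith
  · have hc' : c = F / (n * n) := by rw [hc, threshold, if_neg hcase]
    have hnpos : 0 < n := by
      rcases Nat.eq_zero_or_pos n with rfl | hn
      · simp at hcase
      · exact hn
    have hn1 : (1 : ℝ) ≤ n := by exact_mod_cast hnpos
    have hnn : (0 : ℝ) < n * n := by positivity
    have hcF : c * (n * n) = F := by rw [hc']; field_simp
    have hFn : (n : ℝ) * n < F := by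
      push Not at hcase
      rwa [one_lt_div hnn] at hcase
    set L := ∑ i ∈ range n, |z i| with hL
    have hL0 : 0 ≤ L := sum_nonneg fun _ _ => abs_nonneg _
    have hLE : L ≤ E + n / 2 := by
      calc L ≤ ∑ i ∈ range n, (huber (z i) + 1 / 2) := sum_le_sum fun i _ => abs_le_huber_add _
        _ = E + n / 2 := by rw [sum_add_distrib, hE, vecLoss]; simp; ring
    have hzL : ∑ i ∈ range n, z i ^ 2 ≤ L ^ 2 := by
      rw [hL]
      calc ∑ i ∈ range n, z i ^ 2 = ∑ i ∈ range n, |z i| ^ 2 := by simp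
        _ ≤ _ := sum_sq_le_sq_sum_of_nonneg fun i _ => abs_nonneg _
    -- The chain is entrywise norm, Cauchy–Schwarz, minimality of least squares, and the comparison
    -- of the two norms of `z`. Since `F > n ^ 2`, the additive `n / 2` in `hLE` can then be
    -- absorbed.
    have hFL : F ≤ n * L := by
      have e1 : F ≤ ∑ i ∈ range n, |r₀ i| := sum_le_sum fun i _ => huber_le_abs _
      have e2 : (∑ i ∈ range n, |r₀ i|) ^ 2 ≤ n * ∑ i ∈ range n, r₀ i ^ 2 := by
        have := sq_sum_le_card_mul_sum_sq (s := range n) (f := fun i => |r₀ i|)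
        simpa using this
      have e3 : n * ∑ i ∈ range n, r₀ i ^ 2 ≤ (n * L) ^ 2 := by
        have : ∑ i ∈ range n, r₀ i ^ 2 ≤ L ^ 2 := by linarith
        nlinarith [sq_nonneg L]
      exact e1.trans (abs_le_of_sq_le_sq' (e2.trans e3) (by positivity)).2
    have hFE : F ≤ 2 * n * E := by
      have := mul_le_mul_of_nonneg_left hLE hn0
      linarith
    -- The cost of returning to threshold `1`. After division by `c` it is `n * c / 2`, which is at
    -- most `E` because `n * n * c = F ≤ 2 * n * E`.
    have herr : c * vecLoss n r ≤ scaledLoss n c r + n * (c ^ 2 / 2) := by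
      calc c * vecLoss n r ≤ ∑ i ∈ range n, (scaledHuber c (r i) + c ^ 2 / 2) := by
            rw [vecLoss, mul_sum]
            exact sum_le_sum fun i _ => mul_huber_le_scaledHuber hc1 _
        _ = _ := by rw [sum_add_distrib, scaledLoss]; simp
    have hncE : n * c / 2 ≤ E := by
      have : n * (n * c / 2) ≤ n * E := by
        have : n * (n * c / 2) = F / 2 := by rw [← hcF]; ring
        linarith
      exact le_of_mul_le_mul_left this (by linarith)
    suffices scaledLoss n c r ≤ 2 * (c * E) by
      have : c * vecLoss n r ≤ c * (3 * E) := by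
        have := mul_le_mul_of_nonneg_left hncE (by linarith : 0 ≤ c)
        linarith
      exact le_of_mul_le_mul_left this (by linarith)
    rcases le_total F E with hle | hle
    · have e1 := mul_le_mul_of_nonneg_left hle (by linarith : 0 ≤ c)
      have e2 : 0 ≤ c * E := by positivity
      linarith
    · have hL2 : L ≤ 2 * E := by
        have : (n : ℝ) * 1 ≤ n * c := by gcongr
        linarith
      have hkey : ∑ i ∈ range n, (r₀ i - z i) ^ 2 ≤ 4 * (E * F) := by
        have e1 : L ^ 2 ≤ (2 * E) ^ 2 := by gcongr
        have e2 : E * E ≤ E * F := by gcongr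
        linarith
      -- Since `c * n ^ 2 = F`, the `2 n ^ 2` steps alone use up the bound `2 * E * F` on the
      -- distance; the extra step forces `E = 0`, hence `F = 0`, against `F > n ^ 2`.
      by_contra! hcon
      have h5 : c * E ≤ scaledLoss n c r - scaledLoss n c z := by linarith
      have h6 : (2 * n * n + 1) * (c * E) ≤ 2 * (E * F) := by
        have := mul_le_mul_of_nonneg_left h5 (by positivity : (0 : ℝ) ≤ 2 * n * n + 1)
        linarith
      have h7 : (2 * n * n + 1) * (c * E) = 2 * (E * F) + c * E := by rw [← hcF]; ring
      have hcE : c * E ≤ 0 := by linarith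
      have : E = 0 := by
        have : 0 ≤ (c - 1) * E := mul_nonneg (by linarith) hE0
        linarith
      rw [this] at hFE
      linarith

end HuberCSS

/-! ### Orthogonalisation -/

namespace HuberCSS

open Finset

theorem dot_congr {n : ℕ} {u u' w w' : ℕ → ℝ} (hu : ∀ i < n, u i = u' i) (hw : ∀ i < n, w i = w' i) :
    dot n u w = dot n u' w' :=
  sum_congr rfl fun i hi => by rw [hu i (mem_range.1 hi), hw i (mem_range.1 hi)]

theorem dot_comm (n : ℕ) (u w : ℕ → ℝ) : dot n u w = dot n w u :=
  sum_congr rfl fun _ _ => mul_comm _ _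

theorem dot_sum_right (n d : ℕ) (u : ℕ → ℝ) (w : ℕ → ℕ → ℝ) (c : ℕ → ℝ) :
    dot n u (fun i => ∑ m ∈ range d, w i m * c m) =
      ∑ m ∈ range d, dot n u (fun i => w i m) * c m := by
  simp only [dot, mul_sum, sum_mul]
  rw [sum_comm]
  exact sum_congr rfl fun _ _ => sum_congr rfl fun _ _ => by ring

theorem dot_sub_left (n : ℕ) (u u' w : ℕ → ℝ) :
    dot n (fun i => u i - u' i) w = dot n u w - dot n u' w := by
  simp only [dot, sub_mul, sum_sub_distrib]

theorem dot_sub_right (n : ℕ) (u w w' : ℕ → ℝ) :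
    dot n u (fun i => w i - w' i) = dot n u w - dot n u w' := by
  simp only [dot, mul_sub, sum_sub_distrib]

theorem dot_self_eq_zero {n : ℕ} {u : ℕ → ℝ} (h : dot n u u = 0) : ∀ i < n, u i = 0 := by
  intro i hi
  have := (sum_eq_zero_iff_of_nonneg fun i _ => mul_self_nonneg (u i)).1 h i (mem_range.2 hi)
  simpa using this

/-- The columns of `q` are pairwise orthogonal, are combinations with the coefficients `c` of the
columns of `A` with index in `H`, and span the latter. -/
structure OrthoBasis (n d : ℕ) (A : ℕ → ℕ → ℝ) (H : ℕ → Prop) (q c : ℕ → ℕ → ℝ) : Prop where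
  orth : ∀ l < d, ∀ l' < d, l ≠ l' → dot n (fun i => q i l) (fun i => q i l') = 0
  rep : ∀ l < d, ∀ i < n, q i l = ∑ m ∈ range d, A i m * c m l
  supp : ∀ l < d, ∀ m < d, ¬ H m → c m l = 0
  span : ∀ w, (∀ l < d, dot n w (fun i => q i l) = 0) → ∀ m < d, H m → dot n w (fun i => A i m) = 0

/-- The coefficients of the projection of `v` on orthogonal vectors. -/
noncomputable def projCoeff (n : ℕ) (q : ℕ → ℕ → ℝ) (v : ℕ → ℝ) (l : ℕ) : ℝ :=
  dot n v (fun i => q i l) / dot n (fun i => q i l) (fun i => q i l)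

section OrthoBasis

variable {n d : ℕ} {A : ℕ → ℕ → ℝ} {H : ℕ → Prop} {q c : ℕ → ℕ → ℝ}

theorem OrthoBasis.sum_projCoeff (h : OrthoBasis n d A H q c) (α : ℕ → ℝ) {i : ℕ} (hi : i < n) :
    ∑ l ∈ range d, α l * q i l = ∑ m ∈ range d, A i m * ∑ l ∈ range d, α l * c m l := by
  simp only [mul_sum]
  rw [sum_comm]
  refine sum_congr rfl fun l hl => ?_
  rw [h.rep l (mem_range.1 hl) i hi, mul_sum]
  exact sum_congr rfl fun _ _ => by ring

/-- Each `q l` is orthogonal to the residual, and `span` transfers this to the columns of `A`. The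
basis is orthogonal but not normalised, which avoids square roots, and may contain zero vectors. -/
theorem OrthoBasis.dot_residual (h : OrthoBasis n d A H q c) (v : ℕ → ℝ) {m : ℕ} (hm : m < d)
    (hH : H m) :
    dot n (fun i => v i - ∑ l ∈ range d, projCoeff n q v l * q i l) (fun i => A i m) = 0 := by
  refine h.span _ (fun l hl => ?_) m hm hH
  rw [dot_sub_left, dot_comm n (fun i => ∑ l ∈ range d, projCoeff n q v l * q i l)]
  simp only [mul_comm (projCoeff n q v _)]
  rw [dot_sum_right, sum_eq_single l]
  -- A zero basis vector has coefficient `0 / 0 = 0`, so dependent columns need no special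
  -- treatment.
  · by_cases h0 : dot n (fun i => q i l) (fun i => q i l) = 0
    · have h1 := dot_self_eq_zero h0
      have h2 : dot n v (fun i => q i l) = 0 :=
        sum_eq_zero fun i hi => by simp [h1 i (mem_range.1 hi)]
      rw [h0, h2]; simp
    · rw [projCoeff, mul_div_cancel₀ _ h0, sub_self]
  · intro l' hl' hne
    rw [h.orth l hl l' (mem_range.1 hl') hne.symm, zero_mul]
  · intro hl'
    exact absurd (mem_range.2 hl) hl'

/-- One step of the Gram–Schmidt process. -/
theorem OrthoBasis.extend {j : ℕ} {q' c' : ℕ → ℕ → ℝ} {ξ : ℕ → ℝ} (hj : j < d)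
    (h : OrthoBasis n d A (fun m => H m ∧ m < j) q c)
    (hq0 : ∀ i < n, q i j = 0) (hHj : H j) (hξ : ∀ m < d, ¬ (H m ∧ m < j) → ξ m = 0)
    (hdot : ∀ m < d, H m ∧ m < j →
      dot n (fun i => A i j - ∑ m ∈ range d, A i m * ξ m) (fun i => A i m) = 0)
    (hq' : ∀ l < d, ∀ i < n, q' i l = if l = j then A i j - ∑ m ∈ range d, A i m * ξ m else q i l)
    (hc' : ∀ l < d, ∀ m < d, c' m l =
      if l = j then (if m = j then 1 else 0) - ξ m else c m l) :
    OrthoBasis n d A (fun m => H m ∧ m < j + 1) q' c' := by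
  have hnew : ∀ i < n, q' i j = A i j - ∑ m ∈ range d, A i m * ξ m := fun i hi => by
    rw [hq' j hj i hi, if_pos rfl]
  have hold : ∀ l < d, l ≠ j → ∀ i < n, q' i l = q i l := fun l hl hlj i hi => by
    rw [hq' l hl i hi, if_neg hlj]
  -- The old vectors are combinations of the columns already treated, and the new one is orthogonal
  -- to these columns.
  have hperp : ∀ l < d, l ≠ j → dot n (fun i => q' i j) (fun i => q' i l) = 0 := by
    intro l hl hlj
    rw [dot_congr hnew (hold l hl hlj), dot_congr (fun _ _ => rfl) (h.rep l hl), dot_sum_right]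
    refine sum_eq_zero fun m hm => ?_
    by_cases hH : H m ∧ m < j
    · rw [hdot m (mem_range.1 hm) hH, zero_mul]
    · rw [h.supp l hl m (mem_range.1 hm) hH, mul_zero]
  refine ⟨fun l hl l' hl' hne => ?_, fun l hl i hi => ?_, fun l hl m hm hH => ?_,
    fun w hw m hm hH => ?_⟩
  · by_cases hlj : l = j
    · subst hlj
      exact hperp l' hl' hne.symm
    · by_cases hlj' : l' = j
      · subst hlj'
        rw [dot_comm]
        exact hperp l hl hne
      · rw [dot_congr (hold l hl hlj) (hold l' hl' hlj')]
        exact h.orth l hl l' hl' hne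
  · by_cases hlj : l = j
    · subst hlj
      have : ∑ m ∈ range d, A i m * c' m l =
          ∑ m ∈ range d, A i m * ((if m = l then 1 else 0) - ξ m) :=
        sum_congr rfl fun m hm => by rw [hc' l hl m (mem_range.1 hm), if_pos rfl]
      rw [hnew i hi, this]
      simp [mul_sub, sum_sub_distrib, hl]
    · rw [hold l hl hlj i hi, h.rep l hl i hi]
      exact sum_congr rfl fun m hm => by rw [hc' l hl m (mem_range.1 hm), if_neg hlj]
  · have h1 : ¬ (H m ∧ m < j) := fun h => hH ⟨h.1, by lia⟩
    have h2 : m ≠ j := fun h => hH ⟨h ▸ hHj, by lia⟩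
    rw [hc' l hl m hm]
    split_ifs with hlj
    · simp [hξ m hm h1]
    · exact h.supp l hl m hm h1
  -- The old basis had a zero vector in position `j`, so overwriting it loses nothing of the span.
  · have hspan : ∀ m < d, H m ∧ m < j → dot n w (fun i => A i m) = 0 := by
      refine h.span w fun l hl => ?_
      by_cases hlj : l = j
      · subst hlj
        exact sum_eq_zero fun i hi => by simp [hq0 i (mem_range.1 hi)]
      · rw [← hw l hl]
        exact dot_congr (fun _ _ => rfl) fun i hi => (hold l hl hlj i hi).symm
    by_cases hmj : m = j
    · subst hmj
      have e := hw m hm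
      rw [dot_congr (fun _ _ => rfl) hnew, dot_sub_right, dot_sum_right, sub_eq_zero] at e
      rw [e]
      refine sum_eq_zero fun m' hm' => ?_
      by_cases hH' : H m' ∧ m' < m
      · rw [hspan m' (mem_range.1 hm') hH', zero_mul]
      · rw [hξ m' (mem_range.1 hm') hH', mul_zero]
    · exact hspan m hm ⟨hH.1, by lia⟩

end OrthoBasis

end HuberCSS

/-! ### The numerical subprograms

The arrays of naturals are `0`: input, `1`: output, `2`: columns still to be treated, `3`: columns
chosen in the current trial, `4`: current sample, `5`: columns treated in the current round; those
from `10` on are scalar variables. The arrays of reals are `0`: the matrix, `1`: output, `2`: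
coefficients found in the current trial, `3` and `4`: an orthogonal basis of the span of the sample
and its coefficients, `5`: residual, `6`: vector to be projected, `7`: coefficients of the current
column, `8`: losses of the columns, `9`: coefficients found in the current round; those from `20` on
are scalar variables. -/

namespace HuberCSS

open Finset RealRAM

abbrev rowCount : NExpr := .get 0 (.const 0)

abbrev colCount : NExpr := .get 0 (.const 1)

/-- Set the scalar `acc` to the sum of the values of `e` for `v = 0, …, b - 1`. -/
abbrev sumProg (acc v : ℕ) (b : NExpr) (e : RExpr) : Prog :=
  .seq (.setReal acc (.const 0) (.const 0) (.cast (.const 0)))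
    (.forLt v b (.setReal acc (.const 0) (.const 0) (.add (rvar acc) e)))

/-- Fill the first `b` cells of column `j` of the array `a` with the values of `e`. -/
abbrev fillProg (a v : ℕ) (b j : NExpr) (e : RExpr) : Prog :=
  .forLt v b (.setReal a (nvar v) j e)

/-- Project the vector `6` on the orthogonal basis, subtract the result from the residual and add
its coefficients to the current ones. -/
def project : Prog :=
  .forLt 11 colCount
    (.seq (sumProg 20 10 rowCount
      (.mul (.get 6 (nvar 10) (.const 0)) (.get 3 (nvar 10) (nvar 11))))
    (.seq (sumProg 21 10 rowCount
      (.mul (.get 3 (nvar 10) (nvar 11)) (.get 3 (nvar 10) (nvar 11))))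
    (.seq (.setReal 22 (.const 0) (.const 0) (.div (rvar 20) (rvar 21)))
    (.seq (fillProg 5 10 rowCount (.const 0) (.sub (.get 5 (nvar 10) (.const 0))
      (.mul (rvar 22) (.get 3 (nvar 10) (nvar 11)))))
    (fillProg 7 12 colCount (.const 0) (.add (.get 7 (nvar 12) (.const 0))
      (.mul (rvar 22) (.get 4 (nvar 12) (nvar 11)))))))))

section

variable {B n d : ℕ} {s : State}

theorem run_sumProg {acc v N : ℕ} {b : NExpr} {e : RExpr} (f : ℕ → ℝ) (hN : N ≤ B)
    (hb : ∀ s', Agree (sumProg acc v b e) s s' → b.eval s' = N)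
    (he : ∀ i s', i < N → s'.nats v 0 = i → Agree (sumProg acc v b e) s s' → e.eval s' = f i) :
    Run B (sumProg acc v b e) s fun s' => s'.reals acc 0 0 = ∑ i ∈ range N, f i :=
  .sum f hN (by simp [Prog.natTargets]) hb fun i s' hi hv hA => .setReal (by
    simp [State.setReal_reals, NExpr.eval, RExpr.eval, he i s' hi hv hA])

theorem run_fillProg {a v N J : ℕ} {b j : NExpr} {e : RExpr} (f : ℕ → ℝ) (hN : N ≤ B)
    (hb : ∀ s', Agree (fillProg a v b j e) s s' → b.eval s' = N)
    (hj : ∀ s', Agree (fillProg a v b j e) s s' → j.eval s' = J)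
    (he : ∀ i s', i < N → s'.nats v 0 = i → s'.reals a i J = s.reals a i J →
      Agree (fillProg a v b j e) s s' → e.eval s' = f i) :
    Run B (fillProg a v b j e) s fun s' => ∀ x y, s'.reals a x y =
      if x < N ∧ y = J then f x else s.reals a x y :=
  .map f hN (by simp [Prog.natTargets]) hb fun i s' hi hv ha hA => .setReal (by
    simp [NExpr.eval, he i s' hi hv ha hA, hj s' hA, hv])

theorem run_project (hn : s.nats 0 0 = n) (hd : s.nats 0 1 = d) (hnB : n ≤ B) (hdB : d ≤ B) :
    Run B project s fun s' =>
      (∀ i < n, s'.reals 5 i 0 = s.reals 5 i 0 - ∑ l ∈ range d,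
        projCoeff n (s.reals 3) (fun i => s.reals 6 i 0) l * s.reals 3 i l) ∧
      (∀ m < d, s'.reals 7 m 0 = s.reals 7 m 0 + ∑ l ∈ range d,
        projCoeff n (s.reals 3) (fun i => s.reals 6 i 0) l * s.reals 4 m l) := by
  set α := projCoeff n (s.reals 3) (fun i => s.reals 6 i 0) with hα
  refine .forLt (fun k s' =>
    (∀ i < n, s'.reals 5 i 0 = s.reals 5 i 0 - ∑ l ∈ range k, α l * s.reals 3 i l) ∧
    (∀ m < d, s'.reals 7 m 0 = s.reals 7 m 0 + ∑ l ∈ range k, α l * s.reals 4 m l))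
    hdB (by decide) (fun s' hA => by simp [NExpr.eval, hA.nats 0 (by decide), hd]) (by simp) ?_
  intro l s₁ hl hI hvl hA
  have n1 : s₁.nats 0 = s.nats 0 := hA.nats 0 (by decide)
  have q1 : s₁.reals 3 = s.reals 3 := hA.reals 3 (by decide)
  have c1 : s₁.reals 4 = s.reals 4 := hA.reals 4 (by decide)
  have v1 : s₁.reals 6 = s.reals 6 := hA.reals 6 (by decide)
  refine .seq ((run_sumProg (N := n) (fun i => s.reals 6 i 0 * s.reals 3 i l) hnB ?_ ?_).mono
    fun s₂ hA₂ h₂ => .seq ((run_sumProg (N := n) (fun i => s.reals 3 i l * s.reals 3 i l)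
      hnB ?_ ?_).mono fun s₃ hA₃ h₃ => .seq (.setReal ?_)))
  · intro s' hA'
    simp [NExpr.eval, hA'.nats 0 (by decide), n1, hn]
  · intro i s' _ hi hA'
    simp [NExpr.eval, RExpr.eval, hA'.reals 6 (by decide), hA'.reals 3 (by decide), q1, v1, hi,
      hA'.nats 11 (by decide), hvl]
  · intro s' hA'
    simp [NExpr.eval, hA'.nats 0 (by decide), hA₂.nats 0 (by decide), n1, hn]
  · intro i s' _ hi hA'
    simp [NExpr.eval, RExpr.eval, hA'.reals 3 (by decide), hA₂.reals 3 (by decide), q1, hi,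
      hA'.nats 11 (by decide), hA₂.nats 11 (by decide), hvl]
  have n3 : s₃.nats 0 = s.nats 0 := by
    rw [hA₃.nats 0 (by decide), hA₂.nats 0 (by decide), n1]
  have l3 : s₃.nats 11 0 = l := by
    rw [hA₃.nats 11 (by decide), hA₂.nats 11 (by decide), hvl]
  have q3 : s₃.reals 3 = s.reals 3 := by
    rw [hA₃.reals 3 (by decide), hA₂.reals 3 (by decide), q1]
  have c3 : s₃.reals 4 = s.reals 4 := by
    rw [hA₃.reals 4 (by decide), hA₂.reals 4 (by decide), c1]
  have r3 : s₃.reals 5 = s₁.reals 5 := by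
    rw [hA₃.reals 5 (by decide), hA₂.reals 5 (by decide)]
  have x3 : s₃.reals 7 = s₁.reals 7 := by
    rw [hA₃.reals 7 (by decide), hA₂.reals 7 (by decide)]
  have a3 : s₃.reals 20 0 0 / s₃.reals 21 0 0 = α l := by
    rw [h₃, hA₃.reals 20 (by decide), h₂]
    rfl
  simp only [NExpr.eval, RExpr.eval, a3]
  set s₄ := s₃.setReal 22 0 0 (α l) with hs₄
  have n4 : s₄.nats = s₃.nats := rfl
  have a4 : s₄.reals 22 0 0 = α l := by simp [hs₄, State.setReal_reals]
  have o4 : ∀ a, a ≠ 22 → s₄.reals a = s₃.reals a := fun a ha =>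
    State.setReal_reals_of_ne _ _ _ _ ha
  refine .seq ((run_fillProg (N := n) (J := 0)
    (fun i => s₁.reals 5 i 0 - α l * s.reals 3 i l) hnB ?_ ?_ ?_).mono fun s₅ hA₅ h₅ =>
    (run_fillProg (N := d) (J := 0) (fun m => s₁.reals 7 m 0 + α l * s.reals 4 m l) hdB
      ?_ ?_ ?_).mono fun s₆ hA₆ h₆ => ?_)
  · intro s' hA'
    simp [NExpr.eval, hA'.nats 0 (by decide), n4, n3, hn]
  · intro s' _
    simp [NExpr.eval]
  · intro i s' _ hi hr hA'
    simp [NExpr.eval, RExpr.eval, hr, o4, r3, hi, hA'.reals 22 (by decide), a4,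
      hA'.reals 3 (by decide), q3, hA'.nats 11 (by decide), n4, l3]
  · intro s' hA'
    simp [NExpr.eval, hA'.nats 0 (by decide), hA₅.nats 0 (by decide), n4, n3, hd]
  · intro s' _
    simp [NExpr.eval]
  · intro i s' _ hi hr hA'
    simp [NExpr.eval, RExpr.eval, hr, o4, hi, hA'.reals 22 (by decide), a4,
      hA₅.reals 22 (by decide), hA'.reals 4 (by decide), hA₅.reals 4 (by decide),
      hA₅.reals 7 (by decide), x3, c3, hA'.nats 11 (by decide), hA₅.nats 11 (by decide), n4, l3]
  · constructor
    · intro i hi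
      rw [State.setNat_reals, hA₆.reals 5 (by decide), h₅, if_pos ⟨hi, rfl⟩, hI.1 i hi,
        sum_range_succ]
      ring
    · intro m hm
      rw [State.setNat_reals, h₆, if_pos ⟨hm, rfl⟩, hI.2 m hm, sum_range_succ]
      ring

end

end HuberCSS

/-! ### Programs for orthogonalisation, Huber loss and truncation -/

namespace HuberCSS

open Finset RealRAM

/-- Load column `13` of the matrix into the residual and into the vector to be projected, and clear
the coefficients. -/
def load : Prog :=
  .seq (fillProg 5 10 rowCount (.const 0) (.get 0 (nvar 10) (nvar 13)))
  (.seq (fillProg 6 10 rowCount (.const 0) (.get 0 (nvar 10) (nvar 13)))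
  (fillProg 7 12 colCount (.const 0) (.cast (.const 0))))

/-- Compute an orthogonal basis of the span of the sampled columns. -/
def orthogonalize : Prog :=
  .seq (.forLt 11 colCount
    (.seq (fillProg 3 10 rowCount (nvar 11) (.cast (.const 0)))
      (fillProg 4 12 colCount (nvar 11) (.cast (.const 0)))))
  (.forLt 13 colCount (.branch (.natLe (.const 1) (.get 4 (nvar 13)))
    (.seq load (.seq project
      (.seq (fillProg 3 10 rowCount (nvar 13) (.get 5 (nvar 10) (.const 0)))
      (.seq (fillProg 4 12 colCount (nvar 13)
        (.sub (.cast (.const 0)) (.get 7 (nvar 12) (.const 0))))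
      (.setReal 4 (nvar 13) (nvar 13) (.add (.get 4 (nvar 13) (nvar 13)) (.cast (.const 1))))))))
    .skip))

/-- Compute the Huber loss of the residual. -/
def residualLoss : Prog :=
  .seq (.setReal 23 (.const 0) (.const 0) (.cast (.const 0)))
  (.forLt 10 rowCount
    (.branch (.and (.realLe (.get 5 (nvar 10) (.const 0)) (.cast (.const 1)))
        (.realLe (.sub (.cast (.const 0)) (.cast (.const 1))) (.get 5 (nvar 10) (.const 0))))
      (.setReal 23 (.const 0) (.const 0) (.add (rvar 23)
        (.div (.mul (.get 5 (nvar 10) (.const 0)) (.get 5 (nvar 10) (.const 0)))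
          (.cast (.const 2)))))
      (.branch (.realLe (.cast (.const 0)) (.get 5 (nvar 10) (.const 0)))
        (.setReal 23 (.const 0) (.const 0) (.add (rvar 23)
          (.sub (.get 5 (nvar 10) (.const 0)) (.div (.cast (.const 1)) (.cast (.const 2))))))
        (.setReal 23 (.const 0) (.const 0) (.add (rvar 23)
          (.sub (.sub (.cast (.const 0)) (.get 5 (nvar 10) (.const 0)))
            (.div (.cast (.const 1)) (.cast (.const 2)))))))))

/-- Write the residual, truncated at the scalar `24`, to the vector to be projected. -/
def truncate : Prog :=
  .forLt 10 rowCount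
    (.branch (.realLe (.get 5 (nvar 10) (.const 0)) (rvar 24))
      (.branch (.realLe (.sub (.cast (.const 0)) (rvar 24)) (.get 5 (nvar 10) (.const 0)))
        (.setReal 6 (nvar 10) (.const 0) (.get 5 (nvar 10) (.const 0)))
        (.setReal 6 (nvar 10) (.const 0) (.sub (.cast (.const 0)) (rvar 24))))
      (.setReal 6 (nvar 10) (.const 0) (rvar 24)))

/-- Approximate regression of column `13` on the sampled columns. -/
def regress : Prog :=
  .seq load (.seq project (.seq residualLoss
  (.seq (.setReal 24 (.const 0) (.const 0)
    (.div (rvar 23) (.mul (.cast rowCount) (.cast rowCount))))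
  (.seq (.branch (.realLe (rvar 24) (.cast (.const 1)))
    (.setReal 24 (.const 0) (.const 0) (.cast (.const 1))) .skip)
  (.seq (.forWhile 14 (.not (.realLe
      (.add (.mul (.mul (.cast (.const 2)) (.cast rowCount)) (.cast rowCount)) (.cast (.const 1)))
      (.cast (nvar 14))))
    (.seq truncate project))
  residualLoss)))))

section

variable {B n d : ℕ} {s : State}

theorem run_load {j : ℕ} (hn : s.nats 0 0 = n) (hd : s.nats 0 1 = d) (hj : s.nats 13 0 = j)
    (hnB : n ≤ B) (hdB : d ≤ B) :
    Run B load s fun s' => (∀ i < n, s'.reals 5 i 0 = s.reals 0 i j) ∧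
      (∀ i < n, s'.reals 6 i 0 = s.reals 0 i j) ∧ ∀ m < d, s'.reals 7 m 0 = 0 := by
  refine .seq ((run_fillProg (N := n) (J := 0) (fun i => s.reals 0 i j) hnB ?_ ?_ ?_).mono
    fun s₁ hA₁ h₁ => .seq ((run_fillProg (N := n) (J := 0) (fun i => s.reals 0 i j) hnB
      ?_ ?_ ?_).mono fun s₂ hA₂ h₂ => (run_fillProg (N := d) (J := 0) (fun _ => 0) hdB
        ?_ ?_ ?_).mono fun s₃ hA₃ h₃ => ⟨fun i hi => ?_, fun i hi => ?_, fun m hm => ?_⟩))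
  · intro s' hA'
    simp [NExpr.eval, hA'.nats 0 (by decide), hn]
  · intro s' _
    simp [NExpr.eval]
  · intro i s' _ hi _ hA'
    simp [NExpr.eval, RExpr.eval, hA'.reals 0 (by decide), hA'.nats 13 (by decide), hi, hj]
  · intro s' hA'
    simp [NExpr.eval, hA'.nats 0 (by decide), hA₁.nats 0 (by decide), hn]
  · intro s' _
    simp [NExpr.eval]
  · intro i s' _ hi _ hA'
    simp [NExpr.eval, RExpr.eval, hA'.reals 0 (by decide), hA'.nats 13 (by decide), hi, hj,
      hA₁.reals 0 (by decide), hA₁.nats 13 (by decide)]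
  · intro s' hA'
    simp [NExpr.eval, hA'.nats 0 (by decide), hA₁.nats 0 (by decide), hA₂.nats 0 (by decide), hd]
  · intro s' _
    simp [NExpr.eval]
  · intro i s' _ hi _ hA'
    simp [NExpr.eval, RExpr.eval]
  · rw [hA₃.reals 5 (by decide), hA₂.reals 5 (by decide), h₁, if_pos ⟨hi, rfl⟩]
  · rw [hA₃.reals 6 (by decide), h₂, if_pos ⟨hi, rfl⟩]
  · rw [h₃, if_pos ⟨hm, rfl⟩]

theorem run_residualLoss (hn : s.nats 0 0 = n) (hnB : n ≤ B) :
    Run B residualLoss s fun s' => s'.reals 23 0 0 = vecLoss n fun i => s.reals 5 i 0 := by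
  refine .sum (fun i => huber (s.reals 5 i 0)) hnB (by decide)
    (fun s' hA => by simp [NExpr.eval, hA.nats 0 (by decide), hn]) fun i s' hi hv hA => ?_
  have h5 : s'.reals 5 = s.reals 5 := hA.reals 5 (by decide)
  set x := s.reals 5 i 0 with hx
  refine .branch (fun hb => .setReal ?_) fun hb => .branch (fun hb' => .setReal ?_)
    fun hb' => .setReal ?_
  all_goals
    simp only [BExpr.Holds, NExpr.eval, RExpr.eval, hv, h5, ← hx, Nat.cast_zero, Nat.cast_one,
      Nat.cast_ofNat, zero_sub, State.setReal_reals, and_self, if_true, add_right_inj] at *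
  · rw [huber, if_pos (abs_le.2 ⟨hb.2, hb.1⟩)]; ring
  · rw [huber, if_neg (fun h => hb ⟨(abs_le.1 h).2, (abs_le.1 h).1⟩), abs_of_nonneg hb']
  · rw [huber, if_neg (fun h => hb ⟨(abs_le.1 h).2, (abs_le.1 h).1⟩), abs_of_neg (not_le.1 hb')]

theorem run_truncate (hn : s.nats 0 0 = n) (hnB : n ≤ B) :
    Run B truncate s fun s' => ∀ i < n, s'.reals 6 i 0 = clip (s.reals 24 0 0) (s.reals 5 i 0) := by
  refine Run.mono (.map (a := 6) (J := 0) (fun i => clip (s.reals 24 0 0) (s.reals 5 i 0)) hnB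
    (by decide) (fun s' hA => by simp [NExpr.eval, hA.nats 0 (by decide), hn]) ?_)
    fun s' _ h i hi => by rw [h, if_pos ⟨hi, rfl⟩]
  intro i s' hi hv _ hA
  have h5 : s'.reals 5 = s.reals 5 := hA.reals 5 (by decide)
  have h24 : s'.reals 24 = s.reals 24 := hA.reals 24 (by decide)
  refine .branch (fun hb => .branch (fun hb' => .setReal ?_) fun hb' => .setReal ?_)
    fun hb => .setReal ?_
  all_goals
    simp only [BExpr.Holds, NExpr.eval, RExpr.eval, hv, h5, h24, Nat.cast_zero, zero_sub] at *
    simp [clip, *]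

/-- The vector `w` is a combination of the columns of `A` with index in `H`. -/
def IsComb (n d : ℕ) (A : ℕ → ℕ → ℝ) (H : ℕ → Prop) (ξ w : ℕ → ℝ) : Prop :=
  (∀ m < d, ¬ H m → ξ m = 0) ∧ ∀ i < n, w i = ∑ m ∈ range d, A i m * ξ m

theorem run_project_of_orthoBasis {H : ℕ → Prop} (hn : s.nats 0 0 = n) (hd : s.nats 0 1 = d)
    (hnB : n ≤ B) (hdB : d ≤ B) (h : OrthoBasis n d (s.reals 0) H (s.reals 3) (s.reals 4)) :
    Run B project s fun s' => ∃ ξ δ, IsComb n d (s.reals 0) H ξ δ ∧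
      (∀ m < d, s'.reals 7 m 0 = s.reals 7 m 0 + ξ m) ∧
      (∀ i < n, s'.reals 5 i 0 = s.reals 5 i 0 - δ i) ∧
      ∀ m < d, H m → dot n (fun i => s.reals 6 i 0 - δ i) (fun i => s.reals 0 i m) = 0 := by
  refine (run_project hn hd hnB hdB).mono fun s' _ hs' => ?_
  set α := projCoeff n (s.reals 3) (fun i => s.reals 6 i 0) with hα
  refine ⟨fun m => ∑ l ∈ range d, α l * s.reals 4 m l, fun i => ∑ l ∈ range d, α l * s.reals 3 i l,
    ⟨fun m hm hH => ?_, fun i hi => h.sum_projCoeff α hi⟩, hs'.2, hs'.1,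
    fun m hm hH => h.dot_residual _ hm hH⟩
  exact sum_eq_zero fun l hl => by rw [h.supp l (mem_range.1 hl) m hm hH, mul_zero]

theorem run_orthogonalize (hn : s.nats 0 0 = n) (hd : s.nats 0 1 = d)
    (hnB : n ≤ B) (hdB : d ≤ B) :
    Run B orthogonalize s fun s' =>
      OrthoBasis n d (s.reals 0) (fun m => s.nats 4 m ≠ 0) (s'.reals 3) (s'.reals 4) := by
  refine .seq (Run.mono (.forLt (fun k s' => ∀ l < k, (∀ i < n, s'.reals 3 i l = 0) ∧
    ∀ m < d, s'.reals 4 m l = 0) hdB (by decide)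
    (fun s' hA => by simp [NExpr.eval, hA.nats 0 (by decide), hd]) (by simp) ?_)
    fun s₁ hA₁ h₁ => ?_)
  · intro l s' hl hI hv hA
    refine .seq ((run_fillProg (N := n) (J := l) (fun _ => 0) hnB ?_ ?_ ?_).mono fun s₂ hA₂ h₂ =>
      (run_fillProg (N := d) (J := l) (fun _ => 0) hdB ?_ ?_ ?_).mono
        fun s₃ hA₃ h₃ l' hl' => ⟨fun i hi => ?_, fun m hm => ?_⟩)
    · intro s' hA'
      simp [NExpr.eval, hA'.nats 0 (by decide), hA.nats 0 (by decide), hn]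
    · intro s' hA'
      simp [NExpr.eval, hA'.nats 11 (by decide), hv]
    · simp [NExpr.eval, RExpr.eval]
    · intro s' hA'
      simp [NExpr.eval, hA'.nats 0 (by decide), hA.nats 0 (by decide), hA₂.nats 0 (by decide), hd]
    · intro s' hA'
      simp [NExpr.eval, hA'.nats 11 (by decide), hA₂.nats 11 (by decide), hv]
    · simp [NExpr.eval, RExpr.eval]
    · rw [State.setNat_reals, hA₃.reals 3 (by decide), h₂]
      by_cases h : l' = l
      · simp [h, hi]
      · simp [h, (hI l' (by lia)).1 i hi]
    · rw [State.setNat_reals, h₃, hA₂.reals 4 (by decide)]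
      by_cases h : l' = l
      · simp [h, hm]
      · simp [h, (hI l' (by lia)).2 m hm]
  · have e0 : s₁.nats 0 = s.nats 0 := hA₁.nats 0 (by decide)
    have e4 : s₁.nats 4 = s.nats 4 := hA₁.nats 4 (by decide)
    have eA : s₁.reals 0 = s.reals 0 := hA₁.reals 0 (by decide)
    -- Besides the orthogonal basis of the columns treated so far, the invariant keeps all later
    -- positions at zero: `project` always runs over all `d` positions, and `OrthoBasis.extend`
    -- writes into an empty one.
    refine Run.mono (.forLt (fun j s' => OrthoBasis n d (s.reals 0)
      (fun m => s.nats 4 m ≠ 0 ∧ m < j) (s'.reals 3) (s'.reals 4) ∧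
      ∀ l < d, j ≤ l → (∀ i < n, s'.reals 3 i l = 0) ∧ ∀ m < d, s'.reals 4 m l = 0) hdB (by decide)
      (fun s' hA => by simp [NExpr.eval, hA.nats 0 (by decide), e0, hd]) ?_ ?_) ?_
    · refine ⟨⟨fun l hl l' hl' _ => ?_, fun l hl i hi => ?_, fun l hl m hm _ => ?_, by simp⟩, ?_⟩
      · exact sum_eq_zero fun i hi => by simp [(h₁ l hl).1 i (mem_range.1 hi)]
      · rw [State.setNat_reals, (h₁ l hl).1 i hi]
        exact (sum_eq_zero fun m hm => by simp [(h₁ l hl).2 m (mem_range.1 hm)]).symm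
      · exact (h₁ l hl).2 m hm
      · exact fun l hl _ => h₁ l hl
    · intro j s₂ hj ⟨hI, hI'⟩ hv hA₂
      have f0 : s₂.nats 0 = s.nats 0 := (hA₂.nats 0 (by decide)).trans e0
      have f4 : s₂.nats 4 = s.nats 4 := (hA₂.nats 4 (by decide)).trans e4
      have fA : s₂.reals 0 = s.reals 0 := (hA₂.reals 0 (by decide)).trans eA
      refine .branch (fun hb => ?_) fun hb => .skip ?_
      · have hHj : s.nats 4 j ≠ 0 := by
          simp only [BExpr.Holds, NExpr.eval, hv, f4] at hb
          lia
        refine .seq ((run_load (n := n) (d := d) (j := j) (by rw [f0, hn]) (by rw [f0, hd]) hv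
          hnB hdB).mono fun s₃ hA₃ ⟨hr₃, hv₃, hx₃⟩ => ?_)
        have g0 : s₃.nats 0 = s.nats 0 := (hA₃.nats 0 (by decide)).trans f0
        have gA : s₃.reals 0 = s.reals 0 := (hA₃.reals 0 (by decide)).trans fA
        have gj : s₃.nats 13 0 = j := by rw [hA₃.nats 13 (by decide), hv]
        refine .seq ((run_project_of_orthoBasis (n := n) (d := d)
          (H := fun m => s.nats 4 m ≠ 0 ∧ m < j) (by rw [g0, hn]) (by rw [g0, hd]) hnB hdB
          ?_).mono fun s₄ hA₄ ⟨ξ, δ, hξ, hx₄, hr₄, hd₄⟩ => ?_)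
        · rwa [gA, hA₃.reals 3 (by decide), hA₃.reals 4 (by decide)]
        have k0 : s₄.nats 0 = s.nats 0 := (hA₄.nats 0 (by decide)).trans g0
        have kj : s₄.nats 13 0 = j := by rw [hA₄.nats 13 (by decide), gj]
        refine .seq ((run_fillProg (N := n) (J := j) (fun i => s₄.reals 5 i 0) hnB
          ?_ ?_ ?_).mono fun s₅ hA₅ h₅ => .seq ((run_fillProg (N := d) (J := j)
            (fun m => 0 - s₄.reals 7 m 0) hdB ?_ ?_ ?_).mono fun s₆ hA₆ h₆ => .setReal ?_))
        · intro s' hA'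
          simp [NExpr.eval, hA'.nats 0 (by decide), k0, hn]
        · intro s' hA'
          simp [NExpr.eval, hA'.nats 13 (by decide), kj]
        · intro i s' _ hi _ hA'
          simp [NExpr.eval, RExpr.eval, hi, hA'.reals 5 (by decide)]
        · intro s' hA'
          simp [NExpr.eval, hA'.nats 0 (by decide), hA₅.nats 0 (by decide), k0, hd]
        · intro s' hA'
          simp [NExpr.eval, hA'.nats 13 (by decide), hA₅.nats 13 (by decide), kj]
        · intro i s' _ hi _ hA'
          simp [NExpr.eval, RExpr.eval, hi, hA'.reals 7 (by decide), hA₅.reals 7 (by decide)]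
        have l6 : s₆.nats 13 0 = j := by rw [hA₆.nats 13 (by decide), hA₅.nats 13 (by decide), kj]
        have q4 : s₄.reals 3 = s₂.reals 3 := by
          rw [hA₄.reals 3 (by decide), hA₃.reals 3 (by decide)]
        have c5 : s₅.reals 4 = s₂.reals 4 := by
          rw [hA₅.reals 4 (by decide), hA₄.reals 4 (by decide), hA₃.reals 4 (by decide)]
        have hxξ : ∀ m < d, s₄.reals 7 m 0 = ξ m := fun m hm => by rw [hx₄ m hm, hx₃ m hm, zero_add]
        rw [gA] at hξ hd₄
        simp only [NExpr.eval, RExpr.eval, l6, State.setNat_reals]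
        have Q : ∀ i l, (s₆.setReal 4 j j (s₆.reals 4 j j + (1 : ℕ))).reals 3 i l =
            if i < n ∧ l = j then s₄.reals 5 i 0 else s₂.reals 3 i l := fun i l => by
          rw [State.setReal_reals_of_ne _ _ _ _ (by decide), hA₆.reals 3 (by decide), h₅, q4]
        have C : ∀ m < d, ∀ l, (s₆.setReal 4 j j (s₆.reals 4 j j + (1 : ℕ))).reals 4 m l =
            if l = j then (if m = j then 1 else 0) - ξ m else s₂.reals 4 m l := fun m hm l => by
          rw [State.setReal_reals, h₆, h₆, c5]
          by_cases hl : l = j <;> by_cases hmj : m = j <;> simp [hl, hmj, hm, hj, hxξ]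
          ring
        refine ⟨hI.extend (ξ := ξ) hj (fun i hi => (hI' j hj le_rfl).1 i hi) hHj hξ.1 ?_ ?_ ?_, ?_⟩
        · intro m hm hH
          rw [← hd₄ m hm hH]
          exact dot_congr (fun i hi => by rw [hv₃ i hi, hξ.2 i hi, fA]) fun _ _ => rfl
        · intro l hl i hi
          rw [Q]
          by_cases h : l = j
          · simp only [h, hi, and_self, if_true]
            rw [hr₄ i hi, hr₃ i hi, hξ.2 i hi, fA]
          · simp [h]
        · intro l hl m hm
          exact C m hm l
        · intro l hl hjl
          refine ⟨fun i hi => ?_, fun m hm => ?_⟩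
          · rw [Q, if_neg (by lia)]
            exact (hI' l hl (by lia)).1 i hi
          · rw [C m hm, if_neg (by lia)]
            exact (hI' l hl (by lia)).2 m hm
      · have hHj : s.nats 4 j = 0 := by
          simp only [BExpr.Holds, NExpr.eval, hv, f4] at hb
          lia
        refine ⟨?_, fun l hl hjl => hI' l hl (by lia)⟩
        have : (fun m => s.nats 4 m ≠ 0 ∧ m < j + 1) = fun m => s.nats 4 m ≠ 0 ∧ m < j := by
          funext m
          by_cases h : m = j
          · simp [h, hHj]
          · have : m < j + 1 ↔ m < j := by lia
            rw [this]
        rw [this]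
        exact hI
    · intro s' _ ⟨h, _⟩
      exact ⟨h.orth, h.rep, fun l hl m hm hH => h.supp l hl m hm fun h => hH h.1,
        fun w hw m hm hH => h.span w hw m hm ⟨hH, hm⟩⟩

end

end HuberCSS

/-! ### Correctness of approximate Huber regression -/

namespace HuberCSS

open Finset RealRAM

/-- The residual of column `j` of `A` for the coefficients `x`. -/
def colResidual (d : ℕ) (A : ℕ → ℕ → ℝ) (j : ℕ) (x : ℕ → ℝ) (i : ℕ) : ℝ :=
  A i j - ∑ m ∈ range d, A i m * x m

theorem colResidual_congr {d : ℕ} {A : ℕ → ℕ → ℝ} {j : ℕ} {x y : ℕ → ℝ} (h : ∀ m < d, x m = y m)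
    (i : ℕ) : colResidual d A j x i = colResidual d A j y i := by
  rw [colResidual, colResidual, sum_congr rfl fun m hm => by rw [h m (mem_range.1 hm)]]

theorem vecLoss_congr {n : ℕ} {r r' : ℕ → ℝ} (h : ∀ i < n, r i = r' i) : vecLoss n r = vecLoss n r' :=
  sum_congr rfl fun i hi => by rw [h i (mem_range.1 hi)]

theorem Descent.congr {n : ℕ} {c : ℝ} {V : (ℕ → ℝ) → Prop} {r₀ r r' : ℕ → ℝ} {τ : ℕ}
    (h : Descent n c V r₀ τ r) (hr : ∀ i < n, r' i = r i) : Descent n c V r₀ τ r' := by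
  have h1 : scaledLoss n c r' = scaledLoss n c r :=
    sum_congr rfl fun i hi => by rw [hr i (mem_range.1 hi)]
  refine ⟨h1.trans_le h.le, fun z hz => ?_⟩
  rw [h1, sum_congr rfl fun i hi => by rw [hr i (mem_range.1 hi)]]
  exact h.bound z hz

/-- The outcome of the regression of column `j` on the columns in `H`: coefficients `x` and their
loss `F`. -/
structure ApproxRegression (n d : ℕ) (A : ℕ → ℕ → ℝ) (H : ℕ → Prop) (j : ℕ) (x : ℕ → ℝ) (F : ℝ) :
    Prop where
  supp : ∀ m < d, ¬ H m → x m = 0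
  loss : F = vecLoss n (colResidual d A j x)
  le : ∀ z : ℕ → ℝ, (∀ m < d, ¬ H m → z m = 0) → F ≤ 3 * vecLoss n (colResidual d A j z)

variable {B n d : ℕ} {s : State}

theorem dot_eq_zero_of_comb {A : ℕ → ℕ → ℝ} {H : ℕ → Prop} {u w y : ℕ → ℝ}
    (hu : ∀ m < d, H m → dot n u (fun i => A i m) = 0) (hy : ∀ m < d, ¬ H m → y m = 0)
    (hw : ∀ i < n, w i = ∑ m ∈ range d, A i m * y m) : dot n u w = 0 := by
  rw [dot_congr (fun _ _ => rfl) hw, dot_sum_right]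
  refine sum_eq_zero fun m hm => ?_
  by_cases hH : H m
  · rw [hu m (mem_range.1 hm) hH, zero_mul]
  · rw [hy m (mem_range.1 hm) hH, mul_zero]

/-- The first projection produces the least squares residual. Each later iteration projects the
truncated residual, that is, the gradient, and updates the coefficients so that the stored residual
remains theirs. -/
theorem run_regress {H : ℕ → Prop} {j : ℕ} (hn : s.nats 0 0 = n) (hd : s.nats 0 1 = d)
    (hj : s.nats 13 0 = j) (hnB : n ≤ B) (hdB : d ≤ B) (hTB : 2 * n * n + 1 ≤ B)
    (h : OrthoBasis n d (s.reals 0) H (s.reals 3) (s.reals 4)) :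
    Run B regress s fun s' => ApproxRegression n d (s.reals 0) H j (fun m => s'.reals 7 m 0)
      (s'.reals 23 0 0) := by
  set A := s.reals 0 with hA
  refine .seq ((run_load hn hd hj hnB hdB).mono fun s₁ hA₁ ⟨hr₁, hv₁, hx₁⟩ => ?_)
  have n1 : s₁.nats 0 = s.nats 0 := hA₁.nats 0 (by decide)
  have m1 : s₁.reals 0 = A := hA₁.reals 0 (by decide)
  refine .seq ((run_project_of_orthoBasis (n := n) (d := d) (H := H) (by rw [n1, hn])
    (by rw [n1, hd]) hnB hdB ?_).mono fun s₂ hA₂ ⟨ξ, δ, hξ, hx₂, hr₂, ho₂⟩ => ?_)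
  · rwa [m1, hA₁.reals 3 (by decide), hA₁.reals 4 (by decide)]
  have n2 : s₂.nats 0 = s.nats 0 := (hA₂.nats 0 (by decide)).trans n1
  have m2 : s₂.reals 0 = A := (hA₂.reals 0 (by decide)).trans m1
  rw [m1] at hξ ho₂
  set r₀ : ℕ → ℝ := fun i => s₂.reals 5 i 0 with hr₀
  have hx₂' : ∀ m < d, s₂.reals 7 m 0 = ξ m := fun m hm => by rw [hx₂ m hm, hx₁ m hm, zero_add]
  have hr₀' : ∀ i < n, r₀ i = A i j - δ i := fun i hi => by simp only [hr₀]; rw [hr₂ i hi, hr₁ i hi]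
  -- The admissible residuals are those attainable with coefficients supported on `H`. Differences
  -- of two of them lie in the span of these columns, which makes the projections orthogonal to
  -- them.
  set V : (ℕ → ℝ) → Prop := fun z => ∃ ζ : ℕ → ℝ, (∀ m < d, ¬ H m → ζ m = 0) ∧
    ∀ i < n, z i = colResidual d A j ζ i with hV
  have horth : ∀ z, V z → dot n r₀ (fun i => r₀ i - z i) = 0 := by
    rintro z ⟨ζ, hζ, hz⟩
    refine dot_eq_zero_of_comb (d := d) (A := A) (H := H) (y := fun m => ζ m - ξ m)
      (fun m hm hH => ?_) (fun m hm hH => ?_) (fun i hi => ?_)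
    · rw [← ho₂ m hm hH]
      exact dot_congr (fun i hi => by rw [hr₀' i hi, hv₁ i hi]) fun _ _ => rfl
    · simp [hζ m hm hH, hξ.1 m hm hH]
    · rw [hr₀' i hi, hz i hi, hξ.2 i hi, colResidual]
      simp only [mul_sub, sum_sub_distrib]
      ring
  refine .seq ((run_residualLoss (n := n) (by rw [n2, hn]) hnB).mono fun s₃ hA₃ h₃ => ?_)
  refine .seq (.setReal ?_)
  refine .seq (Run.mono (Q := fun s' => s'.reals 24 0 0 =
    threshold n (vecLoss n r₀) ∧ s'.nats 0 = s.nats 0 ∧ s'.reals 0 = A ∧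
    s'.reals 3 = s.reals 3 ∧ s'.reals 4 = s.reals 4 ∧
    s'.reals 5 = s₂.reals 5 ∧ s'.reals 7 = s₂.reals 7) ?_ fun s₄ _ ⟨c4, n4, m4, q4, b4, r4, x4⟩ => ?_)
  · have e3 : s₃.nats 0 0 = n := by rw [hA₃.nats 0 (by decide), n2, hn]
    have e : ∀ a, a ∉ [5, 6, 7, 20, 21, 22, 23, 24] → s₃.reals a = s.reals a := fun a ha => by
      have h1 : a ∉ load.realTargets := fun h' => ha (by
        have : a ∈ [5, 6, 7] := h'
        simp at this ⊢; lia)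
      have h2 : a ∉ project.realTargets := fun h' => ha (by
        have : a ∈ [20, 20, 21, 21, 22, 5, 7] := h'
        simp at this ⊢; lia)
      have h3 : a ∉ residualLoss.realTargets := fun h' => ha (by
        have : a ∈ [23, 23, 23, 23] := h'
        simp at this ⊢; lia)
      rw [hA₃.reals a h3, hA₂.reals a h2, hA₁.reals a h1]
    simp only [NExpr.eval, RExpr.eval, e3, h₃]
    set F := vecLoss n r₀ with hF
    have common : ∀ s' : State, s'.nats = s₃.nats → (∀ a, a ≠ 24 → s'.reals a = s₃.reals a) →
        s'.nats 0 = s.nats 0 ∧ s'.reals 0 = A ∧ s'.reals 3 = s.reals 3 ∧ s'.reals 4 = s.reals 4 ∧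
        s'.reals 5 = s₂.reals 5 ∧ s'.reals 7 = s₂.reals 7 := by
      intro s' h' h''
      refine ⟨?_, ?_, ?_, ?_, ?_, ?_⟩
      · rw [h', hA₃.nats 0 (by decide), n2]
      · rw [h'' 0 (by decide), e 0 (by decide)]
      · rw [h'' 3 (by decide), e 3 (by decide)]
      · rw [h'' 4 (by decide), e 4 (by decide)]
      · rw [h'' 5 (by decide), hA₃.reals 5 (by decide)]
      · rw [h'' 7 (by decide), hA₃.reals 7 (by decide)]
    refine .branch (fun hb => .setReal ⟨?_, common _ rfl fun a ha => ?_⟩)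
      fun hb => .skip ⟨?_, common _ rfl fun a ha => ?_⟩
    · simp only [BExpr.Holds, NExpr.eval, RExpr.eval, State.setReal_reals, and_self, if_true] at hb
      simp only [NExpr.eval, RExpr.eval, State.setReal_reals, and_self, if_true]
      rw [threshold, if_pos (by simpa using hb)]
      simp
    · rw [State.setReal_reals_of_ne _ _ _ _ (by simpa [NExpr.eval] using ha),
        State.setReal_reals_of_ne _ _ _ _ ha]
    · simp only [BExpr.Holds, NExpr.eval, RExpr.eval, State.setReal_reals, and_self, if_true] at hb
      simp only [State.setReal_reals, and_self, if_true]
      rw [threshold, if_neg (by simpa using hb)]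
    · rw [State.setReal_reals_of_ne _ _ _ _ ha]
  set c := threshold n (vecLoss n r₀) with hc
  have hc0 : 0 ≤ c := zero_le_one.trans (one_le_threshold _ _)
  refine .seq (Run.mono (.forWhile (N := 2 * n * n + 1) (fun τ s' =>
    (∀ m < d, ¬ H m → s'.reals 7 m 0 = 0) ∧
    (∀ i < n, s'.reals 5 i 0 = colResidual d A j (fun m => s'.reals 7 m 0) i) ∧
    Descent n c V r₀ τ (fun i => s'.reals 5 i 0)) hTB (by decide) ?_ ?_ ?_) ?_)
  -- The iteration bound `2 n ^ 2 + 1` is formed and compared as a real number, since the machine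
  -- does not multiply naturals.
  · intro i s' _ _ hi hA'
    have : s'.nats 0 0 = n := by rw [hA'.nats 0 (by decide), n4, hn]
    simp only [BExpr.Holds, NExpr.eval, RExpr.eval, this, hi]
    rw [not_le]
    exact_mod_cast Iff.rfl
  · simp only [State.setNat_reals, r4, x4]
    refine ⟨fun m hm hH => by rw [hx₂' m hm, hξ.1 m hm hH], fun i hi => ?_, Descent.zero ..⟩
    have := hr₀' i hi
    simp only [hr₀] at this
    rw [this, hξ.2 i hi, colResidual_congr hx₂', colResidual]
  · intro τ s₅ _ ⟨hsupp, hres, hdesc⟩ _ hA₅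
    have n5 : s₅.nats 0 = s.nats 0 := (hA₅.nats 0 (by decide)).trans n4
    have m5 : s₅.reals 0 = A := (hA₅.reals 0 (by decide)).trans m4
    have c5 : s₅.reals 24 0 0 = c := by rw [hA₅.reals 24 (by decide), c4]
    refine .seq ((run_truncate (n := n) (by rw [n5, hn]) hnB).mono fun s₆ hA₆ h₆ => ?_)
    have n6 : s₆.nats 0 = s.nats 0 := (hA₆.nats 0 (by decide)).trans n5
    have m6 : s₆.reals 0 = A := (hA₆.reals 0 (by decide)).trans m5
    refine (run_project_of_orthoBasis (n := n) (d := d) (H := H) (by rw [n6, hn])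
      (by rw [n6, hd]) hnB hdB ?_).mono fun s₇ _ ⟨ξ', δ', hξ', hx₇, hr₇, ho₇⟩ => ?_
    · rwa [m6, hA₆.reals 3 (by decide), hA₅.reals 3 (by decide), q4,
        hA₆.reals 4 (by decide), hA₅.reals 4 (by decide), b4]
    rw [m6] at hξ' ho₇
    rw [hA₆.reals 7 (by decide)] at hx₇
    rw [hA₆.reals 5 (by decide)] at hr₇
    simp only [State.setNat_reals]
    refine ⟨fun m hm hH => ?_, fun i hi => ?_, ?_⟩
    · rw [hx₇ m hm, hsupp m hm hH, hξ'.1 m hm hH, zero_add]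
    · rw [hr₇ i hi, hres i hi, hξ'.2 i hi, colResidual_congr hx₇, colResidual, colResidual]
      simp only [mul_add, sum_add_distrib]
      ring
    · refine (hdesc.succ hc0 (δ := δ') ⟨_, hsupp, hres⟩ ?_).congr hr₇
      rintro z ⟨ζ, hζ, hz⟩
      refine dot_eq_zero_of_comb (d := d) (A := A) (H := H)
        (y := fun m => ζ m - s₅.reals 7 m 0 - ξ' m) (fun m hm hH => ?_) (fun m hm hH => ?_)
        (fun i hi => ?_)
      · rw [← ho₇ m hm hH]
        exact dot_congr (fun i hi => by rw [h₆ i hi, c5]) fun _ _ => rfl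
      · simp [hζ m hm hH, hξ'.1 m hm hH, hsupp m hm hH]
      · rw [hres i hi, hz i hi, hξ'.2 i hi, colResidual, colResidual]
        simp only [mul_sub, sum_sub_distrib]
        ring
  · intro s₈ hA₈ ⟨hsupp, hres, hdesc⟩
    have n8 : s₈.nats 0 0 = n := by rw [hA₈.nats 0 (by decide), n4, hn]
    refine (run_residualLoss n8 hnB).mono fun s₉ hA₉ h₉ => ?_
    rw [h₉, hA₉.reals 7 (by decide)]
    refine ⟨hsupp, vecLoss_congr hres, fun z hz => ?_⟩
    exact hdesc.vecLoss_le ⟨z, hz, fun _ _ => rfl⟩ (horth _ ⟨z, hz, fun _ _ => rfl⟩)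

end HuberCSS

/-! ### Selection of the columns with the smallest losses -/

namespace HuberCSS

open Finset RealRAM

/-- Column `l` comes before column `j` in the order by loss, with ties broken by the index. -/
def Precedes (F : ℕ → ℝ) (l j : ℕ) : Prop := F l < F j ∨ (F l ≤ F j ∧ l < j)

open Classical in
/-- The position of `j` in the order by loss of the columns in `T`. -/
noncomputable def lossRank (T : Finset ℕ) (F : ℕ → ℝ) (j : ℕ) : ℕ := #{l ∈ T | Precedes F l j}

theorem Precedes.trans {F : ℕ → ℝ} {a b c : ℕ} (h : Precedes F a b) (h' : Precedes F b c) :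
    Precedes F a c := by
  rcases h with h | ⟨h, h1⟩ <;> rcases h' with h' | ⟨h', h1'⟩
  · exact .inl (h.trans h')
  · exact .inl (h.trans_le h')
  · exact .inl (h.trans_lt h')
  · exact .inr ⟨h.trans h', h1.trans h1'⟩

theorem Precedes.irrefl (F : ℕ → ℝ) (a : ℕ) : ¬ Precedes F a a := by
  rintro (h | ⟨-, h⟩) <;> exact lt_irrefl _ h

theorem Precedes.total (F : ℕ → ℝ) {a b : ℕ} (h : a ≠ b) : Precedes F a b ∨ Precedes F b a := by
  rcases lt_trichotomy (F a) (F b) with h' | h' | h'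
  · exact .inl (.inl h')
  · rcases lt_or_gt_of_ne h with h | h
    · exact .inl (.inr ⟨h'.le, h⟩)
    · exact .inr (.inr ⟨h'.ge, h⟩)
  · exact .inr (.inl h')

theorem lossRank_lt {T : Finset ℕ} {F : ℕ → ℝ} {a b : ℕ} (ha : a ∈ T) (h : Precedes F a b) :
    lossRank T F a < lossRank T F b := by
  classical
  refine card_lt_card ⟨fun l hl => ?_, fun hsub => ?_⟩
  · rw [mem_filter] at hl ⊢
    exact ⟨hl.1, hl.2.trans h⟩
  · have := hsub (mem_filter.2 ⟨ha, h⟩)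
    exact Precedes.irrefl F a (mem_filter.1 this).2

-- Breaking ties makes ranks distinct, so they are exactly `0, …, #T - 1` and the selection has
-- exactly `⌈#T / 4⌉` elements. Thus the sizes of all later rounds, and with them the coins
-- consumed, do not depend on the coins.
open Classical in
theorem card_lossRank (T : Finset ℕ) (F : ℕ → ℝ) :
    #{j ∈ T | 4 * lossRank T F j < #T} = (#T + 3) / 4 := by
  have hinj : Set.InjOn (lossRank T F) T := by
    intro a ha b hb hab
    by_contra hne
    rcases Precedes.total F hne with h | h
    · exact (lossRank_lt ha h).ne hab
    · exact (lossRank_lt hb h).ne hab.symm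
  have himg : T.image (lossRank T F) = range #T := by
    refine eq_of_subset_of_card_le (fun r hr => ?_) ?_
    · obtain ⟨j, hj, rfl⟩ := mem_image.1 hr
      rw [mem_range, lossRank]
      refine card_lt_card (filter_ssubset.2 ⟨j, hj, Precedes.irrefl F j⟩)
    · rw [card_range, card_image_of_injOn hinj]
  have : ({j ∈ T | 4 * lossRank T F j < #T}).image (lossRank T F) = range ((#T + 3) / 4) := by
    ext r
    have hr : r ∈ T.image (lossRank T F) ↔ r < #T := by rw [himg, mem_range]
    simp only [mem_image, mem_filter, mem_range] at hr ⊢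
    constructor
    · rintro ⟨j, ⟨-, hj⟩, rfl⟩
      lia
    · intro h
      obtain ⟨j, hj, rfl⟩ := hr.2 (by lia)
      exact ⟨j, ⟨hj, by lia⟩, rfl⟩
  rw [← card_range ((#T + 3) / 4), ← this, card_image_of_injOn]
  exact hinj.mono fun j hj => (mem_filter.1 hj).1

open Classical in
/-- If a quarter of the columns have loss at most `v`, then so have those selected. -/
theorem le_of_lossRank {T : Finset ℕ} {F : ℕ → ℝ} {v : ℝ} (h : #T ≤ 4 * #{l ∈ T | F l ≤ v}) {j : ℕ}
    (hj : 4 * lossRank T F j < #T) : F j ≤ v := by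
  by_contra! hv
  have : #{l ∈ T | F l ≤ v} ≤ lossRank T F j :=
    card_le_card fun l hl => by
      rw [mem_filter] at hl ⊢
      exact ⟨hl.1, .inl (hl.2.trans_lt hv)⟩
  lia

/-! ### One round -/

/-- The set with the given indicator vector. -/
def memSet (d : ℕ) (f : ℕ → ℕ) : Finset ℕ := {j ∈ range d | f j ≠ 0}

theorem mem_memSet {d : ℕ} {f : ℕ → ℕ} {j : ℕ} : j ∈ memSet d f ↔ j < d ∧ f j ≠ 0 := by
  simp [memSet]

/-- Twice a natural. -/
abbrev double (e : NExpr) : NExpr := .add e e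

/-- Choose the sampling rate `2 ^ (-level)`. -/
def chooseLevel : Prog :=
  .seq (.setNat 30 (.const 0) (double (double (double (double (double (double
    (.get 0 (.const 2)))))))))
  (.forWhile 31 (natLt (nvar 30) (nvar 32)) (.setNat 30 (.const 0) (double (nvar 30))))

/-- The number of halvings after which at most `64 k` of `N` columns are expected to remain. -/
noncomputable def level (k N : ℕ) : ℕ := sInf {l | N ≤ 64 * k * 2 ^ l}

theorem exists_level {k : ℕ} (hk : 1 ≤ k) (N : ℕ) : N ∈ {l | N ≤ 64 * k * 2 ^ l} := by
  have : N < 2 ^ N := Nat.lt_two_pow_self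
  simp only [Set.mem_ofPred_eq]
  nlinarith

theorem level_spec {k : ℕ} (hk : 1 ≤ k) (N : ℕ) : N ≤ 64 * k * 2 ^ level k N :=
  Nat.sInf_mem (s := {l | N ≤ 64 * k * 2 ^ l}) ⟨N, exists_level hk N⟩

theorem level_le {k : ℕ} (hk : 1 ≤ k) (N : ℕ) : level k N ≤ N := Nat.sInf_le (exists_level hk N)

theorem lt_level_iff {k : ℕ} (hk : 1 ≤ k) {N i : ℕ} : i < level k N ↔ 64 * k * 2 ^ i < N := by
  constructor
  · intro h
    simpa using Nat.notMem_of_lt_sInf h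
  · intro h
    by_contra! h'
    have : 64 * k * 2 ^ level k N ≤ 64 * k * 2 ^ i := by gcongr; norm_num
    have := level_spec hk N
    lia

/-- Draw the sample and add it to the chosen columns. An exceedingly large sample is discarded. -/
def drawSample : Prog :=
  .seq (.setNat 33 (.const 0) (.const 0))
  (.seq (.forLt 13 colCount
    (.seq (.setNat 34 (.const 0) (.get 2 (nvar 13)))
    (.seq (.forLt 16 (nvar 31)
      (.seq (.flip 35 (.const 0)) (.branch (.natLe (.const 1) (nvar 35)) .skip
        (.setNat 34 (.const 0) (.const 0)))))
    (.seq (.setNat 4 (nvar 13) (nvar 34))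
    (.branch (.natLe (.const 1) (nvar 34)) (.incr 33) .skip)))))
  (.forLt 13 colCount
    (.seq (.branch (natLt (double (double (double (double (double (double (double (double
        (.get 0 (.const 2)))))))))) (nvar 33))
      (.setNat 4 (nvar 13) (.const 0)) .skip)
    (.branch (.natLe (.const 1) (.get 4 (nvar 13))) (.setNat 3 (nvar 13) (.const 1)) .skip))))

/-- The columns in `T` all of whose `l` coins show heads. -/
def sampleSet (T : Finset ℕ) (l : ℕ) (ω : ℕ → Bool) : Finset ℕ :=
  {j ∈ T | ∀ i < l, ω (j * l + i) = true}

/-- The sample, or the empty set if the sample is exceedingly large. -/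
def cappedSample (k : ℕ) (T : Finset ℕ) (l : ℕ) (ω : ℕ → Bool) : Finset ℕ :=
  if #(sampleSet T l ω) ≤ 256 * k then sampleSet T l ω else ∅

/-- Regression of all columns on the sample. -/
def regressAll : Prog :=
  .forLt 13 colCount (.seq regress
    (.seq (.setReal 8 (nvar 13) (.const 0) (rvar 23))
    (fillProg 9 12 colCount (nvar 13) (.get 7 (nvar 12) (.const 0)))))

/-- Compute the rank of column `13`. -/
def computeRank : Prog :=
  .seq (.setNat 36 (.const 0) (.const 0))
  (.forLt 16 colCount (.branch (.and (.natLe (.const 1) (.get 2 (nvar 16)))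
      (.not (.and (.realLe (.get 8 (nvar 13) (.const 0)) (.get 8 (nvar 16) (.const 0)))
        (.not (.and (.realLe (.get 8 (nvar 16) (.const 0)) (.get 8 (nvar 13) (.const 0)))
          (natLt (nvar 16) (nvar 13)))))))
    (.incr 36) .skip))

/-- Mark the quarter of the columns with the smallest losses and keep their coefficients. -/
def selectColumns : Prog :=
  .forLt 13 colCount (.seq (.setNat 5 (nvar 13) (.const 0))
    (.branch (.natLe (.const 1) (.get 2 (nvar 13)))
      (.seq computeRank
        (.branch (natLt (double (double (nvar 36))) (nvar 32))
          (.seq (.setNat 5 (nvar 13) (.const 1))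
            (fillProg 2 12 colCount (nvar 13) (.get 9 (nvar 12) (nvar 13))))
          .skip))
      .skip))

/-- Remove the marked columns from those still to be treated. -/
def removeColumns : Prog :=
  .forLt 13 colCount (.branch (.natLe (.const 1) (.get 5 (nvar 13)))
    (.seq (.setNat 2 (nvar 13) (.const 0)) (.setNat 32 (.const 0) (.sub (nvar 32) (.const 1))))
    .skip)

/-- One round of the algorithm. -/
def roundProg : Prog :=
  .seq chooseLevel (.seq drawSample (.seq orthogonalize (.seq regressAll
    (.seq selectColumns removeColumns))))

variable {B n d k : ℕ} {s : State}

theorem run_chooseLevel {N : ℕ} (hk : s.nats 0 2 = k) (hN : s.nats 32 0 = N) (hk1 : 1 ≤ k)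
    (hNB : N ≤ B) : Run B chooseLevel s fun s' => s'.nats 31 0 = level k N := by
  -- The factor `64` comes from six doublings of `k`; naturals can only be added.
  refine .seq (.setNat ?_)
  simp only [NExpr.eval, hk]
  refine Run.mono (.forWhile (N := level k N) (fun i s' => s'.nats 30 0 = 64 * k * 2 ^ i ∧
    s'.nats 31 0 = i) ((level_le hk1 N).trans hNB) (by decide) ?_ ?_ ?_) fun s' _ h => h.2
  · intro i s' _ hI _ hA
    have : s'.nats 32 0 = N := by
      rw [hA.nats 32 (by decide), State.setNat_nats_of_ne _ _ _ (by decide), hN]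
    simp [BExpr.Holds, NExpr.eval, hI.1, this, lt_level_iff hk1]
  · simp [State.setNat_nats]
    ring
  · intro i s' _ hI _ hA
    refine .setNat ?_
    simp [State.setNat_nats, NExpr.eval, hI.1]
    ring

theorem sampleSet_insert_range (T : Finset ℕ) (l : ℕ) (ω : ℕ → Bool) (j : ℕ) :
    {i ∈ sampleSet T l ω | i < j + 1} = if j ∈ sampleSet T l ω then
      insert j {i ∈ sampleSet T l ω | i < j} else {i ∈ sampleSet T l ω | i < j} := by
  split_ifs with h <;> ext i <;> simp only [mem_filter, mem_insert]
  · grind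
  · grind

/-- Every one of the `d` columns consumes `l` coins, treated or not, so the `j`-th block of the tape
belongs to column `j` and the total is fixed. The size of the sample is known only after the first
pass; the second pass discards the sample if necessary and records it. -/
theorem run_drawSample {l : ℕ} {T : Finset ℕ} {ω : ℕ → Bool} (hd : s.nats 0 1 = d)
    (hk : s.nats 0 2 = k) (hl : s.nats 31 0 = l)
    (hT : memSet d (s.nats 2) = T) (hω : s.coins = ω) (hdB : d ≤ B) (hlB : l ≤ B) :
    Run B drawSample s fun s' => memSet d (s'.nats 4) = cappedSample k T l ω ∧
      memSet d (s'.nats 3) = memSet d (s.nats 3) ∪ cappedSample k T l ω ∧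
      s'.coins = fun i => ω (i + d * l) := by
  set S := sampleSet T l ω with hS
  have hTd : ∀ j ∈ T, j < d := fun j hj => (mem_memSet.1 (hT ▸ hj)).1
  refine .seq (.setNat ?_)
  simp only [NExpr.eval]
  have hA0 := (Exec.setNat 33 (.const 0) (.const 0) s).agree
  simp only [NExpr.eval] at hA0
  set s₁ := s.setNat 33 0 0 with hs₁
  refine .seq (Run.mono (.forLt (fun j s' => (∀ i < j, (s'.nats 4 i ≠ 0 ↔ i ∈ S)) ∧
    s'.nats 33 0 = #{i ∈ S | i < j} ∧ s'.coins = fun i => ω (i + j * l)) hdB (by decide) ?_ ?_ ?_) ?_)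
  · intro s' hA
    simp [NExpr.eval, hA.nats 0 (by decide), hA0.nats 0 (by decide), hd]
  · simp [State.setNat_nats, hs₁, hω]
  · intro j s₂ hj ⟨h4, h33, hc⟩ hv hA₂
    have e31 : s₂.nats 31 0 = l := by rw [hA₂.nats 31 (by decide), hA0.nats 31 (by decide), hl]
    have e2 : s₂.nats 2 = s.nats 2 := by rw [hA₂.nats 2 (by decide), hA0.nats 2 (by decide)]
    refine .seq (.setNat ?_)
    simp only [NExpr.eval, hv, e2]
    set s₃ := s₂.setNat 34 0 (s.nats 2 j) with hs₃
    have o3 : ∀ a, a ≠ 34 → s₃.nats a = s₂.nats a := fun a ha => State.setNat_nats_of_ne _ _ _ ha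
    refine .seq (Run.mono (.forLt (N := l) (fun i s' => (s'.nats 34 0 ≠ 0 ↔ j ∈ T ∧
      ∀ i' < i, ω (j * l + i') = true) ∧ s'.coins = fun i' => ω (i' + (j * l + i))) hlB (by decide)
      ?_ ?_ ?_) fun s₄ hA₄ ⟨h34, hc₄⟩ => .seq (.setNat ?_))
    · intro s' hA
      simp [NExpr.eval, hA.nats 31 (by decide), o3, e31]
    · simp [State.setNat_nats, hs₃, hc, ← hT, mem_memSet, hj]
    · intro i s₄ _ ⟨h34, hc₄⟩ _ _
      refine .seq (.flip ?_)
      have hz : (s₄.flip 35 0).nats 35 0 = (ω (j * l + i)).toNat := by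
        simp [State.flip, State.setNat_nats, hc₄]
      have h34' : (s₄.flip 35 0).nats 34 0 = s₄.nats 34 0 := by
        simp [State.flip, State.setNat_nats]
      have hc' : (s₄.flip 35 0).coins = fun i' => ω (i' + (j * l + (i + 1))) := by
        funext i'
        simp only [State.flip, hc₄]
        congr 1
        ring
      simp only [NExpr.eval]
      refine .branch (fun hb => .skip ?_) fun hb => .setNat ?_
      · simp only [BExpr.Holds, NExpr.eval, hz] at hb
        have hb' : ω (j * l + i) = true := by
          cases h : ω (j * l + i) <;> simp_all
        refine ⟨?_, hc'⟩
        rw [State.setNat_nats_of_ne _ _ _ (by decide), h34', h34]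
        grind
      · simp only [BExpr.Holds, NExpr.eval, hz] at hb
        have hb' : ω (j * l + i) = false := by
          cases h : ω (j * l + i) <;> simp_all
        refine ⟨?_, hc'⟩
        simp only [State.setNat_nats, NExpr.eval]
        simp
        grind
    · have e13 : s₄.nats 13 0 = j := by rw [hA₄.nats 13 (by decide), o3 13 (by decide), hv]
      have hmemS : s₄.nats 34 0 ≠ 0 ↔ j ∈ S := by rw [h34, hS, sampleSet, mem_filter]
      have e4 : s₄.nats 4 = s₂.nats 4 := by rw [hA₄.nats 4 (by decide), o3 4 (by decide)]
      have e33 : s₄.nats 33 0 = #{i ∈ S | i < j} := by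
        rw [hA₄.nats 33 (by decide), o3 33 (by decide), h33]
      have hcj : s₄.coins = fun i => ω (i + (j + 1) * l) := by
        rw [hc₄]; funext i; congr 1; ring
      simp only [NExpr.eval, e13]
      have h4' : ∀ s' : State, s'.nats 4 = (s₄.setNat 4 j (s₄.nats 34 0)).nats 4 →
          ∀ i < j + 1, (s'.nats 4 i ≠ 0 ↔ i ∈ S) := by
        intro s' hs' i hi
        rw [hs', State.setNat_nats]
        by_cases hij : i = j
        · simp only [hij, and_self, if_true]
          exact hmemS
        · simp only [hij, and_false, if_false]
          rw [e4]
          exact h4 i (by lia)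
      have hins := sampleSet_insert_range T l ω j
      rw [← hS] at hins
      refine .branch (fun hb => .setNat ?_) fun hb => .skip ?_
      · simp only [BExpr.Holds, NExpr.eval, State.setNat_nats] at hb
        have hjS : j ∈ S := hmemS.1 (by simp at hb; lia)
        refine ⟨h4' _ ?_, ?_, hcj⟩
        · simp only [NExpr.eval]
          rw [State.setNat_nats_of_ne _ _ _ (by decide), State.setNat_nats_of_ne _ _ _ (by decide)]
        · rw [hins, if_pos hjS, card_insert_of_notMem (by simp)]
          simp [State.setNat_nats, NExpr.eval, e33]
      · simp only [BExpr.Holds, NExpr.eval, State.setNat_nats] at hb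
        have hjS : j ∉ S := fun h => (hmemS.2 h) (by simp at hb; lia)
        refine ⟨h4' _ ?_, ?_, hcj⟩
        · rw [State.setNat_nats_of_ne _ _ _ (by decide)]
        · rw [hins, if_neg hjS]
          simp [State.setNat_nats, e33]
  · intro s₂ hA₂ ⟨h4, h33, hc⟩
    have hSd : {i ∈ S | i < d} = S := by
      refine filter_true_of_mem fun i hi => hTd i ?_
      exact (mem_filter.1 hi).1
    rw [hSd] at h33
    have e3 : s₂.nats 3 = s.nats 3 := by rw [hA₂.nats 3 (by decide), hA0.nats 3 (by decide)]
    have e0 : s₂.nats 0 = s.nats 0 := by rw [hA₂.nats 0 (by decide), hA0.nats 0 (by decide)]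
    set C := cappedSample k T l ω with hC
    have hCmem : ∀ i, i ∈ C ↔ i ∈ S ∧ #S ≤ 256 * k := fun i => by
      rw [hC, cappedSample, ← hS]
      split_ifs with h <;> simp [h]
    refine Run.mono (.forLt (fun j s' => (∀ i < j, (s'.nats 4 i ≠ 0 ↔ i ∈ C)) ∧
      (∀ i < d, j ≤ i → (s'.nats 4 i ≠ 0 ↔ i ∈ S)) ∧
      (∀ i < d, (s'.nats 3 i ≠ 0 ↔ s.nats 3 i ≠ 0 ∨ (i ∈ C ∧ i < j)))) hdB (by decide) ?_ ?_ ?_) ?_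
    · intro s' hA
      simp [NExpr.eval, hA.nats 0 (by decide), e0, hd]
    · refine ⟨by simp, fun i hi _ => ?_, fun i hi => ?_⟩
      · rw [State.setNat_nats_of_ne _ _ _ (by decide), h4 i hi]
      · rw [State.setNat_nats_of_ne _ _ _ (by decide), e3]
        simp
    · intro j s₃ hj ⟨h1, h2, h3⟩ hv hA₃
      have f33 : s₃.nats 33 0 = #S := by rw [hA₃.nats 33 (by decide), h33]
      have fk : s₃.nats 0 2 = k := by rw [hA₃.nats 0 (by decide), e0, hk]
      refine .seq (Run.mono (Q := fun s' => (∀ i < j + 1, (s'.nats 4 i ≠ 0 ↔ i ∈ C)) ∧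
        (∀ i < d, j + 1 ≤ i → (s'.nats 4 i ≠ 0 ↔ i ∈ S)) ∧ s'.nats 3 = s₃.nats 3 ∧
        s'.nats 13 = s₃.nats 13) ?_ ?_)
      · refine .branch (fun hb => .setNat ?_) fun hb => .skip ?_
        · simp only [BExpr.Holds, NExpr.eval, f33, fk] at hb
          simp only [NExpr.eval, hv]
          refine ⟨fun i hi => ?_, fun i hi hij => ?_, ?_, ?_⟩
          · rw [State.setNat_nats]
            have hiC : i ∉ C := fun h => by have := ((hCmem i).1 h).2; lia
            by_cases hij : i = j
            · simp [hij, hij ▸ hiC]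
            · simp only [hij, and_false, if_false]
              exact h1 i (by lia)
          · rw [State.setNat_nats, if_neg (by lia)]
            exact h2 i hi (by lia)
          · rw [State.setNat_nats_of_ne _ _ _ (by decide)]
          · rw [State.setNat_nats_of_ne _ _ _ (by decide)]
        · simp only [BExpr.Holds, NExpr.eval, f33, fk] at hb
          refine ⟨fun i hi => ?_, fun i hi hij => h2 i hi (by lia), rfl, rfl⟩
          by_cases hij : i = j
          · rw [hij, h2 j hj le_rfl, hCmem]
            have : #S ≤ 256 * k := by lia
            simp [this]
          · exact h1 i (by lia)
      · intro s₄ hA₄ ⟨g1, g2, g3, g13⟩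
        have hjC := g1 j (by lia)
        refine .branch (fun hb => .setNat ?_) fun hb => .skip ?_
        · simp only [BExpr.Holds, NExpr.eval, g13, hv] at hb
          simp only [NExpr.eval, g13, hv]
          have hjC' : j ∈ C := hjC.1 (by lia)
          refine ⟨fun i hi => ?_, fun i hi hij => ?_, fun i hi => ?_⟩
          · rw [State.setNat_nats_of_ne _ _ _ (by decide), State.setNat_nats_of_ne _ _ _ (by decide)]
            exact g1 i hi
          · rw [State.setNat_nats_of_ne _ _ _ (by decide), State.setNat_nats_of_ne _ _ _ (by decide)]
            exact g2 i hi hij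
          · rw [State.setNat_nats_of_ne _ _ _ (by decide), State.setNat_nats, g3]
            by_cases hij : i = j
            · simp [hij, hjC']
            · simp only [hij, and_false, if_false]
              rw [h3 i hi]
              grind
        · simp only [BExpr.Holds, NExpr.eval, g13, hv] at hb
          have hjC' : j ∉ C := fun h => (hjC.2 h) (by lia)
          refine ⟨fun i hi => ?_, fun i hi hij => ?_, fun i hi => ?_⟩
          · rw [State.setNat_nats_of_ne _ _ _ (by decide)]
            exact g1 i hi
          · rw [State.setNat_nats_of_ne _ _ _ (by decide)]
            exact g2 i hi hij
          · rw [State.setNat_nats_of_ne _ _ _ (by decide), g3, h3 i hi]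
            grind
    · intro s₃ hA₃ ⟨h1, _, h3⟩
      refine ⟨?_, ?_, ?_⟩
      · ext i
        rw [mem_memSet]
        constructor
        · exact fun h => (h1 i h.1).1 h.2
        · intro h
          have hid : i < d := hTd i (mem_filter.1 ((hCmem i).1 h).1).1
          exact ⟨hid, (h1 i hid).2 h⟩
      · ext i
        rw [mem_memSet, mem_union, mem_memSet]
        have : i ∈ C → i < d := fun h => hTd i (mem_filter.1 ((hCmem i).1 h).1).1
        have := h3 i
        grind
      · rw [hA₃.coins (by decide), hc]

end HuberCSS

/-! ### Regression of all columns, selection and removal -/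

namespace HuberCSS

open Finset RealRAM

variable {B n d k : ℕ} {s : State}

theorem run_regressAll {H : ℕ → Prop} (hn : s.nats 0 0 = n) (hd : s.nats 0 1 = d)
    (hnB : n ≤ B) (hdB : d ≤ B) (hTB : 2 * n * n + 1 ≤ B)
    (h : OrthoBasis n d (s.reals 0) H (s.reals 3) (s.reals 4)) :
    Run B regressAll s fun s' => ∀ j < d,
      ApproxRegression n d (s.reals 0) H j (fun m => s'.reals 9 m j) (s'.reals 8 j 0) := by
  refine .forLt (fun j s' => ∀ l < j,
      ApproxRegression n d (s.reals 0) H l (fun m => s'.reals 9 m l) (s'.reals 8 l 0)) hdB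
      (by decide) (fun s' hA => by simp [NExpr.eval, hA.nats 0 (by decide), hd]) (by simp) ?_
  intro j s₁ hj hI hv hA₁
  have n1 : s₁.nats 0 = s.nats 0 := hA₁.nats 0 (by decide)
  have m1 : s₁.reals 0 = s.reals 0 := hA₁.reals 0 (by decide)
  refine .seq ((run_regress (H := H) (by rw [n1, hn]) (by rw [n1, hd]) hv hnB hdB hTB ?_).mono
    fun s₂ hA₂ h₂ => .seq (.setReal ?_))
  · rwa [m1, hA₁.reals 3 (by decide), hA₁.reals 4 (by decide)]
  rw [m1] at h₂
  have j2 : s₂.nats 13 0 = j := by rw [hA₂.nats 13 (by decide), hv]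
  simp only [NExpr.eval, RExpr.eval, j2]
  set s₃ := s₂.setReal 8 j 0 (s₂.reals 23 0 0) with hs₃
  have o3 : ∀ a, a ≠ 8 → s₃.reals a = s₂.reals a := fun a ha =>
    State.setReal_reals_of_ne _ _ _ _ ha
  have n3 : s₃.nats = s₂.nats := rfl
  refine (run_fillProg (N := d) (J := j) (fun m => s₂.reals 7 m 0) hdB ?_ ?_ ?_).mono
    fun s₄ hA₄ h₄ l hl => ?_
  · intro s' hA'
    simp [NExpr.eval, hA'.nats 0 (by decide), n3, hA₂.nats 0 (by decide), n1, hd]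
  · intro s' hA'
    simp [NExpr.eval, hA'.nats 13 (by decide), n3, j2]
  · intro i s' _ hi _ hA'
    simp [NExpr.eval, RExpr.eval, hi, hA'.reals 7 (by decide), o3]
  · simp only [State.setNat_reals]
    have e8 : s₄.reals 8 l 0 = if l = j then s₂.reals 23 0 0 else s₁.reals 8 l 0 := by
      rw [hA₄.reals 8 (by decide), hs₃, State.setReal_reals, hA₂.reals 8 (by decide)]
      simp
    have e9 : ∀ m < d, s₄.reals 9 m l = if l = j then s₂.reals 7 m 0 else s₁.reals 9 m l := by
      intro m hm
      rw [h₄, o3 9 (by decide), hA₂.reals 9 (by decide)]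
      simp [hm]
    by_cases hlj : l = j
    · subst hlj
      simp only [if_true] at e8 e9
      rw [e8]
      refine ⟨fun m hm hH => by rw [e9 m hm, h₂.supp m hm hH], ?_, h₂.le⟩
      rw [h₂.loss]
      exact vecLoss_congr fun i _ => (colResidual_congr e9 i).symm
    · simp only [if_neg hlj] at e8 e9
      have hI' := hI l (by lia)
      rw [e8]
      refine ⟨fun m hm hH => by rw [e9 m hm, hI'.supp m hm hH], ?_, hI'.le⟩
      rw [hI'.loss]
      exact vecLoss_congr fun i _ => (colResidual_congr e9 i).symm

theorem filter_lt_succ (S : Finset ℕ) (P : ℕ → Prop) [DecidablePred P] (j : ℕ) :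
    {i ∈ S | P i ∧ i < j + 1} = if j ∈ S ∧ P j then insert j {i ∈ S | P i ∧ i < j}
      else {i ∈ S | P i ∧ i < j} := by
  split_ifs with h <;> ext i <;> simp only [mem_filter, mem_insert]
  · grind
  · grind

theorem run_computeRank {T : Finset ℕ} {j : ℕ} (hd : s.nats 0 1 = d)
    (hT : memSet d (s.nats 2) = T) (hj : s.nats 13 0 = j) (hdB : d ≤ B) :
    Run B computeRank s fun s' => s'.nats 36 0 = lossRank T (fun l => s.reals 8 l 0) j := by
  classical
  set F : ℕ → ℝ := fun l => s.reals 8 l 0 with hF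
  refine .seq (.setNat ?_)
  simp only [NExpr.eval]
  refine Run.mono (.forLt (fun i s' => s'.nats 36 0 = #{l ∈ T | Precedes F l j ∧ l < i}) hdB
    (by decide) ?_ ?_ ?_) ?_
  · intro s' hA
    simp [NExpr.eval, hA.nats 0 (by decide), State.setNat_nats, hd]
  · simp [State.setNat_nats]
  · intro i s₁ hi hI hv hA₁
    have e2 : s₁.nats 2 = s.nats 2 := by
      rw [hA₁.nats 2 (by decide), State.setNat_nats_of_ne _ _ _ (by decide)]
    have e13 : s₁.nats 13 0 = j := by
      rw [hA₁.nats 13 (by decide), State.setNat_nats_of_ne _ _ _ (by decide), hj]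
    have e8 : s₁.reals 8 = s.reals 8 := by rw [hA₁.reals 8 (by decide), State.setNat_reals]
    -- The language has only `≤` and no disjunction, so the order with ties is tested as a negated
    -- conjunction.
    have key : (i ∈ T ∧ Precedes F i j) ↔ BExpr.Holds s₁
        (.and (.natLe (.const 1) (.get 2 (nvar 16)))
        (.not (.and (.realLe (.get 8 (nvar 13) (.const 0)) (.get 8 (nvar 16) (.const 0)))
        (.not (.and (.realLe (.get 8 (nvar 16) (.const 0)) (.get 8 (nvar 13) (.const 0)))
          (natLt (nvar 16) (nvar 13))))))) := by
      simp only [BExpr.Holds, NExpr.eval, RExpr.eval, e2, e13, e8, hv, ← hT, mem_memSet, Precedes,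
        hF, Nat.one_le_iff_ne_zero]
      rw [not_and_or, not_not, not_le, not_le]
      tauto
    refine .branch (fun hb => .setNat ?_) fun hb => .skip ?_
    · rw [filter_lt_succ, if_pos (key.2 hb), card_insert_of_notMem (by simp)]
      simp [State.setNat_nats, NExpr.eval, hI]
    · rw [filter_lt_succ, if_neg (fun h => hb (key.1 h))]
      simp [State.setNat_nats, hI]
  · intro s' _ h
    rw [h, lossRank]
    congr 1
    refine filter_congr fun l hl => ?_
    have : l < d := (mem_memSet.1 (hT ▸ hl)).1
    simp [this]

open Classical in
/-- The columns selected in a round. -/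
noncomputable def selectedSet (T : Finset ℕ) (F : ℕ → ℝ) : Finset ℕ :=
  {j ∈ T | 4 * lossRank T F j < #T}

theorem run_selectColumns {T : Finset ℕ} (hd : s.nats 0 1 = d)
    (hT : memSet d (s.nats 2) = T) (hN : s.nats 32 0 = #T) (hdB : d ≤ B) :
    Run B selectColumns s fun s' =>
      memSet d (s'.nats 5) = selectedSet T (fun l => s.reals 8 l 0) ∧
      ∀ j < d, ∀ m < d, s'.reals 2 m j =
        if j ∈ selectedSet T (fun l => s.reals 8 l 0) then s.reals 9 m j else s.reals 2 m j := by
  set F : ℕ → ℝ := fun l => s.reals 8 l 0 with hF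
  set S := selectedSet T F with hS
  have hTd : ∀ j, j ∈ T ↔ j < d ∧ s.nats 2 j ≠ 0 := fun j => by rw [← hT, mem_memSet]
  have hSmem : ∀ j, j ∈ S ↔ j ∈ T ∧ 4 * lossRank T F j < #T := fun j => by
    rw [hS, selectedSet, mem_filter]
  refine Run.mono (.forLt (fun j s' => (∀ i < j, (s'.nats 5 i ≠ 0 ↔ i ∈ S)) ∧
    ∀ i < d, ∀ m < d, s'.reals 2 m i = if i ∈ S ∧ i < j then s.reals 9 m i else s.reals 2 m i)
    hdB (by decide) ?_ (by simp) ?_) ?_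
  · intro s' hA
    simp [NExpr.eval, hA.nats 0 (by decide), hd]
  · intro j s₁ hj ⟨h5, h2⟩ hv hA₁
    refine .seq (.setNat ?_)
    simp only [NExpr.eval, hv]
    set s₂ := s₁.setNat 5 j 0 with hs₂
    have o2 : ∀ a, a ≠ 5 → s₂.nats a = s₁.nats a := fun a ha => State.setNat_nats_of_ne _ _ _ ha
    have e2 : s₂.nats 2 = s.nats 2 := by rw [o2 2 (by decide), hA₁.nats 2 (by decide)]
    have e0 : s₂.nats 0 = s.nats 0 := by rw [o2 0 (by decide), hA₁.nats 0 (by decide)]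
    have e13 : s₂.nats 13 0 = j := by rw [o2 13 (by decide), hv]
    have e8 : s₂.reals 8 = s.reals 8 := hA₁.reals 8 (by decide)
    have e9 : s₂.reals 9 = s.reals 9 := hA₁.reals 9 (by decide)
    have skip_case : j ∉ S → ∀ s' : State, s'.nats 5 = s₂.nats 5 → s'.reals 2 = s₁.reals 2 →
        (∀ i < j + 1, ((s'.setNat 13 0 (j + 1)).nats 5 i ≠ 0 ↔ i ∈ S)) ∧
        ∀ i < d, ∀ m < d, (s'.setNat 13 0 (j + 1)).reals 2 m i =
          if i ∈ S ∧ i < j + 1 then s.reals 9 m i else s.reals 2 m i := by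
      intro hjS s' hs' hr'
      refine ⟨fun i hi => ?_, fun i hi m hm => ?_⟩
      · rw [State.setNat_nats_of_ne _ _ _ (by decide), hs', hs₂, State.setNat_nats]
        by_cases hij : i = j
        · simp [hij, hjS]
        · simp only [hij, and_false, if_false]
          exact h5 i (by lia)
      · rw [State.setNat_reals, hr', h2 i hi m hm]
        by_cases hij : i = j
        · simp [hij, hjS]
        · have : i < j + 1 ↔ i < j := by lia
          simp only [this]
    refine .branch (fun hb => .seq ((run_computeRank (T := T) (by rw [e0, hd]) (by rw [e2, hT]) e13
      hdB).mono fun s₃ hA₃ h₃ => ?_)) fun hb => .skip (skip_case ?_ _ rfl rfl)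
    · simp only [BExpr.Holds, NExpr.eval, e13, e2] at hb
      have hjT : j ∈ T := (hTd j).2 ⟨hj, by lia⟩
      rw [e8] at h₃
      have e32 : s₃.nats 32 0 = #T := by
        rw [hA₃.nats 32 (by decide), o2 32 (by decide), hA₁.nats 32 (by decide), hN]
      have f13 : s₃.nats 13 0 = j := by rw [hA₃.nats 13 (by decide), e13]
      refine .branch (fun hb' => .seq (.setNat ?_)) fun hb' => .skip (skip_case ?_ _ ?_ ?_)
      · simp only [BExpr.Holds, NExpr.eval, h₃, e32] at hb'
        have hjS : j ∈ S := (hSmem j).2 ⟨hjT, by simp only [hF]; lia⟩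
        simp only [NExpr.eval, f13]
        set s₄ := s₃.setNat 5 j 1 with hs₄
        have o4 : ∀ a, a ≠ 5 → s₄.nats a = s₃.nats a := fun a ha =>
          State.setNat_nats_of_ne _ _ _ ha
        have r4 : s₄.reals = s₃.reals := rfl
        refine (run_fillProg (N := d) (J := j) (fun m => s.reals 9 m j) hdB ?_ ?_ ?_).mono
          fun s₅ hA₅ h₅' => ⟨fun i hi => ?_, fun i hi m hm => ?_⟩
        · intro s' hA'
          simp [NExpr.eval, hA'.nats 0 (by decide), o4, hA₃.nats 0 (by decide), e0, hd]
        · intro s' hA'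
          simp [NExpr.eval, hA'.nats 13 (by decide), o4, f13]
        · intro i s' _ hi _ hA'
          simp [NExpr.eval, RExpr.eval, hi, hA'.nats 13 (by decide), o4, f13,
            hA'.reals 9 (by decide), r4, hA₃.reals 9 (by decide), e9]
        · rw [State.setNat_nats_of_ne _ _ _ (by decide), hA₅.nats 5 (by decide), hs₄,
            State.setNat_nats, hA₃.nats 5 (by decide), hs₂, State.setNat_nats]
          by_cases hij : i = j
          · simp [hij, hjS]
          · simp only [hij, and_false, if_false]
            exact h5 i (by lia)
        · rw [State.setNat_reals, h₅', r4, hA₃.reals 2 (by decide)]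
          by_cases hij : i = j
          · simp [hij, hm, hjS]
          · have : i < j + 1 ↔ i < j := by lia
            simp only [hij, and_false, if_false, this]
            exact h2 i hi m hm
      · simp only [BExpr.Holds, NExpr.eval, h₃, e32] at hb'
        rw [hSmem]
        simp only [hF]
        lia
      · rw [hA₃.nats 5 (by decide)]
      · rw [hA₃.reals 2 (by decide), hs₂, State.setNat_reals]
    · simp only [BExpr.Holds, NExpr.eval, e13, e2] at hb
      rw [hSmem, hTd]
      lia
  · intro s' _ ⟨h5, h2⟩
    refine ⟨?_, fun j hj m hm => ?_⟩
    · ext i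
      rw [mem_memSet]
      constructor
      · exact fun h => (h5 i h.1).1 h.2
      · intro h
        have hid : i < d := ((hTd i).1 ((hSmem i).1 h).1).1
        exact ⟨hid, (h5 i hid).2 h⟩
    · rw [h2 j hj m hm]
      simp [hj]

theorem run_removeColumns {T S : Finset ℕ} (hd : s.nats 0 1 = d)
    (hT : memSet d (s.nats 2) = T) (hS : memSet d (s.nats 5) = S) (hST : S ⊆ T)
    (hN : s.nats 32 0 = #T) (hdB : d ≤ B) :
    Run B removeColumns s fun s' =>
      memSet d (s'.nats 2) = T \ S ∧ s'.nats 32 0 = #(T \ S) := by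
  have hSd : ∀ j, j ∈ S ↔ j < d ∧ s.nats 5 j ≠ 0 := fun j => by rw [← hS, mem_memSet]
  refine Run.mono (.forLt (fun j s' => (∀ i < d, (s'.nats 2 i = if i ∈ S ∧ i < j then 0
    else s.nats 2 i)) ∧ s'.nats 32 0 = #T - #{i ∈ S | True ∧ i < j})
    hdB (by decide) ?_ ?_ ?_) ?_
  · intro s' hA
    simp [NExpr.eval, hA.nats 0 (by decide), hd]
  · simp [State.setNat_nats, hN]
  · intro j s₁ hj ⟨h2, h32⟩ hv hA₁
    have e5 : s₁.nats 5 = s.nats 5 := hA₁.nats 5 (by decide)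
    refine .branch (fun hb => .seq (.setNat (.setNat ?_))) fun hb => .skip ?_
    · simp only [BExpr.Holds, NExpr.eval, hv, e5] at hb
      have hjS : j ∈ S := (hSd j).2 ⟨hj, by lia⟩
      refine ⟨fun i hi => ?_, ?_⟩
      · simp only [State.setNat_nats, NExpr.eval, hv, h2 i hi]
        by_cases hij : i = j
        · simp [hij, hjS]
        · have : i < j + 1 ↔ i < j := by lia
          simp [hij, this]
      · rw [filter_lt_succ, if_pos ⟨hjS, trivial⟩, card_insert_of_notMem (by simp)]
        simp [State.setNat_nats, NExpr.eval, h32]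
        lia
    · simp only [BExpr.Holds, NExpr.eval, hv, e5] at hb
      have hjS : j ∉ S := fun h => ((hSd j).1 h).2 (by lia)
      refine ⟨fun i hi => ?_, ?_⟩
      · rw [State.setNat_nats_of_ne _ _ _ (by decide), h2 i hi]
        by_cases hij : i = j
        · simp [hij, hjS]
        · have : i < j + 1 ↔ i < j := by lia
          simp only [this]
      · rw [filter_lt_succ, if_neg (fun h => hjS h.1)]
        simp [State.setNat_nats, h32]
  · intro s' _ ⟨h2, h32⟩
    refine ⟨?_, ?_⟩
    · ext i
      rw [mem_memSet, mem_sdiff, ← hT, mem_memSet]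
      constructor
      · rintro ⟨hi, h⟩
        rw [h2 i hi] at h
        have : i ∉ S := fun h' => h (by rw [if_pos ⟨h', hi⟩])
        rw [if_neg (fun h => this h.1)] at h
        exact ⟨⟨hi, h⟩, this⟩
      · rintro ⟨⟨hi, h⟩, h'⟩
        exact ⟨hi, by rwa [h2 i hi, if_neg (fun h => h' h.1)]⟩
    · rw [h32, card_sdiff_of_subset hST]
      congr 2
      refine filter_true_of_mem fun i hi => ⟨trivial, ((hSd i).1 hi).1⟩

/-- The number of columns that remain after a round. -/
def nextCount (N : ℕ) : ℕ := N - (N + 3) / 4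

open Classical in
/-- The effect of a round with sample `H`. -/
structure RoundPost (n d : ℕ) (H : Finset ℕ) (s s' : State) : Prop where
  subset : memSet d (s'.nats 2) ⊆ memSet d (s.nats 2)
  card : #(memSet d (s'.nats 2)) = nextCount #(memSet d (s.nats 2))
  count : s'.nats 32 0 = #(memSet d (s'.nats 2))
  chosen : memSet d (s'.nats 3) = memSet d (s.nats 3) ∪ H
  old : ∀ j < d, j ∉ memSet d (s.nats 2) → ∀ m < d, s'.reals 2 m j = s.reals 2 m j
  supp : ∀ j ∈ memSet d (s.nats 2) \ memSet d (s'.nats 2), ∀ m < d, m ∉ H → s'.reals 2 m j = 0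
  loss : ∀ v : ℝ, #(memSet d (s.nats 2)) ≤ 4 * #{l ∈ memSet d (s.nats 2) | ∃ z : ℕ → ℝ,
      (∀ m < d, m ∉ H → z m = 0) ∧ 3 * vecLoss n (colResidual d (s.reals 0) l z) ≤ v} →
    ∀ j ∈ memSet d (s.nats 2) \ memSet d (s'.nats 2),
      vecLoss n (colResidual d (s.reals 0) j fun m => s'.reals 2 m j) ≤ v

theorem memSet_card_le (d : ℕ) (f : ℕ → ℕ) : #(memSet d f) ≤ d :=
  (card_filter_le _ _).trans_eq (card_range d)

/-- Everything random is concentrated in `cappedSample`, an explicit function of the tape; apart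
from it the round is deterministic, which lets the probabilistic analysis ignore the program. -/
theorem run_roundProg (hn : s.nats 0 0 = n) (hd : s.nats 0 1 = d) (hk : s.nats 0 2 = k)
    (hk1 : 1 ≤ k) (hN : s.nats 32 0 = #(memSet d (s.nats 2))) (hnB : n ≤ B) (hdB : d ≤ B)
    (hTB : 2 * n * n + 1 ≤ B) :
    Run B roundProg s fun s' =>
      (s'.coins = fun i => s.coins (i + d * level k #(memSet d (s.nats 2)))) ∧
      RoundPost n d (cappedSample k (memSet d (s.nats 2)) (level k #(memSet d (s.nats 2))) s.coins)
        s s' := by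
  classical
  set T := memSet d (s.nats 2) with hT
  have hNd : #T ≤ d := memSet_card_le _ _
  refine .seq ((run_chooseLevel hk hN hk1 (hNd.trans hdB)).mono fun s₁ hA₁ h₁ => ?_)
  set l := level k #T with hl
  set H := cappedSample k T l s.coins with hH
  have a0 : s₁.nats 0 = s.nats 0 := hA₁.nats 0 (by decide)
  refine .seq ((run_drawSample (k := k) (d := d) (T := T) (ω := s.coins) (by rw [a0, hd])
    (by rw [a0, hk]) h₁ (by rw [hA₁.nats 2 (by decide)]) (hA₁.coins (by decide)) hdB
    ((level_le hk1 _).trans (hNd.trans hdB))).mono fun s₂ hA₂ ⟨h4, h3, hc⟩ => ?_)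
  have b0 : s₂.nats 0 = s.nats 0 := (hA₂.nats 0 (by decide)).trans a0
  have bA : s₂.reals 0 = s.reals 0 := by rw [hA₂.reals 0 (by decide), hA₁.reals 0 (by decide)]
  refine .seq ((run_orthogonalize (by rw [b0, hn]) (by rw [b0, hd]) hnB hdB).mono
    fun s₃ hA₃ h₃ => ?_)
  have c0 : s₃.nats 0 = s.nats 0 := (hA₃.nats 0 (by decide)).trans b0
  have cA : s₃.reals 0 = s.reals 0 := (hA₃.reals 0 (by decide)).trans bA
  rw [bA, ← cA] at h₃
  refine .seq ((run_regressAll (by rw [c0, hn]) (by rw [c0, hd]) hnB hdB hTB h₃).mono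
    fun s₄ hA₄ h₄ => ?_)
  rw [cA] at h₄
  have d0 : s₄.nats 0 = s.nats 0 := (hA₄.nats 0 (by decide)).trans c0
  have t4 : s₄.nats 2 = s.nats 2 := by
    rw [hA₄.nats 2 (by decide), hA₃.nats 2 (by decide), hA₂.nats 2 (by decide),
      hA₁.nats 2 (by decide)]
  have n4 : s₄.nats 32 0 = #T := by
    rw [hA₄.nats 32 (by decide), hA₃.nats 32 (by decide), hA₂.nats 32 (by decide),
      hA₁.nats 32 (by decide), hN]
  have x4 : s₄.reals 2 = s.reals 2 := by
    rw [hA₄.reals 2 (by decide), hA₃.reals 2 (by decide), hA₂.reals 2 (by decide),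
      hA₁.reals 2 (by decide)]
  set F : ℕ → ℝ := fun l => s₄.reals 8 l 0 with hF
  refine .seq ((run_selectColumns (T := T) (by rw [d0, hd]) (by rw [t4]) n4 hdB).mono
    fun s₅ hA₅ ⟨h5, h5'⟩ => ?_)
  set S := selectedSet T F with hS
  have hST : S ⊆ T := filter_subset _ _
  refine (run_removeColumns (T := T) (S := S) (by rw [hA₅.nats 0 (by decide), d0, hd])
    (by rw [hA₅.nats 2 (by decide), t4]) h5 hST (by rw [hA₅.nats 32 (by decide), n4]) hdB).mono
    fun s₆ hA₆ ⟨h6, h6'⟩ => ⟨?_, ?_⟩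
  · rw [hA₆.coins (by decide), hA₅.coins (by decide), hA₄.coins (by decide), hA₃.coins (by decide),
      hc]
  have x6 : ∀ j < d, ∀ m < d, s₆.reals 2 m j = if j ∈ S then s₄.reals 9 m j else s.reals 2 m j := by
    intro j hj m hm
    rw [hA₆.reals 2 (by decide), h5' j hj m hm, x4]
  have hTS : T \ memSet d (s₆.nats 2) = S := by rw [h6, Finset.sdiff_sdiff_eq_self hST]
  have hmd : ∀ j ∈ T, j < d := fun j hj => (mem_memSet.1 hj).1
  have hHmem : ∀ m < d, m ∉ H ↔ ¬ s₂.nats 4 m ≠ 0 := by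
    intro m hm
    rw [hH, ← h4, mem_memSet]
    simp [hm]
  refine ⟨?_, ?_, ?_, ?_, ?_, ?_, ?_⟩
  · rw [h6]; exact sdiff_subset
  · rw [h6, card_sdiff_of_subset hST, hS, selectedSet, card_lossRank, nextCount]
  · rw [h6, h6']
  · rw [hA₆.nats 3 (by decide), hA₅.nats 3 (by decide), hA₄.nats 3 (by decide),
      hA₃.nats 3 (by decide), h3, hA₁.nats 3 (by decide)]
  · intro j hj hjT m hm
    rw [x6 j hj m hm, if_neg fun h => hjT (hST h)]
  · rw [hTS]
    intro j hj m hm hmH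
    have hjd := hmd j (hST hj)
    rw [x6 j hjd m hm, if_pos hj]
    exact (h₄ j hjd).supp m hm ((hHmem m hm).1 hmH)
  · rw [hTS]
    intro v hv j hj
    have hjd := hmd j (hST hj)
    have e : vecLoss n (colResidual d (s.reals 0) j fun m => s₆.reals 2 m j) = F j := by
      refine Eq.trans ?_ (h₄ j hjd).loss.symm
      refine vecLoss_congr fun i _ => colResidual_congr (fun m hm => ?_) i
      rw [x6 j hjd m hm, if_pos hj]
    rw [e]
    have hj' : 4 * lossRank T F j < #T := (mem_filter.1 hj).2
    -- A competitor `z` on the sample bounds the computed loss through the factor `3` of the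
    -- regression. So at least a quarter of the computed losses are at most `v`, and hence so are
    -- the smallest quarter.
    refine le_of_lossRank (hv.trans ?_) hj'
    gcongr 4 * ?_
    refine card_le_card fun l hl => ?_
    rw [mem_filter] at hl ⊢
    obtain ⟨hlT, z, hz, hzv⟩ := hl
    exact ⟨hlT, ((h₄ l (hmd l hlT)).le z fun m hm h => hz m hm ((hHmem m hm).2 h)).trans hzv⟩

end HuberCSS

/-! ### Columns that are short combinations of others -/

namespace HuberCSS

open Finset RealRAM

/-- A linear relation between the columns in `U` in which column `i` has a large coefficient exhibits
it as a short combination of the others. -/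
theorem exists_short_combination {n d : ℕ} {M : Matrix (Fin n) (Fin d) ℝ} {U : Finset (Fin d)}
    {i : Fin d} (hi : i ∈ U) {y : Fin d → ℝ} (hy : ∀ r, ∑ j ∈ U, M r j * y j = 0)
    (hsum : ∑ j, y j ^ 2 = y i) (hyi : 1 / 2 ≤ y i) :
    ∃ x : Fin d → ℝ, (∀ j ∉ U.erase i, x j = 0) ∧ ∑ j, x j ^ 2 ≤ 1 ∧
      ∀ r, M r i = ∑ j, M r j * x j := by
  have hpos : 0 < y i := by linarith
  -- Solve the relation for column `i`. The hypothesis on the norm of `y` bounds the square sum of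
  -- the new coefficients by `(y i - y i ^ 2) / y i ^ 2`, which is at most `1` since `y i ≥ 1 / 2`.
  refine ⟨fun j => if j ∈ U.erase i then -(y j / y i) else 0, fun j hj => by simp [hj], ?_,
    fun r => ?_⟩
  · have h1 : ∑ j, (if j ∈ U.erase i then -(y j / y i) else 0) ^ 2 =
        (∑ j ∈ U.erase i, y j ^ 2) / y i ^ 2 := by
      rw [sum_div, ← sum_filter_add_sum_filter_not univ (fun j => j ∈ U.erase i)]
      rw [sum_eq_zero (s := univ.filter fun j => j ∉ U.erase i)
        fun j hj => by simp [(mem_filter.1 hj).2], add_zero]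
      rw [filter_univ_mem]
      exact sum_congr rfl fun j hj => by simp only [hj, if_true]; rw [neg_sq, div_pow]
    have h2 : ∑ j ∈ U.erase i, y j ^ 2 + y i ^ 2 ≤ y i := by
      rw [sum_erase_add _ _ hi, ← hsum]
      exact sum_le_sum_of_subset_of_nonneg (subset_univ _) fun _ _ _ => sq_nonneg _
    rw [h1, div_le_one (by positivity)]
    nlinarith
  · have h1 := hy r
    rw [← sum_erase_add _ _ hi] at h1
    have h2 : ∑ j, M r j * (if j ∈ U.erase i then -(y j / y i) else 0) =
        -(∑ j ∈ U.erase i, M r j * y j) / y i := by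
      simp only [mul_ite, mul_zero]
      rw [← sum_filter, filter_univ_mem, ← sum_neg_distrib, sum_div]
      exact sum_congr rfl fun j _ => by ring
    rw [h2, eq_div_iff hpos.ne']
    linarith

/-- All but `2 k` of the columns in `U` of a matrix of rank `k` are combinations of the others with
coefficient vectors of norm at most `1`. -/
theorem card_long_combination_le {n d k : ℕ} (M : Matrix (Fin n) (Fin d) ℝ) (hM : M.rank ≤ k)
    (U Z : Finset (Fin d)) (hZU : Z ⊆ U)
    (hZ : ∀ i ∈ Z, ¬ ∃ x : Fin d → ℝ, (∀ j ∉ U.erase i, x j = 0) ∧ ∑ j, x j ^ 2 ≤ 1 ∧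
      ∀ r, M r i = ∑ j, M r j * x j) : #Z ≤ 2 * k := by
  classical
  -- The columns outside `U` are zeroed, so that the kernel encodes the relations among the columns
  -- in `U` only.
  set D : Matrix (Fin n) (Fin d) ℝ :=
    M * Matrix.diagonal (fun j => if j ∈ U then (1 : ℝ) else 0) with hD
  have hDrank : D.rank ≤ k := (Matrix.rank_mul_le_left _ _).trans hM
  set f : EuclideanSpace ℝ (Fin d) →ₗ[ℝ] (Fin n → ℝ) :=
    D.mulVecLin ∘ₗ (WithLp.linearEquiv 2 ℝ (Fin d → ℝ)).toLinearMap with hf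
  have hker : ∀ y, f y = 0 → ∀ r, ∑ j ∈ U, M r j * y j = 0 := fun y hy r => by
    have h1 : ∑ j, D r j * y j = 0 := congrFun hy r
    simpa [hD, Matrix.mul_diagonal, ite_mul] using h1
  have hrange : Module.finrank ℝ (LinearMap.range f) ≤ k := by
    have h3 : LinearMap.range f = LinearMap.range D.mulVecLin := by
      rw [hf]; exact LinearMap.range_comp_of_range_eq_top _ (LinearEquiv.range _)
    rw [h3]
    exact hDrank
  clear_value f
  -- This is the row space, of dimension at most `k`. The quantities `‖P (e i)‖ ^ 2` are the
  -- leverage scores; they sum to the trace of the projection, so at most `2 k` of them reach `1 /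
  -- 2`.
  set W := (LinearMap.ker f)ᗮ with hW
  have hfin : Module.finrank ℝ W ≤ k := by
    have h1 := (LinearMap.ker f).finrank_add_finrank_orthogonal
    have h2 := f.finrank_range_add_finrank_ker
    rw [← hW] at h1
    omega
  set e : Fin d → EuclideanSpace ℝ (Fin d) := fun i => EuclideanSpace.single i 1 with he
  set P := W.starProjection with hP
  have hnorm : ∀ i, (P (e i)) i = ‖P (e i)‖ ^ 2 := by
    intro i
    have h := W.starProjection_inner_eq_zero (e i) _ (W.starProjection_apply_mem (e i))
    rw [inner_sub_left, real_inner_self_eq_norm_sq, sub_eq_zero] at h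
    rw [hP, ← h]
    simp [he, EuclideanSpace.inner_single_left]
  have htrace : ∑ i, ‖P (e i)‖ ^ 2 = Module.finrank ℝ W := by
    have hproj : LinearMap.IsProj W (P : EuclideanSpace ℝ (Fin d) →ₗ[ℝ] _) :=
      ⟨fun x => W.starProjection_apply_mem x, fun x hx => Submodule.starProjection_eq_self_iff.2 hx⟩
    rw [← hproj.trace, LinearMap.trace_eq_sum_inner _ (EuclideanSpace.basisFun (Fin d) ℝ)]
    refine sum_congr rfl fun i _ => ?_
    rw [← hnorm i]
    simp [he, EuclideanSpace.inner_single_left]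
  have hbig : ∀ i ∈ Z, (1 / 2 : ℝ) ≤ ‖P (e i)‖ ^ 2 := by
    intro i hi
    by_contra! hlt
    -- With a leverage score below `1 / 2`, the projection of `e i` on the kernel is a relation
    -- whose coefficient at `i` equals its square norm and exceeds `1 / 2`.
    have hyK : f (e i - P (e i)) = 0 := by
      have : e i - P (e i) ∈ Wᗮ := W.sub_starProjection_mem_orthogonal (e i)
      rwa [hW, Submodule.orthogonal_orthogonal] at this
    have hyi : (e i - P (e i)) i = 1 - ‖P (e i)‖ ^ 2 := by
      rw [PiLp.sub_apply, hnorm i]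
      simp [he]
    refine hZ i hi (exists_short_combination (hZU hi) (hker _ hyK) ?_ (by linarith))
    rw [hyi]
    have h1 : ‖e i - P (e i)‖ ^ 2 = ∑ j, (e i - P (e i)) j ^ 2 := by
      rw [EuclideanSpace.norm_sq_eq]
      simp
    have h2 : inner ℝ (e i - P (e i)) (P (e i)) = 0 :=
      W.starProjection_inner_eq_zero (e i) _ (W.starProjection_apply_mem _)
    have h3 := norm_add_sq_real (e i - P (e i)) (P (e i))
    rw [h2, sub_add_cancel, h1] at h3
    have h4 : ‖e i‖ = 1 := by simp [he]
    rw [h4] at h3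
    linarith
  have h1 : (#Z : ℝ) * (1 / 2) ≤ ∑ i ∈ Z, ‖P (e i)‖ ^ 2 := by
    rw [← nsmul_eq_mul]
    exact card_nsmul_le_sum _ _ _ hbig
  have h2 : ∑ i ∈ Z, ‖P (e i)‖ ^ 2 ≤ ∑ i, ‖P (e i)‖ ^ 2 :=
    sum_le_sum_of_subset_of_nonneg (subset_univ _) fun _ _ _ => by positivity
  have h3 : (Module.finrank ℝ W : ℝ) ≤ k := by exact_mod_cast hfin
  have : (#Z : ℝ) ≤ 2 * k := by linarith
  exact_mod_cast this

/-- Column `i` of `M` is not a combination of the columns in `V` with a coefficient vector of norm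
at most `1`. -/
def IsLong (n d : ℕ) (M : ℕ → ℕ → ℝ) (V : Finset ℕ) (i : ℕ) : Prop :=
  ¬ ∃ x : ℕ → ℝ, (∀ j ∉ V, x j = 0) ∧ ∑ j ∈ range d, x j ^ 2 ≤ 1 ∧
    ∀ r < n, M r i = ∑ j ∈ range d, M r j * x j

/-- The entries of a matrix as a function on pairs of naturals. -/
def entries {n d : ℕ} (M : Matrix (Fin n) (Fin d) ℝ) (i j : ℕ) : ℝ :=
  if h : i < n ∧ j < d then M ⟨i, h.1⟩ ⟨j, h.2⟩ else 0

theorem entries_fin {n d : ℕ} (M : Matrix (Fin n) (Fin d) ℝ) (i : Fin n) (j : Fin d) :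
    entries M i j = M i j := by simp [entries]

open Classical in
theorem card_isLong_le {n d k : ℕ} (M : Matrix (Fin n) (Fin d) ℝ) (hM : M.rank ≤ k)
    {U : Finset ℕ} (hU : U ⊆ range d) :
    #{i ∈ U | IsLong n d (entries M) (U.erase i) i} ≤ 2 * k := by
  set Z := {i ∈ U | IsLong n d (entries M) (U.erase i) i} with hZ
  have hlt : ∀ V : Finset ℕ, V ⊆ range d → ∀ i ∈ V, i < d := fun V hV i hi => mem_range.1 (hV hi)
  have hZd : Z ⊆ range d := (filter_subset _ _).trans hU
  have h := card_long_combination_le M hM (U.attachFin (hlt U hU)) (Z.attachFin (hlt Z hZd))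
    (fun i hi => by
      rw [mem_attachFin] at hi ⊢
      exact filter_subset _ _ hi)
    (fun i hi => by
      rw [mem_attachFin, hZ, mem_filter] at hi
      rintro ⟨x, hx, hx1, hxM⟩
      refine hi.2 ⟨fun j => if h : j < d then x ⟨j, h⟩ else 0, fun j hj => ?_, ?_, fun r hr => ?_⟩
      · dsimp only
        split_ifs with h
        · refine hx _ fun h' => hj ?_
          rw [mem_erase, mem_attachFin] at h'
          rw [mem_erase]
          exact ⟨fun h'' => h'.1 (Fin.ext h''), h'.2⟩
        · rfl
      · rw [Finset.sum_range]
        simpa using hx1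
      · rw [Finset.sum_range]
        have := hxM ⟨r, hr⟩
        simpa [entries, hr] using this)
  rwa [card_attachFin] at h

end HuberCSS

/-! ### Averages over coin tosses -/

namespace RealRAM

def consCoin (b : Bool) (ω : ℕ → Bool) : ℕ → Bool
  | 0 => b
  | i + 1 => ω i

/-- The average of `f` over the first `m` coins of a tape that continues with `ρ`. -/
noncomputable def coinAvg : ℕ → ((ℕ → Bool) → ℝ) → (ℕ → Bool) → ℝ
  | 0, f, ρ => f ρ
  | m + 1, f, ρ =>
    (coinAvg m (fun ω => f (consCoin true ω)) ρ + coinAvg m (fun ω => f (consCoin false ω)) ρ) / 2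

theorem coinAvg_mono {m : ℕ} {f g : (ℕ → Bool) → ℝ} (h : ∀ ω, f ω ≤ g ω) (ρ : ℕ → Bool) :
    coinAvg m f ρ ≤ coinAvg m g ρ := by
  induction m generalizing f g with
  | zero => exact h ρ
  | succ m ih =>
    have h1 := ih fun ω => h (consCoin true ω)
    have h2 := ih fun ω => h (consCoin false ω)
    simp only [coinAvg]
    linarith

theorem coinAvg_const (m : ℕ) (c : ℝ) (ρ : ℕ → Bool) : coinAvg m (fun _ => c) ρ = c := by
  induction m with
  | zero => rfl
  | succ m ih => rw [coinAvg, ih]; ring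

theorem coinAvg_add (m : ℕ) (f g : (ℕ → Bool) → ℝ) (ρ : ℕ → Bool) :
    coinAvg m (fun ω => f ω + g ω) ρ = coinAvg m f ρ + coinAvg m g ρ := by
  induction m generalizing f g with
  | zero => rfl
  | succ m ih => simp only [coinAvg, ih]; ring

theorem coinAvg_mul (m : ℕ) (c : ℝ) (f : (ℕ → Bool) → ℝ) (ρ : ℕ → Bool) :
    coinAvg m (fun ω => c * f ω) ρ = c * coinAvg m f ρ := by
  induction m generalizing f with
  | zero => rfl
  | succ m ih => simp only [coinAvg, ih]; ring

theorem appendCoins_succ (m : ℕ) (b : Bool) (ω ω' : ℕ → Bool) :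
    appendCoins (m + 1) (consCoin b ω) ω' = consCoin b (appendCoins m ω ω') := by
  funext i
  cases i <;> simp [appendCoins, consCoin]

/-- Fubini for two consecutive blocks of coins. The tape `ρ'` is arbitrary because only the first
`m` coins of `ω` survive in `appendCoins m ω ω'`. -/
theorem coinAvg_append (m m' : ℕ) (f : (ℕ → Bool) → ℝ) (ρ ρ' : ℕ → Bool) :
    coinAvg (m + m') f ρ =
      coinAvg m (fun ω => coinAvg m' (fun ω' => f (appendCoins m ω ω')) ρ) ρ' := by
  induction m generalizing f with
  | zero =>
    simp only [zero_add, coinAvg]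
    congr 1
  | succ m ih =>
    rw [Nat.add_right_comm]
    simp only [coinAvg, ih, appendCoins_succ]

/-- The tape that carries the coins `ω`, followed by `false`. -/
def padCoins {T : ℕ} (ω : Fin T → Bool) : ℕ → Bool := fun m => if h : m < T then ω ⟨m, h⟩ else false

theorem padCoins_cons {T : ℕ} (b : Bool) (ω : Fin T → Bool) :
    padCoins (Fin.cons b ω : Fin (T + 1) → Bool) = consCoin b (padCoins ω) := by
  funext i
  cases i with
  | zero => simp [padCoins, consCoin]
  | succ i =>
    simp only [padCoins, consCoin, Nat.add_lt_add_iff_right]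
    split_ifs with h
    · exact Fin.cons_succ (α := fun _ => Bool) b ω ⟨i, h⟩
    · rfl

theorem sum_padCoins (T : ℕ) (f : (ℕ → Bool) → ℝ) :
    (∑ ω : Fin T → Bool, f (padCoins ω)) / 2 ^ T = coinAvg T f fun _ => false := by
  induction T generalizing f with
  | zero =>
    simp only [pow_zero, div_one, coinAvg, Finset.univ_unique, Finset.sum_singleton]
    congr 1
  | succ T ih =>
    rw [← (Fin.consEquiv fun _ : Fin (T + 1) => Bool).sum_comp, Fintype.sum_prod_type]
    simp only [Fin.consEquiv, Equiv.coe_fn_mk, Fintype.sum_bool, padCoins_cons, coinAvg, ← ih]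
    rw [pow_succ]
    field_simp

open Classical in
theorem coinProb_eq (T : ℕ) (E : (ℕ → Bool) → Prop) :
    coinProb T (fun ω => E (padCoins ω)) =
      coinAvg T (fun ω => if E ω then 1 else 0) fun _ => false := by
  rw [← sum_padCoins, coinProb, Nat.card_eq_fintype_card, Fintype.card_subtype]
  simp

end RealRAM

/-! ### Random samples -/

namespace HuberCSS

open Finset RealRAM

/-- The expectation of `F` on a random subset of `T` that contains each element with probability
`p`, independently. -/
noncomputable def sampleAvg (p : ℝ) (T : Finset ℕ) (F : Finset ℕ → ℝ) : ℝ :=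
  ∑ H ∈ T.powerset, p ^ #H * (1 - p) ^ #(T \ H) * F H

theorem sampleAvg_insert (p : ℝ) {T : Finset ℕ} {a : ℕ} (ha : a ∉ T) (F : Finset ℕ → ℝ) :
    sampleAvg p (insert a T) F =
      p * sampleAvg p T (fun H => F (insert a H)) + (1 - p) * sampleAvg p T F := by
  rw [sampleAvg, sum_powerset_insert ha, add_comm]
  congr 1
  · rw [sampleAvg, mul_sum]
    refine sum_congr rfl fun H hH => ?_
    have haH : a ∉ H := fun h => ha (mem_powerset.1 hH h)
    rw [card_insert_of_notMem haH]
    have : insert a T \ insert a H = T \ H := by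
      ext x; simp only [mem_sdiff, mem_insert]; grind
    rw [this]
    ring
  · rw [sampleAvg, mul_sum]
    refine sum_congr rfl fun H hH => ?_
    have haH : a ∉ H := fun h => ha (mem_powerset.1 hH h)
    have : insert a T \ H = insert a (T \ H) := by
      ext x; simp only [mem_sdiff, mem_insert]; grind
    rw [this, card_insert_of_notMem (by simp [ha])]
    ring

theorem sampleAvg_empty (p : ℝ) (F : Finset ℕ → ℝ) : sampleAvg p ∅ F = F ∅ := by
  simp [sampleAvg]

theorem sampleAvg_congr {p : ℝ} {T : Finset ℕ} {F F' : Finset ℕ → ℝ} (h : ∀ H ⊆ T, F H = F' H) :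
    sampleAvg p T F = sampleAvg p T F' :=
  sum_congr rfl fun H hH => by rw [h H (mem_powerset.1 hH)]

theorem sampleAvg_mono {p : ℝ} (hp0 : 0 ≤ p) (hp1 : p ≤ 1) {T : Finset ℕ} {F F' : Finset ℕ → ℝ}
    (h : ∀ H ⊆ T, F H ≤ F' H) : sampleAvg p T F ≤ sampleAvg p T F' := by
  refine sum_le_sum fun H hH => ?_
  have h1 : 0 ≤ 1 - p := by linarith
  have := h H (mem_powerset.1 hH)
  gcongr

theorem sampleAvg_const (p : ℝ) (T : Finset ℕ) (c : ℝ) : sampleAvg p T (fun _ => c) = c := by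
  induction T using Finset.induction_on with
  | empty => exact sampleAvg_empty _ _
  | insert a T ha ih => rw [sampleAvg_insert p ha, ih]; ring

theorem sampleAvg_sum {ι : Type*} (p : ℝ) (T : Finset ℕ) (S : Finset ι) (F : ι → Finset ℕ → ℝ) :
    sampleAvg p T (fun H => ∑ i ∈ S, F i H) = ∑ i ∈ S, sampleAvg p T (F i) := by
  simp only [sampleAvg, mul_sum]
  exact sum_comm

theorem sampleAvg_add (p : ℝ) (T : Finset ℕ) (F F' : Finset ℕ → ℝ) :
    sampleAvg p T (fun H => F H + F' H) = sampleAvg p T F + sampleAvg p T F' := by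
  simp only [sampleAvg, mul_add, sum_add_distrib]

theorem sampleAvg_mul (p : ℝ) (T : Finset ℕ) (c : ℝ) (F : Finset ℕ → ℝ) :
    sampleAvg p T (fun H => c * F H) = c * sampleAvg p T F := by
  simp only [sampleAvg, mul_sum]
  exact sum_congr rfl fun _ _ => by ring

/-- Whether `i` is sampled is independent of the rest of the sample. Together with
`sampleAvg_notMem` this allows exchanging sampled and unsampled elements. -/
theorem sampleAvg_mem (p : ℝ) {T : Finset ℕ} {i : ℕ} (hi : i ∈ T) (g : Finset ℕ → ℝ) :
    sampleAvg p T (fun H => if i ∈ H then g (H.erase i) else 0) =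
      p * sampleAvg p (T.erase i) g := by
  conv_lhs => rw [← insert_erase hi]
  rw [sampleAvg_insert p (notMem_erase i T)]
  have h1 : sampleAvg p (T.erase i) (fun H => if i ∈ H then g (H.erase i) else 0) = 0 := by
    refine (sampleAvg_congr fun H hH => ?_).trans (sampleAvg_const p (T.erase i) 0)
    exact if_neg fun h => notMem_erase i T (hH h)
  have h2 : sampleAvg p (T.erase i)
      (fun H => if i ∈ insert i H then g ((insert i H).erase i) else 0) =
        sampleAvg p (T.erase i) g :=
    sampleAvg_congr fun H hH => by
      rw [if_pos (mem_insert_self i H), erase_insert fun h => notMem_erase i T (hH h)]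
  rw [h1, h2, mul_zero, add_zero]

theorem sampleAvg_notMem (p : ℝ) {T : Finset ℕ} {i : ℕ} (hi : i ∈ T) (g : Finset ℕ → ℝ) :
    sampleAvg p T (fun H => if i ∈ H then 0 else g H) = (1 - p) * sampleAvg p (T.erase i) g := by
  conv_lhs => rw [← insert_erase hi]
  rw [sampleAvg_insert p (notMem_erase i T)]
  have h1 : sampleAvg p (T.erase i) (fun H => if i ∈ H then 0 else g H) =
      sampleAvg p (T.erase i) g :=
    sampleAvg_congr fun H hH => if_neg fun h => notMem_erase i T (hH h)
  have h2 : sampleAvg p (T.erase i) (fun H => if i ∈ insert i H then 0 else g (insert i H)) = 0 := by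
    simp only [mem_insert_self, if_true]
    exact sampleAvg_const _ _ _
  rw [h1, h2, mul_zero, zero_add]

theorem coinAvg_forall (l : ℕ) (a b : ℝ) (ρ : ℕ → Bool) :
    coinAvg l (fun ω => if ∀ i < l, ω i = true then a else b) ρ =
      (1 / 2) ^ l * a + (1 - (1 / 2) ^ l) * b := by
  induction l with
  | zero => simp [coinAvg]
  | succ l ih =>
    have h1 : ∀ ω, (∀ i < l + 1, consCoin true ω i = true) ↔ ∀ i < l, ω i = true := fun ω => by
      constructor
      · intro h i hi
        exact h (i + 1) (by lia)
      · rintro h (_ | i) hi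
        · rfl
        · exact h i (by lia)
    have h2 : ∀ ω, ¬ ∀ i < l + 1, consCoin false ω i = true := fun ω h => by
      simpa [consCoin] using h 0 (by lia)
    simp only [coinAvg, h1, h2, if_false, ih, coinAvg_const]
    ring

/-- Distinct columns use disjoint blocks of coins, so they are sampled independently. The induction
on `d` peels off the last block, which decides about column `d`. -/
theorem coinAvg_sampleSet {d : ℕ} {T : Finset ℕ} (hT : T ⊆ range d) (l : ℕ) (F : Finset ℕ → ℝ)
    (ρ : ℕ → Bool) :
    coinAvg (d * l) (fun ω => F (sampleSet T l ω)) ρ = sampleAvg ((1 / 2) ^ l) T F := by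
  induction d generalizing T F ρ with
  | zero =>
    obtain rfl : T = ∅ := by simpa using hT
    simp [sampleSet, coinAvg, sampleAvg_empty]
  | succ d ih =>
    have hT' : T.erase d ⊆ range d := fun j hj => by
      rw [mem_erase] at hj
      have := mem_range.1 (hT hj.2)
      rw [mem_range]
      lia
    rw [add_mul, one_mul, coinAvg_append _ _ _ ρ ρ]
    have hlow : ∀ ω ω', sampleSet (T.erase d) l (appendCoins (d * l) ω ω') =
        sampleSet (T.erase d) l ω := fun ω ω' => by
      refine filter_congr fun j hj => forall₂_congr fun i hi => ?_
      have hjd := mem_range.1 (hT' hj)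
      have : j * l + i < d * l := by nlinarith
      simp [appendCoins, this]
    have htop : ∀ ω ω' i, appendCoins (d * l) ω ω' (d * l + i) = ω' i := fun ω ω' i => by
      simp [appendCoins]
    by_cases hd : d ∈ T
    · have key : ∀ ω ω', sampleSet T l (appendCoins (d * l) ω ω') =
          if ∀ i < l, ω' i = true then insert d (sampleSet (T.erase d) l ω)
          else sampleSet (T.erase d) l ω := fun ω ω' => by
        rw [← hlow ω ω']
        split_ifs with h
        · ext j
          simp only [sampleSet, mem_filter, mem_insert, mem_erase]
          by_cases hj : j = d
          · subst hj
            simpa [hd, htop] using h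
          · simp [hj]
        · ext j
          simp only [sampleSet, mem_filter, mem_erase]
          by_cases hj : j = d
          · subst hj
            simpa [hd, htop] using h
          · simp [hj]
      have key' : ∀ ω ω', F (sampleSet T l (appendCoins (d * l) ω ω')) =
          if ∀ i < l, ω' i = true then F (insert d (sampleSet (T.erase d) l ω))
          else F (sampleSet (T.erase d) l ω) := fun ω ω' => by
        rw [key]
        split_ifs <;> rfl
      simp only [key', coinAvg_forall, coinAvg_add, coinAvg_mul]
      rw [ih hT' (fun H => F (insert d H)), ih hT' F, ← sampleAvg_insert _ (notMem_erase d T),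
        insert_erase hd]
    · rw [erase_eq_of_notMem hd] at hlow hT'
      simp only [hlow, coinAvg_const]
      exact ih hT' F ρ

open Classical in
/-- The sample is good with probability at least `1 / 2`. -/
theorem half_le_sampleAvg {k : ℕ} (hk : 1 ≤ k) {T G : Finset ℕ} (hG : G ⊆ T) (hT : T.Nonempty)
    (Bad : Finset ℕ → ℕ → Prop) (hBad : ∀ U ⊆ G, #{i ∈ U | Bad (U.erase i) i} ≤ 2 * k) :
    1 / 2 ≤ sampleAvg ((1 / 2) ^ level k #T) T fun H =>
      if #H ≤ 256 * k ∧ 4 * #{i ∈ G \ H | Bad (H ∩ G) i} ≤ #T then 1 else 0 := by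
  set l := level k #T with hl
  set p : ℝ := (1 / 2) ^ l with hp
  have hp0 : 0 < p := by positivity
  have hp1 : p ≤ 1 := pow_le_one₀ (by norm_num) (by norm_num)
  have hp2 : p * 2 ^ l = 1 := by rw [hp, ← mul_pow]; norm_num
  have hk0 : (0 : ℝ) < k := by exact_mod_cast hk
  have hT0 : (0 : ℝ) < #T := by exact_mod_cast card_pos.2 hT
  have hpT : p * #T ≤ 64 * k := by
    have h1 : (#T : ℝ) ≤ 64 * k * 2 ^ l := by exact_mod_cast level_spec hk #T
    have h2 := mul_le_mul_of_nonneg_left h1 hp0.le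
    have h3 : p * (64 * k * 2 ^ l) = 64 * k * (p * 2 ^ l) := by ring
    rw [h3, hp2] at h2
    linarith
  have hcard : sampleAvg p T (fun H => (#H : ℝ)) = p * #T := by
    have h1 : sampleAvg p T (fun H => (#H : ℝ)) =
        sampleAvg p T (fun H => ∑ i ∈ T, if i ∈ H then (1 : ℝ) else 0) :=
      sampleAvg_congr fun H hH => by
        rw [sum_ite_mem, inter_eq_right.2 hH]; simp
    rw [h1, sampleAvg_sum, sum_congr rfl fun i hi => (sampleAvg_mem p hi fun _ => 1)]
    simp [sampleAvg_const]
    ring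
  -- The exchange argument: for fixed `i`, both events, `i` bad and not in `H`, and `i` bad in `H`
  -- relative to the rest, are governed by the sample without `i`. Their probabilities are in ratio
  -- `(1 - p) : p`, and `hBad` with `U = H ∩ G` limits the number of the latter to `2 k` for every
  -- sample.
  have hbad : p * sampleAvg p T (fun H => (#{i ∈ G \ H | Bad (H ∩ G) i} : ℝ)) ≤
      (1 - p) * (2 * k) := by
    have h1 : sampleAvg p T (fun H => (#{i ∈ G \ H | Bad (H ∩ G) i} : ℝ)) =
        sampleAvg p T (fun H => ∑ i ∈ G, if i ∈ H then (0 : ℝ) else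
          if Bad (H ∩ G) i then 1 else 0) :=
      sampleAvg_congr fun H hH => by
        rw [card_filter, Nat.cast_sum, ← filter_notMem_eq_sdiff, sum_filter]
        refine sum_congr rfl fun i _ => ?_
        split_ifs <;> simp_all
    have h2 : sampleAvg p T (fun H => ∑ i ∈ G, if i ∈ H then
        (if Bad ((H.erase i) ∩ G) i then (1 : ℝ) else 0) else 0) ≤ 2 * k := by
      rw [← sampleAvg_const p T (2 * k : ℝ)]
      refine sampleAvg_mono hp0.le hp1 fun H hH => ?_
      have h3 := hBad (H ∩ G) inter_subset_right
      have h4 : ∑ i ∈ G, (if i ∈ H then (if Bad ((H.erase i) ∩ G) i then (1 : ℝ) else 0) else 0) =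
          (#{i ∈ H ∩ G | Bad ((H ∩ G).erase i) i} : ℝ) := by
        rw [card_filter, Nat.cast_sum, inter_comm H G, ← filter_mem_eq_inter, sum_filter]
        refine sum_congr rfl fun i _ => ?_
        rw [filter_mem_eq_inter, inter_comm G H, ← erase_inter]
        split_ifs <;> simp
      rw [h4]
      exact_mod_cast h3
    rw [sampleAvg_sum, sum_congr rfl fun i hi => (sampleAvg_mem p (hG hi)
      fun H => if Bad (H ∩ G) i then (1 : ℝ) else 0), ← mul_sum] at h2
    rw [h1, sampleAvg_sum, sum_congr rfl fun i hi => (sampleAvg_notMem p (hG hi)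
      fun H => if Bad (H ∩ G) i then (1 : ℝ) else 0), ← mul_sum]
    have h5 : 0 ≤ 1 - p := by linarith
    have h6 := mul_le_mul_of_nonneg_left h2 h5
    linarith
  -- For `l = 0` everything is sampled and no bad element remains. Otherwise minimality of the level
  -- gives `p * #T > 32 k`, so `2 k / p < #T / 16`.
  have hbad' : sampleAvg p T (fun H => (#{i ∈ G \ H | Bad (H ∩ G) i} : ℝ)) ≤ #T / 16 := by
    refine le_of_mul_le_mul_left (hbad.trans ?_) hp0
    rcases Nat.eq_zero_or_pos l with h0 | h0
    · have : p = 1 := by rw [hp, h0, pow_zero]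
      rw [this, sub_self, zero_mul]
      positivity
    · have h1 : 64 * k * 2 ^ (l - 1) < #T := (lt_level_iff hk).1 (by lia)
      have h2 : (64 * k * 2 ^ (l - 1) : ℝ) < #T := by exact_mod_cast h1
      have h3 : (2 : ℝ) ^ l = 2 ^ (l - 1) * 2 := by rw [← pow_succ]; congr 1; lia
      have h4 : p * 2 ^ (l - 1) = 1 / 2 := by rw [h3] at hp2; linarith
      have h5 := mul_le_mul_of_nonneg_left h2.le hp0.le
      have h6 : p * (64 * k * 2 ^ (l - 1)) = 64 * k * (p * 2 ^ (l - 1)) := by ring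
      rw [h6, h4] at h5
      nlinarith
  -- Markov's inequality for both conditions at once, with the indicator bounded below by an affine
  -- function. Each of the two expected losses is at most `1 / 4`, from `64 / 256` and `4 / 16`.
  have hlow : sampleAvg p T (fun H => 1 + ((-1 / (256 * k)) * (#H : ℝ) +
      (-4 / #T) * (#{i ∈ G \ H | Bad (H ∩ G) i} : ℝ))) ≤ sampleAvg p T fun H =>
      if #H ≤ 256 * k ∧ 4 * #{i ∈ G \ H | Bad (H ∩ G) i} ≤ #T then (1 : ℝ) else 0 := by
    refine sampleAvg_mono hp0.le hp1 fun H _ => ?_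
    have e1 : -1 / (256 * k) * (#H : ℝ) = -(#H / (256 * k)) := by ring
    have e2 : -4 / (#T : ℝ) * (#{i ∈ G \ H | Bad (H ∩ G) i} : ℝ) =
        -(4 * #{i ∈ G \ H | Bad (H ∩ G) i} / #T) := by ring
    rw [e1, e2]
    have p1 : 0 ≤ (#H : ℝ) / (256 * k) := by positivity
    have p2 : 0 ≤ 4 * (#{i ∈ G \ H | Bad (H ∩ G) i} : ℝ) / #T := by positivity
    split_ifs with h
    · linarith
    · rw [not_and_or, not_le, not_le] at h
      rcases h with h | h
      · have : (1 : ℝ) ≤ #H / (256 * k) := by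
          rw [le_div_iff₀ (by positivity), one_mul]
          exact_mod_cast h.le
        linarith
      · have : (1 : ℝ) ≤ 4 * (#{i ∈ G \ H | Bad (H ∩ G) i} : ℝ) / #T := by
          rw [le_div_iff₀ hT0, one_mul]
          exact_mod_cast h.le
        linarith
  refine le_trans ?_ hlow
  rw [sampleAvg_add, sampleAvg_add, sampleAvg_mul, sampleAvg_mul, sampleAvg_const, hcard]
  have f1 : -1 / (256 * k) * (p * #T) ≥ -(1 / 4) := by
    rw [ge_iff_le, neg_div, neg_mul, neg_le_neg_iff, div_mul_eq_mul_div, one_mul,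
      div_le_iff₀ (by positivity)]
    linarith
  have f2 : -4 / #T * sampleAvg p T (fun H => (#{i ∈ G \ H | Bad (H ∩ G) i} : ℝ)) ≥ -(1 / 4) := by
    rw [ge_iff_le, neg_div, neg_mul, neg_le_neg_iff, div_mul_eq_mul_div, div_le_iff₀ hT0]
    linarith
  linarith

end HuberCSS

/-! ### Analysis of a round -/

namespace HuberCSS

open Finset RealRAM

theorem nextCount_lt {N : ℕ} (h : N ≠ 0) : nextCount N < N := by
  unfold nextCount; lia

theorem four_mul_nextCount_le (N : ℕ) : 4 * nextCount N ≤ 3 * N := by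
  unfold nextCount; lia

/-- The number of rounds needed for `N` columns. -/
def roundCount (N : ℕ) : ℕ := if h : N = 0 then 0 else roundCount (nextCount N) + 1
termination_by N
decreasing_by exact nextCount_lt h

/-- The number of coins tossed in the treatment of `N` of `d` columns. -/
noncomputable def coinCount (d k N : ℕ) : ℕ :=
  if h : N = 0 then 0 else d * level k N + coinCount d k (nextCount N)
termination_by N
decreasing_by exact nextCount_lt h

theorem roundCount_zero : roundCount 0 = 0 := by rw [roundCount]; simp

theorem roundCount_of_ne {N : ℕ} (h : N ≠ 0) : roundCount N = roundCount (nextCount N) + 1 := by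
  rw [roundCount, dif_neg h]

theorem coinCount_zero (d k : ℕ) : coinCount d k 0 = 0 := by rw [coinCount]; simp

theorem coinCount_of_ne (d k : ℕ) {N : ℕ} (h : N ≠ 0) :
    coinCount d k N = d * level k N + coinCount d k (nextCount N) := by
  rw [coinCount, dif_neg h]

theorem roundCount_le (N : ℕ) : roundCount N ≤ N := by
  induction N using Nat.strong_induction_on with
  | _ N ih =>
    by_cases h : N = 0
    · rw [h, roundCount_zero]
    · rw [roundCount_of_ne h]
      have := ih _ (nextCount_lt h)
      have := nextCount_lt h
      lia

theorem coinCount_le {k : ℕ} (hk : 1 ≤ k) {d N : ℕ} (hN : N ≤ d) : coinCount d k N ≤ N * (d * d) := by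
  induction N using Nat.strong_induction_on with
  | _ N ih =>
    by_cases h : N = 0
    · rw [h, coinCount_zero]; simp
    · rw [coinCount_of_ne d k h]
      have h1 := nextCount_lt h
      have h2 := ih _ h1 (h1.le.trans hN)
      have h3 : d * level k N ≤ d * d := by
        gcongr
        exact (level_le hk N).trans hN
      have h4 : (nextCount N + 1) * (d * d) ≤ N * (d * d) := by gcongr; exact h1
      rw [add_mul, one_mul] at h4
      lia

/-- A round doubles the left side and multiplies `N` by at most `3 / 4`; since `2 * 27 ≤ 64`, the
cube compensates. The bound makes the success probability of a trial inverse polynomial. -/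
theorem two_pow_roundCount_le (N : ℕ) : 2 ^ roundCount N ≤ 2 * N ^ 3 + 1 := by
  have key : ∀ N, N ≠ 0 → 2 ^ roundCount N ≤ 2 * N ^ 3 := by
    intro N
    induction N using Nat.strong_induction_on with
    | _ N ih =>
      intro h
      rw [roundCount_of_ne h, pow_succ]
      by_cases h' : nextCount N = 0
      · rw [h', roundCount_zero]
        have : 1 ≤ N ^ 3 := Nat.one_le_pow _ _ (by lia)
        lia
      · have h1 := ih _ (nextCount_lt h) h'
        have h2 : (4 * nextCount N) ^ 3 ≤ (3 * N) ^ 3 :=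
          Nat.pow_le_pow_left (four_mul_nextCount_le N) 3
        rw [mul_pow, mul_pow] at h2
        lia
  by_cases h : N = 0
  · rw [h, roundCount_zero]; simp
  · exact (key N h).trans (by lia)

/-- Each round lowers `4 * log N` by at least `4 * log (4 / 3) ≥ 1`. The one additional round is
absorbed by `2 * log 2 ≥ 1`. -/
theorem roundCount_le_log (N : ℕ) : (roundCount N : ℝ) ≤ 6 * Real.log (max N 2) := by
  have hlog43 : (1 / 4 : ℝ) ≤ Real.log (4 / 3) := by
    have := Real.one_sub_inv_le_log_of_pos (by norm_num : (0 : ℝ) < 4 / 3)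
    norm_num at this ⊢
    linarith
  have key : ∀ N, N ≠ 0 → (roundCount N : ℝ) ≤ 1 + 4 * Real.log N := by
    intro N
    induction N using Nat.strong_induction_on with
    | _ N ih =>
      intro h
      have hN : (0 : ℝ) < N := by exact_mod_cast Nat.pos_of_ne_zero h
      have hN1 : (1 : ℝ) ≤ N := by exact_mod_cast Nat.pos_of_ne_zero h
      rw [roundCount_of_ne h]
      push_cast
      by_cases h' : nextCount N = 0
      · rw [h', roundCount_zero]
        have := Real.log_nonneg hN1
        push_cast
        linarith
      · have h1 := ih _ (nextCount_lt h) h'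
        have h2 : (4 / 3 : ℝ) * nextCount N ≤ N := by
          have : (4 * nextCount N : ℝ) ≤ 3 * N := by exact_mod_cast four_mul_nextCount_le N
          linarith
        have h3 : (0 : ℝ) < nextCount N := by exact_mod_cast Nat.pos_of_ne_zero h'
        have h4 := Real.log_le_log (by positivity) h2
        rw [Real.log_mul (by norm_num) h3.ne'] at h4
        linarith
  have hl2 : (1 / 2 : ℝ) ≤ Real.log 2 := by linarith [Real.log_two_gt_d9]
  have hle : Real.log 2 ≤ Real.log (max (N : ℝ) 2) :=
    Real.log_le_log (by norm_num) (le_max_right _ _)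
  by_cases h : N = 0
  · have h1 : roundCount N = 0 := by rw [h, roundCount_zero]
    rw [h1, Nat.cast_zero]
    linarith
  · have h1 := key N h
    have hN : (0 : ℝ) < N := by exact_mod_cast Nat.pos_of_ne_zero h
    have h2 : Real.log N ≤ Real.log (max (N : ℝ) 2) := Real.log_le_log hN (le_max_left _ _)
    linarith

/-- Both halves are needed: the lower one supplies the cheap columns `G`, the upper one pays for the
round in `potential_step`. -/
theorem exists_median {T : Finset ℕ} (hT : T.Nonempty) (h : ℕ → ℝ) :
    ∃ j ∈ T, #T ≤ 2 * #{l ∈ T | h l ≤ h j} ∧ #T ≤ 2 * #{l ∈ T | h j ≤ h l} := by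
  set T' := {j ∈ T | #T ≤ 2 * #{l ∈ T | h l ≤ h j}} with hT'
  have hne : T'.Nonempty := by
    obtain ⟨j, hj, hmax⟩ := T.exists_max_image h hT
    refine ⟨j, mem_filter.2 ⟨hj, ?_⟩⟩
    rw [filter_true_of_mem hmax]
    lia
  obtain ⟨j, hj, hmin⟩ := T'.exists_min_image h hne
  refine ⟨j, (mem_filter.1 hj).1, (mem_filter.1 hj).2, ?_⟩
  by_contra! hlt
  have hsplit := card_filter_add_card_filter_not (s := T) (p := fun l => h j ≤ h l)
  set L := {l ∈ T | ¬ h j ≤ h l} with hL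
  have hLne : L.Nonempty := card_pos.1 (by lia)
  obtain ⟨i, hi, himax⟩ := L.exists_max_image h hLne
  have hi' := mem_filter.1 hi
  have : i ∈ T' := by
    refine mem_filter.2 ⟨hi'.1, ?_⟩
    have : #L ≤ #{l ∈ T | h l ≤ h i} := card_le_card fun l hl =>
      mem_filter.2 ⟨(mem_filter.1 hl).1, himax l hl⟩
    lia
  exact hi'.2 (hmin i this)

/-- The potential that bounds the loss caused by the remaining rounds. -/
noncomputable def potential (d : ℕ) (h : ℕ → ℝ) (θ : ℝ) (N : ℕ) : ℝ :=
  8 * ∑ j ∈ range d, max (h j - θ) 0 + 4 * N * θ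

theorem potential_nonneg (d : ℕ) (h : ℕ → ℝ) {θ : ℝ} (hθ : 0 ≤ θ) (N : ℕ) :
    0 ≤ potential d h θ N := by
  have : 0 ≤ ∑ j ∈ range d, max (h j - θ) 0 := sum_nonneg fun _ _ => le_max_right _ _
  unfold potential
  positivity

/-- Take `θ'' = max θ θ'`. If `θ` does not change, the loss of a quarter of the `N` columns releases
`N * θ`. If it rises, at least `N / 2` summands drop by `θ' - θ`, which pays, with the factor `8`,
for the increase of `4 * N * θ`. -/
theorem potential_step {d : ℕ} {h : ℕ → ℝ} {θ θ' : ℝ} (hθ : 0 ≤ θ) (hθ' : 0 ≤ θ') {N N' : ℕ}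
    (hN : 4 * N' ≤ 3 * N) (hcount : N ≤ 2 * #{j ∈ range d | θ' ≤ h j}) :
    ∃ θ'', 0 ≤ θ'' ∧ N * θ' + potential d h θ'' N' ≤ potential d h θ N := by
  have hN' : (4 * N' : ℝ) ≤ 3 * N := by exact_mod_cast hN
  rcases le_total θ' θ with hle | hle
  · refine ⟨θ, hθ, ?_⟩
    have h1 : (N : ℝ) * θ' ≤ N * θ := by gcongr
    have h2 : (4 * N' : ℝ) * θ ≤ 3 * N * θ := by gcongr
    unfold potential
    linarith
  · refine ⟨θ', hθ', ?_⟩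
    have h1 : ∑ j ∈ range d, (max (h j - θ') 0 + if θ' ≤ h j then θ' - θ else 0) ≤
        ∑ j ∈ range d, max (h j - θ) 0 := by
      refine sum_le_sum fun j _ => ?_
      split_ifs with hj
      · rw [max_eq_left (by linarith), max_eq_left (by linarith)]
        linarith
      · rw [max_eq_right (by linarith), add_zero]
        exact le_max_right _ _
    rw [sum_add_distrib, ← sum_filter, sum_const, nsmul_eq_mul] at h1
    have h2 : (N : ℝ) ≤ 2 * #{j ∈ range d | θ' ≤ h j} := by exact_mod_cast hcount
    have h3 := mul_le_mul_of_nonneg_right h2 (by linarith : 0 ≤ θ' - θ)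
    have h4 : (4 * N' : ℝ) * θ' ≤ 3 * N * θ' := by gcongr
    unfold potential
    linarith

/-- The loss of column `j` of `A - M`. -/
noncomputable def colLoss (n : ℕ) (A M : ℕ → ℕ → ℝ) (j : ℕ) : ℝ := vecLoss n fun i => A i j - M i j

/-- As `M` satisfies the relation exactly, the residual of `A` is the same combination of the
columns of `A - M`. Its coefficients are `1` and `-x j`, with square sum at most `2`. -/
theorem vecLoss_combination_le {n d : ℕ} {A M : ℕ → ℕ → ℝ} {V : Finset ℕ} {l : ℕ} {x : ℕ → ℝ}
    (hV : V ⊆ range d) (hl : l ∉ V) (hx : ∀ j ∉ V, x j = 0)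
    (hx1 : ∑ j ∈ range d, x j ^ 2 ≤ 1)
    (hM : ∀ r < n, M r l = ∑ j ∈ range d, M r j * x j) :
    vecLoss n (colResidual d A l x) ≤ 2 * ∑ j ∈ insert l V, colLoss n A M j := by
  have hsub : ∀ f : ℕ → ℝ, ∑ j ∈ range d, f j * x j = ∑ j ∈ V, f j * x j := fun f =>
    (sum_subset hV fun j _ hj => by rw [hx j hj, mul_zero]).symm
  set c : ℕ → ℝ := fun j => if j = l then 1 else -x j with hc
  have hc2 : ∑ j ∈ insert l V, c j ^ 2 ≤ 2 := by
    rw [sum_insert hl]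
    have h1 : ∑ j ∈ V, c j ^ 2 = ∑ j ∈ V, x j ^ 2 := sum_congr rfl fun j hj => by
      have : j ≠ l := fun h => hl (h ▸ hj)
      simp [hc, this]
    have h2 : ∑ j ∈ V, x j ^ 2 ≤ ∑ j ∈ range d, x j ^ 2 :=
      sum_le_sum_of_subset_of_nonneg hV fun _ _ _ => sq_nonneg _
    have h3 : c l = 1 := by simp [hc]
    rw [h1, h3]
    linarith
  simp only [colLoss, vecLoss]
  rw [sum_comm, mul_sum]
  refine sum_le_sum fun i hi => ?_
  have e : colResidual d A l x i = ∑ j ∈ insert l V, c j * (A i j - M i j) := by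
    rw [sum_insert hl]
    have h1 : ∑ j ∈ V, c j * (A i j - M i j) =
        ∑ j ∈ V, M i j * x j - ∑ j ∈ V, A i j * x j := by
      rw [← sum_sub_distrib]
      refine sum_congr rfl fun j hj => ?_
      have : j ≠ l := fun h => hl (h ▸ hj)
      simp only [hc, this, if_false]
      ring
    have h3 : c l = 1 := by simp [hc]
    rw [h1, h3, ← hsub, ← hsub, ← hM i (mem_range.1 hi), colResidual]
    ring
  rw [e]
  exact huber_sum_le _ _ _ hc2

open Classical in
/-- After a good sample, a quarter of the columns have a small loss. -/
theorem card_le_good {n d k : ℕ} (hk : 1 ≤ k) {A M : ℕ → ℕ → ℝ} {T H : Finset ℕ} {θ : ℝ} (hθ : 0 ≤ θ)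
    (hT : T ⊆ range d) (hH : H ⊆ T)
    (hmed : #T ≤ 2 * #{l ∈ T | colLoss n A M l ≤ θ}) (hcard : #H ≤ 256 * k)
    (hgood : 4 * #{i ∈ {l ∈ T | colLoss n A M l ≤ θ} \ H |
      IsLong n d M (H ∩ {l ∈ T | colLoss n A M l ≤ θ}) i} ≤ #T) :
    #T ≤ 4 * #{l ∈ T | ∃ z : ℕ → ℝ, (∀ m < d, m ∉ H → z m = 0) ∧
      3 * vecLoss n (colResidual d A l z) ≤ 1542 * k * θ} := by
  set G := {l ∈ T | colLoss n A M l ≤ θ} with hG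
  set X := {i ∈ G \ H | IsLong n d M (H ∩ G) i} with hX
  have hsub : G \ X ⊆ {l ∈ T | ∃ z : ℕ → ℝ, (∀ m < d, m ∉ H → z m = 0) ∧
      3 * vecLoss n (colResidual d A l z) ≤ 1542 * k * θ} := by
    intro l hl
    rw [mem_sdiff] at hl
    have hlG := mem_filter.1 hl.1
    have hld := mem_range.1 (hT hlG.1)
    refine mem_filter.2 ⟨hlG.1, ?_⟩
    have hk1 : (1 : ℝ) ≤ k := by exact_mod_cast hk
    -- A sampled column reproduces itself at no loss, so only the unsampled ones need a short
    -- combination.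
    by_cases hlH : l ∈ H
    · refine ⟨fun m => if m = l then 1 else 0, fun m _ hm => if_neg ?_, ?_⟩
      · rintro rfl
        exact hm hlH
      have : vecLoss n (colResidual d A l fun m => if m = l then 1 else 0) = 0 := by
        refine sum_eq_zero fun i _ => ?_
        simp [colResidual, hld, huber_zero]
      rw [this, mul_zero]
      positivity
    · have hnl : ¬ IsLong n d M (H ∩ G) l := fun h =>
        hl.2 (mem_filter.2 ⟨mem_sdiff.2 ⟨hl.1, hlH⟩, h⟩)
      rw [IsLong, not_not] at hnl
      obtain ⟨x, hx, hx1, hxM⟩ := hnl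
      refine ⟨x, fun m _ hm => hx m fun h => hm (mem_inter.1 h).1, ?_⟩
      have hlV : l ∉ H ∩ G := fun h => hlH (mem_inter.1 h).1
      have h1 := vecLoss_combination_le (A := A) ((inter_subset_left.trans hH).trans hT) hlV
        hx hx1 hxM
      have h2 : ∑ j ∈ insert l (H ∩ G), colLoss n A M j ≤ #(insert l (H ∩ G)) • θ := by
        refine sum_le_card_nsmul _ _ _ fun j hj => ?_
        rcases mem_insert.1 hj with rfl | hj
        · exact hlG.2
        · exact (mem_filter.1 (mem_inter.1 hj).2).2
      rw [nsmul_eq_mul, card_insert_of_notMem hlV] at h2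
      -- The combination involves the column itself and at most `256 k` sampled ones, each of loss
      -- at most `θ`. The factors `3` from regression and `2` from the Huber bound give `1542 = 3 *
      -- 2 * 257`.
      have h3 : ((#(H ∩ G) + 1 : ℕ) : ℝ) ≤ 257 * k := by
        have : #(H ∩ G) ≤ 256 * k := (card_le_card inter_subset_left).trans hcard
        have : #(H ∩ G) + 1 ≤ 257 * k := by lia
        exact_mod_cast this
      have h4 := mul_le_mul_of_nonneg_right h3 hθ
      linarith
  have h1 := card_le_card hsub
  have h2 : #G ≤ #(G \ X) + #X := by
    have := card_le_card (show G ⊆ (G \ X) ∪ X by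
      intro a ha; rw [mem_union, mem_sdiff]; tauto)
    exact this.trans (card_union_le _ _)
  lia

end HuberCSS

/-! ### One trial -/

namespace RealRAM

/-- The average does not depend on the continuation if `f` looks only at the first `m` coins. -/
theorem coinAvg_append_const (m : ℕ) (f : (ℕ → Bool) → ℝ) (ρ ρ' : ℕ → Bool) :
    coinAvg m (fun ω => f (appendCoins m ω ρ)) ρ' = coinAvg m f ρ :=
  (coinAvg_append m 0 f ρ ρ').symm

end RealRAM

namespace HuberCSS

open Finset RealRAM

/-- The loss of the columns in `S` if they are approximated with the coefficients `X`. -/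
noncomputable def lossOn (n d : ℕ) (A X : ℕ → ℕ → ℝ) (S : Finset ℕ) : ℝ :=
  ∑ j ∈ S, vecLoss n (colResidual d A j fun m => X m j)

theorem lossOn_congr {n d : ℕ} {A X Y : ℕ → ℕ → ℝ} {S : Finset ℕ}
    (h : ∀ j ∈ S, ∀ m < d, X m j = Y m j) : lossOn n d A X S = lossOn n d A Y S :=
  sum_congr rfl fun j hj => vecLoss_congr fun i _ => colResidual_congr (h j hj) i

/-- What holds between two rounds. -/
structure TrialInv (n d k : ℕ) (A : ℕ → ℕ → ℝ) (s : State) : Prop where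
  rows : s.nats 0 0 = n
  cols : s.nats 0 1 = d
  rank : s.nats 0 2 = k
  matrix : s.reals 0 = A
  count : s.nats 32 0 = #(memSet d (s.nats 2))
  supp : ∀ j < d, j ∉ memSet d (s.nats 2) → ∀ m < d, m ∉ memSet d (s.nats 3) → s.reals 2 m j = 0
  size : #(memSet d (s.nats 3)) + 256 * k * roundCount #(memSet d (s.nats 2)) ≤
    256 * k * roundCount d

theorem TrialInv.withCoins {n d k : ℕ} {A : ℕ → ℕ → ℝ} {s : State} (h : TrialInv n d k A s)
    (ω : ℕ → Bool) : TrialInv n d k A (s.withCoins ω) :=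
  ⟨h.rows, h.cols, h.rank, h.matrix, h.count, h.supp, h.size⟩

theorem card_cappedSample_le (k : ℕ) (T : Finset ℕ) (l : ℕ) (ω : ℕ → Bool) :
    #(cappedSample k T l ω) ≤ 256 * k := by
  unfold cappedSample
  split_ifs with h
  · exact h
  · simp

theorem sampleSet_appendCoins {d : ℕ} {T : Finset ℕ} (hT : T ⊆ range d) (l : ℕ) (ω ρ : ℕ → Bool) :
    sampleSet T l (appendCoins (d * l) ω ρ) = sampleSet T l ω := by
  refine filter_congr fun j hj => forall₂_congr fun i hi => ?_
  have h1 := mem_range.1 (hT hj)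
  have h2 : j * l + i < d * l := by
    have : (j + 1) * l ≤ d * l := by gcongr; exact h1
    rw [add_mul, one_mul] at this
    lia
  rw [appendCoins, if_pos h2]

variable {B n d k : ℕ} {A : ℕ → ℕ → ℝ} {s s' : State}

theorem TrialInv.round (h : TrialInv n d k A s) (hne : #(memSet d (s.nats 2)) ≠ 0) {H : Finset ℕ}
    (hH : #H ≤ 256 * k) (hA : Agree roundProg s s') (hp : RoundPost n d H s s') :
    TrialInv n d k A s' := by
  have e0 := hA.nats 0 (by decide)
  refine ⟨by rw [e0, h.rows], by rw [e0, h.cols], by rw [e0, h.rank],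
    by rw [hA.reals 0 (by decide), h.matrix], hp.count, fun j hj hj' m hm hm' => ?_, ?_⟩
  · rw [hp.chosen, mem_union, not_or] at hm'
    by_cases hjT : j ∈ memSet d (s.nats 2)
    · exact hp.supp j (mem_sdiff.2 ⟨hjT, hj'⟩) m hm hm'.2
    · rw [hp.old j hj hjT m hm]
      exact h.supp j hj hjT m hm hm'.1
  · have h1 := h.size
    rw [roundCount_of_ne hne, ← hp.card, mul_add, mul_one] at h1
    have h2 := card_union_le (memSet d (s.nats 3)) H
    rw [← hp.chosen] at h2
    lia

/-- For every tape the numbers of columns follow the recursion `nextCount`, hence fixed counts of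
rounds and coins. The quality of the samples plays no role here. -/
theorem loopRun_roundProg (hk1 : 1 ≤ k) (hnB : n ≤ B) (hdB : d ≤ B) (hTB : 2 * n * n + 1 ≤ B)
    {N : ℕ} (h : TrialInv n d k A s) (hN : #(memSet d (s.nats 2)) = N) :
    LoopRun B (roundCount N) (natLt (.const 0) (nvar 32)) roundProg s fun s' =>
      (s'.coins = fun i => s.coins (i + coinCount d k N)) ∧ TrialInv n d k A s' ∧
      memSet d (s'.nats 2) = ∅ := by
  induction N using Nat.strong_induction_on generalizing s with
  | _ N ih =>
    by_cases h0 : N = 0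
    · refine .done (by simp [BExpr.Holds, NExpr.eval, h.count, hN, h0]) ⟨?_, h, ?_⟩
      · rw [h0, coinCount_zero]; rfl
      · rwa [h0, card_eq_zero] at hN
    · rw [roundCount_of_ne h0, coinCount_of_ne d k h0]
      refine .step (by simp [BExpr.Holds, NExpr.eval, h.count, hN]; lia)
        ((run_roundProg h.rows h.cols h.rank hk1 h.count hnB hdB hTB).mono
          fun s₁ hA₁ ⟨hc, hp⟩ => ?_)
      have h₁ := h.round (by rwa [hN]) (card_cappedSample_le _ _ _ _) hA₁ hp
      have hN₁ : #(memSet d (s₁.nats 2)) = nextCount N := by rw [hp.card, hN]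
      have := ih _ (nextCount_lt h0) h₁ hN₁
      rw [hc, hN] at this
      convert this using 6 with s'
      ring_nf

-- The target `b` stays fixed while `θ` varies: accumulated loss plus scaled potential remains at
-- most `b` after a good round. Each round is good with probability at least `1 / 2` whatever
-- happened before, so the probabilities multiply; after a bad round nothing is claimed.
open Classical in
theorem le_coinAvg_roundProg (hk1 : 1 ≤ k) (hnB : n ≤ B) (hdB : d ≤ B) (hTB : 2 * n * n + 1 ≤ B)
    {M : Matrix (Fin n) (Fin d) ℝ} (hM : M.rank ≤ k) {N : ℕ} (h : TrialInv n d k A s)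
    (hN : #(memSet d (s.nats 2)) = N) {θ b : ℝ} (hθ : 0 ≤ θ)
    (hb : lossOn n d A (s.reals 2) (range d \ memSet d (s.nats 2)) +
      1542 * k * potential d (colLoss n A (entries M)) θ N ≤ b) (ρ : ℕ → Bool) :
    (1 / 2) ^ roundCount N ≤ coinAvg (coinCount d k N) (fun ω =>
      if LoopRun B (roundCount N) (natLt (.const 0) (nvar 32)) roundProg (s.withCoins ω)
        (fun s' => lossOn n d A (s'.reals 2) (range d) ≤ b) then 1 else 0) ρ := by
  induction N using Nat.strong_induction_on generalizing s θ with
  | _ N ih =>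
    set g := colLoss n A (entries M) with hg
    by_cases h0 : N = 0
    · subst h0
      rw [roundCount_zero, coinCount_zero, coinAvg, if_pos, pow_zero]
      refine .done (by simp [State.withCoins, BExpr.Holds, NExpr.eval, h.count, hN]) ?_
      rw [card_eq_zero] at hN
      rw [hN, sdiff_empty] at hb
      have : 0 ≤ 1542 * k * potential d g θ 0 :=
        mul_nonneg (by positivity) (potential_nonneg d g hθ 0)
      change lossOn n d A (s.reals 2) (range d) ≤ b
      linarith
    · set T := memSet d (s.nats 2) with hT
      set l := level k N with hl
      have hTd : T ⊆ range d := filter_subset _ _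
      have hTne : T.Nonempty := card_pos.1 (by lia)
      obtain ⟨a, haT, ha1, ha2⟩ := exists_median hTne g
      set θ' := g a with hθ'
      have hθ'0 : 0 ≤ θ' := vecLoss_nonneg _ _
      obtain ⟨θ'', hθ''0, hpot⟩ := potential_step (d := d) (h := g) hθ hθ'0
        (four_mul_nextCount_le N) (hN ▸ ha2.trans (by gcongr))
      set G := {i ∈ T | g i ≤ θ'} with hG
      set Good : Finset ℕ → Prop := fun H => #H ≤ 256 * k ∧
        4 * #{i ∈ G \ H | IsLong n d (entries M) (H ∩ G) i} ≤ N with hGood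
      have hhalf : 1 / 2 ≤ coinAvg (d * l) (fun ω => if Good (sampleSet T l ω) then 1 else 0) ρ := by
        have := half_le_sampleAvg hk1 (filter_subset _ T : G ⊆ T) hTne (IsLong n d (entries M))
          fun U hU => card_isLong_le M hM ((hU.trans (filter_subset _ _)).trans hTd)
        rw [← coinAvg_sampleSet hTd _ _ ρ, hN, ← hl] at this
        convert this
      rw [roundCount_of_ne h0, coinCount_of_ne d k h0, coinAvg_append _ _ _ _ ρ, pow_succ]
      refine le_trans (mul_le_mul_of_nonneg_left hhalf (by positivity)) ?_
      rw [← coinAvg_mul]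
      refine coinAvg_mono (fun ω => ?_) ρ
      -- Once the coins of this round are fixed, so is the memory after it, and the induction
      -- hypothesis applies to that memory and the remaining coins.
      obtain ⟨s₁, ⟨hA₁, hp⟩, hrun⟩ := Run.exists_split (B := B) (p := roundProg) (s := s)
        (K := d * l) (Q := fun ω s' => Agree roundProg (s.withCoins ω) s' ∧
          RoundPost n d (cappedSample k T l ω) (s.withCoins ω) s') (fun ω => by
        have hω := h.withCoins ω
        have := run_roundProg hω.rows hω.cols hω.rank hk1 hω.count hnB hdB hTB
        refine this.mono fun s' hA' h' => ?_
        change _ ∧ RoundPost n d (cappedSample k T (level k #T) ω) _ _ at h'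
        rw [hN] at h'
        refine ⟨?_, hA', h'.2⟩
        rw [h'.1, hl, ← hN]
        rfl) ω
      have hstep : ∀ ω' (Q : State → Prop),
          LoopRun B (roundCount (nextCount N)) (natLt (.const 0) (nvar 32)) roundProg
            (s₁.withCoins ω') Q →
          LoopRun B (roundCount (nextCount N) + 1) (natLt (.const 0) (nvar 32)) roundProg
            (s.withCoins (appendCoins (d * l) ω ω')) Q := by
        intro ω' Q hQ
        refine .step (by simp [State.withCoins, BExpr.Holds, NExpr.eval, h.count, ← hT, hN]; lia)
          ((hrun ω').mono fun s' _ hs' => ?_)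
        rwa [hs']
      by_cases hgood : Good (sampleSet T l ω)
      · rw [if_pos hgood, mul_one]
        have hH : cappedSample k T l (appendCoins (d * l) ω markedTape) = sampleSet T l ω := by
          rw [cappedSample, sampleSet_appendCoins hTd, if_pos hgood.1]
        rw [hH] at hp
        have hi := h.withCoins (appendCoins (d * l) ω markedTape)
        have h₁ := hi.round (by change #T ≠ 0; rwa [hN]) hgood.1 hA₁ hp
        have hN₁ : #(memSet d (s₁.nats 2)) = nextCount N := hp.card.trans (congrArg nextCount hN)
        set T₁ := memSet d (s₁.nats 2) with hT₁
        have hT₁T : T₁ ⊆ T := hp.subset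
        have hloss : ∀ j ∈ T \ T₁,
            vecLoss n (colResidual d A j fun m => s₁.reals 2 m j) ≤ 1542 * k * θ' := by
          rw [← h.matrix]
          refine hp.loss (1542 * k * θ') ?_
          have := card_le_good hk1 (n := n) (d := d) (A := A) (M := entries M) hθ'0 hTd
            (filter_subset _ T : sampleSet T l ω ⊆ T) ha1 hgood.1 (hN ▸ hgood.2)
          rw [← h.matrix] at this
          exact this
        have hsum : lossOn n d A (s₁.reals 2) (range d \ T₁) ≤
            lossOn n d A (s.reals 2) (range d \ T) + N * (1542 * k * θ') := by
          have e1 : range d \ T₁ = (range d \ T) ∪ (T \ T₁) := by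
            ext j
            have := @hTd j
            have := @hT₁T j
            simp only [mem_sdiff, mem_union]
            tauto
          have hdis : Disjoint (range d \ T) (T \ T₁) := by
            rw [disjoint_left]
            intro j hj hj'
            exact (mem_sdiff.1 hj).2 (mem_sdiff.1 hj').1
          rw [e1, lossOn, sum_union hdis]
          refine add_le_add (le_of_eq ?_) ?_
          · exact lossOn_congr fun j hj m hm =>
              hp.old j (mem_range.1 (mem_sdiff.1 hj).1) (mem_sdiff.1 hj).2 m hm
          · refine (sum_le_card_nsmul _ _ _ hloss).trans ?_
            rw [nsmul_eq_mul, ← hN]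
            gcongr
            exact sdiff_subset
        refine (ih _ (nextCount_lt h0) h₁ hN₁ hθ''0 ?_).trans (coinAvg_mono (fun ω' => ?_) _)
        · have := mul_le_mul_of_nonneg_left hpot (by positivity : (0 : ℝ) ≤ 1542 * k)
          linarith
        · split_ifs with h1 h2 h2
          · exact le_rfl
          · exact absurd (hstep ω' _ h1) h2
          · norm_num
          · exact le_rfl
      · rw [if_neg hgood, mul_zero]
        refine (coinAvg_const (coinCount d k (nextCount N)) 0 ρ).ge.trans (coinAvg_mono (fun ω' => ?_) _)
        split_ifs <;> norm_num

end HuberCSS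

/-! ### Complete trials and their success probability -/

namespace HuberCSS

open Finset RealRAM

variable {B n d k t : ℕ} {A : ℕ → ℕ → ℝ} {s : State}

/-- Mark all columns as untreated. -/
def resetColumns : Prog :=
  .seq (.forLt 13 colCount (.seq (.setNat 2 (nvar 13) (.const 1)) (.setNat 3 (nvar 13) (.const 0))))
  (.setNat 32 (.const 0) colCount)

theorem appendCoins_zero (ω ρ : ℕ → Bool) : appendCoins 0 ω ρ = ρ := by
  funext i; simp [appendCoins]

/-- The input as it stands in memory. -/
structure HasInput (n d k t : ℕ) (A : ℕ → ℕ → ℝ) (s : State) : Prop where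
  rows : s.nats 0 0 = n
  cols : s.nats 0 1 = d
  rank : s.nats 0 2 = k
  trials : s.nats 0 3 = t
  matrix : s.reals 0 = A

theorem HasInput.congr {s' : State} (h : HasInput n d k t A s) (h0 : s'.nats 0 = s.nats 0)
    (hA : s'.reals 0 = s.reals 0) : HasInput n d k t A s' :=
  ⟨by rw [h0, h.rows], by rw [h0, h.cols], by rw [h0, h.rank], by rw [h0, h.trials],
    by rw [hA, h.matrix]⟩

theorem run_resetColumns (h : HasInput n d k t A s) (hdB : d ≤ B) :
    Run B resetColumns s fun s' => TrialInv n d k A s' ∧ memSet d (s'.nats 2) = range d := by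
  refine .seq (Run.mono (.forLt (fun j s' => ∀ i < j, s'.nats 2 i = 1 ∧ s'.nats 3 i = 0) hdB
    (by decide) (fun s' hA => by simp [NExpr.eval, hA.nats 0 (by decide), h.cols]) (by simp) ?_)
    fun s₁ hA₁ h₁ => .setNat ?_)
  · intro j s₁ _ hI hv _
    refine .seq (.setNat (.setNat ?_))
    intro i hi
    have := hI i
    simp only [State.setNat_nats, NExpr.eval, hv]
    simp
    grind
  · have e0 : s₁.nats 0 = s.nats 0 := hA₁.nats 0 (by decide)
    have hcols : s₁.nats 0 1 = d := by rw [e0, h.cols]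
    simp only [NExpr.eval, hcols]
    have o : ∀ a, a ≠ 32 → (s₁.setNat 32 0 d).nats a = s₁.nats a := fun a ha =>
      State.setNat_nats_of_ne _ _ _ ha
    have e2 : memSet d ((s₁.setNat 32 0 d).nats 2) = range d := by
      rw [o 2 (by decide)]
      ext j
      rw [mem_memSet, mem_range]
      exact ⟨fun h => h.1, fun hj => ⟨hj, by rw [(h₁ j hj).1]; exact one_ne_zero⟩⟩
    have e3 : memSet d ((s₁.setNat 32 0 d).nats 3) = ∅ := by
      rw [o 3 (by decide), eq_empty_iff_forall_notMem]
      intro j hj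
      rw [mem_memSet] at hj
      exact hj.2 (h₁ j hj.1).2
    refine ⟨⟨?_, ?_, ?_, ?_, ?_, ?_, ?_⟩, e2⟩
    · rw [o 0 (by decide), e0, h.rows]
    · rw [o 0 (by decide), e0, h.cols]
    · rw [o 0 (by decide), e0, h.rank]
    · rw [State.setNat_reals, hA₁.reals 0 (by decide), h.matrix]
    · rw [e2, card_range]; simp [State.setNat_nats]
    · intro j hj hj'
      rw [e2, mem_range] at hj'
      exact absurd hj hj'
    · rw [e2, e3, card_range]; simp

/-- Choose columns and coefficients for all columns. -/
def trialProg : Prog := .seq resetColumns (.loop (natLt (.const 0) (nvar 32)) roundProg)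

theorem run_trialProg (h : HasInput n d k t A s) (hk1 : 1 ≤ k) (hnB : n ≤ B) (hdB : d ≤ B)
    (hTB : 2 * n * n + 1 ≤ B) :
    Run B trialProg s fun s' => (s'.coins = fun i => s.coins (i + coinCount d k d)) ∧
      TrialInv n d k A s' ∧ memSet d (s'.nats 2) = ∅ := by
  refine .seq ((run_resetColumns h hdB).mono fun s₁ hA₁ ⟨h₁, h₂⟩ =>
    (LoopRun.run ?_ ((roundCount_le d).trans hdB)))
  have := loopRun_roundProg hk1 hnB hdB hTB h₁ (by rw [h₂, card_range])
  rwa [hA₁.coins (by decide)] at this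

-- The analysis starts with `θ = 0`, where the potential is `8` times the loss of `A - M`; hence the
-- constant `12336 = 8 * 1542`.
open Classical in
theorem le_coinAvg_trialProg (h : HasInput n d k t A s) (hk1 : 1 ≤ k) (hnB : n ≤ B) (hdB : d ≤ B)
    (hTB : 2 * n * n + 1 ≤ B) {M : Matrix (Fin n) (Fin d) ℝ} (hM : M.rank ≤ k) {b : ℝ}
    (hb : 12336 * k * ∑ j ∈ range d, colLoss n A (entries M) j ≤ b) (ρ : ℕ → Bool) :
    (1 / 2) ^ roundCount d ≤ coinAvg (coinCount d k d) (fun ω =>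
      if Run B trialProg (s.withCoins ω) (fun s' => lossOn n d A (s'.reals 2) (range d) ≤ b)
        then 1 else 0) ρ := by
  obtain ⟨s₁, ⟨h₁, h₂⟩, hrun⟩ := Run.exists_split (B := B) (p := resetColumns) (s := s) (K := 0)
    (Q := fun _ s' => TrialInv n d k A s' ∧ memSet d (s'.nats 2) = range d) (fun ω =>
      (run_resetColumns (h.congr rfl rfl : HasInput n d k t A (s.withCoins ω)) hdB).mono
        fun s' hA' h' => ⟨hA'.coins (by decide), h'⟩) ρ
  have hpot : potential d (colLoss n A (entries M)) 0 d =
      8 * ∑ j ∈ range d, colLoss n A (entries M) j := by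
    rw [potential, mul_zero, add_zero]
    refine congrArg _ (sum_congr rfl fun j _ => ?_)
    rw [sub_zero]
    exact max_eq_left (vecLoss_nonneg _ _)
  refine (le_coinAvg_roundProg hk1 hnB hdB hTB hM h₁ (by rw [h₂, card_range]) le_rfl (b := b) ?_
    ρ).trans (coinAvg_mono (fun ω => ?_) _)
  · rw [h₂, sdiff_self, hpot, lossOn]
    simp only [bot_eq_empty, sum_empty]
    linarith
  · split_ifs with h3 h4 h4
    · exact le_rfl
    · refine absurd (.seq ?_) h4
      have := hrun ω
      rw [appendCoins_zero] at this
      refine this.mono fun s' _ hs' => ?_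
      rw [hs']
      exact h3.run ((roundCount_le d).trans hdB)
    · norm_num
    · exact le_rfl

/-! ### Keeping the best trial -/

/-- Compute the loss of the coefficients found in the current trial. -/
def lossProg : Prog :=
  .seq (.setReal 26 (.const 0) (.const 0) (.cast (.const 0)))
  (.forLt 13 colCount (.seq
    (.forLt 10 rowCount (.seq
      (sumProg 20 12 colCount (.mul (.get 0 (nvar 10) (nvar 12)) (.get 2 (nvar 12) (nvar 13))))
      (.setReal 5 (nvar 10) (.const 0) (.sub (.get 0 (nvar 10) (nvar 13)) (rvar 20)))))
    (.seq residualLoss (.setReal 26 (.const 0) (.const 0) (.add (rvar 26) (rvar 23))))))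

theorem run_lossProg (h : HasInput n d k t A s) (hnB : n ≤ B) (hdB : d ≤ B) :
    Run B lossProg s fun s' => s'.reals 26 0 0 = lossOn n d A (s.reals 2) (range d) := by
  refine .sum (fun j => vecLoss n (colResidual d A j fun m => s.reals 2 m j)) hdB (by decide)
    (fun s' hA => by simp [NExpr.eval, hA.nats 0 (by decide), h.cols]) ?_
  intro j s₁ _ hj hA₁
  have h₁ : HasInput n d k t A s₁ := h.congr (hA₁.nats 0 (by decide)) (hA₁.reals 0 (by decide))
  have x₁ : s₁.reals 2 = s.reals 2 := hA₁.reals 2 (by decide)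
  refine .seq (Run.mono (.map (a := 5) (J := 0) (colResidual d A j fun m => s.reals 2 m j) hnB
    (by decide) (fun s' hA => by simp [NExpr.eval, hA.nats 0 (by decide), h₁.rows]) ?_)
    fun s₂ hA₂ h₂ => .seq ?_)
  · intro i s₂ _ hi _ hA₂
    have h₂ : HasInput n d k t A s₂ := h₁.congr (hA₂.nats 0 (by decide)) (hA₂.reals 0 (by decide))
    have j₂ : s₂.nats 13 0 = j := by rw [hA₂.nats 13 (by decide), hj]
    have x₂ : s₂.reals 2 = s.reals 2 := by rw [hA₂.reals 2 (by decide), x₁]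
    refine .seq ((run_sumProg (N := d) (fun m => A i m * s.reals 2 m j) hdB ?_ ?_).mono
      fun s₃ hA₃ h₃ => .setReal ?_)
    · intro s' hA'
      simp [NExpr.eval, hA'.nats 0 (by decide), h₂.cols]
    · intro m s' _ hm hA'
      simp [NExpr.eval, RExpr.eval, hm, hA'.reals 0 (by decide), hA'.reals 2 (by decide),
        hA'.nats 10 (by decide), hA'.nats 13 (by decide), hi, j₂, x₂, h₂.matrix]
    · funext x y
      simp [State.setReal_reals, NExpr.eval, RExpr.eval, hA₃.nats 10 (by decide), hi, h₃,
        hA₃.nats 13 (by decide), j₂, hA₃.reals 0 (by decide), h₂.matrix, hA₃.reals 5 (by decide),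
        colResidual]
  · refine (run_residualLoss (by rw [hA₂.nats 0 (by decide), h₁.rows]) hnB).mono
      fun s₃ hA₃ h₃ => .setReal ?_
    simp only [State.setReal_reals, NExpr.eval, RExpr.eval, h₃, hA₃.reals 26 (by decide),
      hA₂.reals 26 (by decide), and_self, if_true]
    congr 1
    refine vecLoss_congr fun i hi => ?_
    rw [h₂]
    simp [hi]

/-- Keep the result of the current trial if it is the best so far. -/
def keepProg : Prog :=
  .branch (.realLe (rvar 26) (rvar 25))
    (.seq (.forLt 13 colCount (.seq (.setNat 1 (nvar 13) (.get 3 (nvar 13)))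
      (fillProg 1 12 colCount (nvar 13) (.get 2 (nvar 12) (nvar 13)))))
    (.setReal 25 (.const 0) (.const 0) (rvar 26)))
    .skip

/-- What holds between two trials. -/
structure MainInv (n d k t : ℕ) (A : ℕ → ℕ → ℝ) (s : State) : Prop where
  input : HasInput n d k t A s
  supp : ∀ j < d, ∀ m < d, m ∉ memSet d (s.nats 1) → s.reals 1 m j = 0
  size : #(memSet d (s.nats 1)) ≤ 256 * k * roundCount d
  loss : s.reals 25 0 0 = lossOn n d A (s.reals 1) (range d)

theorem MainInv.congr {s' : State} (h : MainInv n d k t A s) (h0 : s'.nats 0 = s.nats 0)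
    (hA : s'.reals 0 = s.reals 0) (h1 : s'.nats 1 = s.nats 1) (hX : s'.reals 1 = s.reals 1)
    (h25 : s'.reals 25 = s.reals 25) : MainInv n d k t A s' :=
  ⟨h.input.congr h0 hA, by rw [h1, hX]; exact h.supp, by rw [h1]; exact h.size,
    by rw [h25, hX]; exact h.loss⟩

theorem run_keepProg (h : MainInv n d k t A s) (hT : TrialInv n d k A s)
    (hall : memSet d (s.nats 2) = ∅) (hl : s.reals 26 0 0 = lossOn n d A (s.reals 2) (range d))
    (hdB : d ≤ B) :
    Run B keepProg s fun s' => MainInv n d k t A s' ∧ s'.reals 25 0 0 ≤ s.reals 25 0 0 ∧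
      s'.reals 25 0 0 ≤ lossOn n d A (s.reals 2) (range d) := by
  refine .branch (fun hb => .seq (Run.mono (.forLt (fun j s' => ∀ l < j, s'.nats 1 l = s.nats 3 l ∧
    ∀ m < d, s'.reals 1 m l = s.reals 2 m l) hdB (by decide)
    (fun s' hA => by simp [NExpr.eval, hA.nats 0 (by decide), h.input.cols]) (by simp) ?_)
    fun s₁ hA₁ h₁ => .setReal ?_)) fun hb => .skip ⟨h, le_rfl, ?_⟩
  · intro j s₁ _ hI hv hA₁
    refine .seq (.setNat ?_)
    simp only [NExpr.eval, hv, hA₁.nats 3 (by decide)]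
    set s₂ := s₁.setNat 1 j (s.nats 3 j) with hs₂
    have o2 : ∀ a, a ≠ 1 → s₂.nats a = s₁.nats a := fun a ha => State.setNat_nats_of_ne _ _ _ ha
    refine (run_fillProg (N := d) (J := j) (fun m => s.reals 2 m j) hdB ?_ ?_ ?_).mono
      fun s₃ hA₃ h₃ l hl => ?_
    · intro s' hA'
      simp [NExpr.eval, hA'.nats 0 (by decide), o2, hA₁.nats 0 (by decide), h.input.cols]
    · intro s' hA'
      simp [NExpr.eval, hA'.nats 13 (by decide), o2, hv]
    · intro m s' _ hm _ hA'
      have : s₂.reals = s₁.reals := rfl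
      simp [NExpr.eval, RExpr.eval, hm, hA'.reals 2 (by decide), hA'.nats 13 (by decide), o2, hv,
        this, hA₁.reals 2 (by decide)]
    · have e1 : s₃.nats 1 = s₂.nats 1 := hA₃.nats 1 (by decide)
      have := hI l
      rw [State.setNat_nats_of_ne _ _ _ (by decide), e1, State.setNat_reals, hs₂, State.setNat_nats]
      refine ⟨by grind, fun m hm => ?_⟩
      rw [h₃, State.setNat_reals]
      grind
  · simp only [NExpr.eval, RExpr.eval]
    have e26 : s₁.reals 26 = s.reals 26 := hA₁.reals 26 (by decide)
    rw [e26]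
    set s₂ := s₁.setReal 25 0 0 (s.reals 26 0 0) with hs₂
    have o2 : ∀ a, a ≠ 25 → s₂.reals a = s₁.reals a := fun a ha =>
      State.setReal_reals_of_ne _ _ _ _ ha
    have e25 : s₂.reals 25 0 0 = s.reals 26 0 0 := by simp [hs₂, State.setReal_reals]
    have e1 : memSet d (s₂.nats 1) = memSet d (s.nats 3) := by
      ext j
      rw [mem_memSet, mem_memSet]
      refine and_congr_right fun hj => ?_
      rw [hs₂, State.setReal_nats, (h₁ j hj).1]
    have eX : ∀ j < d, ∀ m < d, s₂.reals 1 m j = s.reals 2 m j := fun j hj m hm => by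
      rw [o2 1 (by decide), (h₁ j hj).2 m hm]
    refine ⟨⟨h.input.congr ?_ ?_, ?_, ?_, ?_⟩, ?_, ?_⟩
    · exact hA₁.nats 0 (by decide)
    · rw [o2 0 (by decide), hA₁.reals 0 (by decide)]
    · intro j hj m hm hm'
      rw [eX j hj m hm]
      exact hT.supp j hj (by rw [hall]; exact notMem_empty j) m hm (e1 ▸ hm')
    · rw [e1]
      exact (Nat.le_add_right _ _).trans hT.size
    · rw [e25, hl]
      exact (lossOn_congr fun j hj m hm => eX j (mem_range.1 hj) m hm).symm
    · rw [e25]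
      exact hb
    · rw [e25, hl]
  · rw [← hl]
    exact (not_le.1 hb).le

/-- One trial, followed by a comparison with the best one so far. -/
def bodyProg : Prog := .seq trialProg (.seq lossProg keepProg)

/-- The last clause expresses that the stored loss is at most that of this trial. It is phrased
through runs of `trialProg` so that the event bounded in `le_coinAvg_trialProg` can be used
directly; determinism identifies the two runs. -/
theorem run_bodyProg (h : MainInv n d k t A s) (hk1 : 1 ≤ k) (hnB : n ≤ B) (hdB : d ≤ B)
    (hTB : 2 * n * n + 1 ≤ B) :
    Run B bodyProg s fun s' => (s'.coins = fun i => s.coins (i + coinCount d k d)) ∧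
      MainInv n d k t A s' ∧ s'.reals 25 0 0 ≤ s.reals 25 0 0 ∧
      ∀ b, Run B trialProg s (fun s₁ => lossOn n d A (s₁.reals 2) (range d) ≤ b) →
        s'.reals 25 0 0 ≤ b := by
  obtain ⟨s₁, τ, he, ht, hc, hT, hall⟩ := run_trialProg h.input hk1 hnB hdB hTB
  refine .seq ⟨s₁, τ, he, ht, .seq ?_⟩
  have hA₁ := he.agree
  have h₁ : MainInv n d k t A s₁ := h.congr (hA₁.nats 0 (by decide)) (hA₁.reals 0 (by decide))
    (hA₁.nats 1 (by decide)) (hA₁.reals 1 (by decide)) (hA₁.reals 25 (by decide))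
  refine (run_lossProg h₁.input hnB hdB).mono fun s₂ hA₂ h26 => ?_
  have e0 := hA₂.nats 0 (by decide)
  have eA := hA₂.reals 0 (by decide)
  have h₂ : MainInv n d k t A s₂ := h₁.congr e0 eA
    (hA₂.nats 1 (by decide)) (hA₂.reals 1 (by decide)) (hA₂.reals 25 (by decide))
  have e2 := hA₂.nats 2 (by decide)
  have x2 := hA₂.reals 2 (by decide)
  have hT₂ : TrialInv n d k A s₂ :=
    ⟨h₂.input.rows, h₂.input.cols, h₂.input.rank, h₂.input.matrix,
      by rw [hA₂.nats 32 (by decide), e2]; exact hT.count,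
      by rw [e2, x2, hA₂.nats 3 (by decide)]; exact hT.supp,
      by rw [e2, hA₂.nats 3 (by decide)]; exact hT.size⟩
  refine (run_keepProg h₂ hT₂ (by rw [e2, hall]) (by rw [h26, x2]) hdB).mono
    fun s₃ hA₃ ⟨h₃, h25, hle⟩ => ⟨?_, h₃, ?_, ?_⟩
  · rw [hA₃.coins (by decide), hA₂.coins (by decide), hc]
  · rwa [hA₂.reals 25 (by decide), hA₁.reals 25 (by decide)] at h25
  · rintro b ⟨s₁', τ', he', -, hb⟩
    obtain rfl := he.det he'
    rw [x2] at hle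
    exact hle.trans hb

end HuberCSS

/-! ### Repeated trials -/

namespace RealRAM

theorem coinAvg_succ_right (m : ℕ) (f : (ℕ → Bool) → ℝ) (ρ : ℕ → Bool) :
    coinAvg (m + 1) f ρ =
      (coinAvg m f (consCoin true ρ) + coinAvg m f (consCoin false ρ)) / 2 := by
  induction m generalizing f with
  | zero => rfl
  | succ m ih =>
    rw [coinAvg, ih, ih]
    simp only [coinAvg]
    ring

/-- Surplus coins only change the continuation `ρ`, over which the bound is uniform. The tape of the
theorem is longer than what the program consumes. -/
theorem le_coinAvg_add {m : ℕ} {f : (ℕ → Bool) → ℝ} {c : ℝ} (h : ∀ ρ, c ≤ coinAvg m f ρ) (m' : ℕ)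
    (ρ : ℕ → Bool) : c ≤ coinAvg (m + m') f ρ := by
  induction m' generalizing ρ with
  | zero => exact h ρ
  | succ m' ih =>
    rw [← add_assoc, coinAvg_succ_right]
    linarith [ih (consCoin true ρ), ih (consCoin false ρ)]

theorem coinProb_mono {T : ℕ} {E E' : (Fin T → Bool) → Prop} (h : ∀ ω, E ω → E' ω) :
    coinProb T E ≤ coinProb T E' := by
  unfold coinProb
  gcongr
  exact Nat.card_le_card_of_injective (fun ω => ⟨ω.1, h _ ω.2⟩ : {ω // E ω} → {ω // E' ω})
    fun a b hab => Subtype.ext (Subtype.mk.inj hab)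

end RealRAM

namespace HuberCSS

open Finset RealRAM

/-- The test whether there have been fewer than `(2 d ^ 3 + 1) t` trials. -/
def trialTest : BExpr :=
  .not (.realLe (.mul (.add (.mul (.mul (.mul (.cast (.const 2)) (.cast colCount)) (.cast colCount))
    (.cast colCount)) (.cast (.const 1))) (.cast (.get 0 (.const 3)))) (.cast (nvar 17)))

/-- Preparation of the trials: the initial approximation is zero. -/
def initProg : Prog :=
  .seq lossProg (.seq (.setReal 25 (.const 0) (.const 0) (rvar 26))
    (.setNat 17 (.const 0) (.const 0)))

/-- Make independent trials and keep the best one. -/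
def mainProg : Prog := .seq initProg (.loop trialTest (.seq bodyProg (.incr 17)))

/-- The number of trials. -/
def trialCount (d t : ℕ) : ℕ := (2 * d * d * d + 1) * t

variable {B n d k t : ℕ} {A : ℕ → ℕ → ℝ} {s : State}

theorem holds_trialTest (h : HasInput n d k t A s) :
    trialTest.Holds s ↔ s.nats 17 0 < trialCount d t := by
  simp only [trialTest, BExpr.Holds, RExpr.eval, NExpr.eval, h.cols, h.trials, not_le, trialCount]
  norm_cast

theorem MainInv.withCoins (h : MainInv n d k t A s) (ω : ℕ → Bool) :
    MainInv n d k t A (s.withCoins ω) :=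
  h.congr rfl rfl rfl rfl rfl

theorem run_bodyProg_incr (h : MainInv n d k t A s) (hk1 : 1 ≤ k) (hnB : n ≤ B) (hdB : d ≤ B)
    (hTB : 2 * n * n + 1 ≤ B) :
    Run B (.seq bodyProg (.incr 17)) s fun s' =>
      (s'.coins = fun i => s.coins (i + coinCount d k d)) ∧
      MainInv n d k t A s' ∧ s'.nats 17 0 = s.nats 17 0 + 1 ∧ s'.reals 25 0 0 ≤ s.reals 25 0 0 ∧
      ∀ b, Run B trialProg s (fun s₁ => lossOn n d A (s₁.reals 2) (range d) ≤ b) →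
        s'.reals 25 0 0 ≤ b := by
  refine .seq ((run_bodyProg h hk1 hnB hdB hTB).mono fun s₁ hA₁ ⟨hc, h₁, hle, hb⟩ => .setNat ?_)
  refine ⟨hc, h₁.congr ?_ rfl ?_ rfl rfl, ?_, hle, hb⟩
  · exact State.setNat_nats_of_ne _ _ _ (by decide)
  · exact State.setNat_nats_of_ne _ _ _ (by decide)
  · simp [State.setNat_nats, NExpr.eval, hA₁.nats 17 (by decide)]

theorem loopRun_bodyProg (hk1 : 1 ≤ k) (hnB : n ≤ B) (hdB : d ≤ B) (hTB : 2 * n * n + 1 ≤ B) {m : ℕ}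
    (h : MainInv n d k t A s) (hm : s.nats 17 0 + m = trialCount d t) :
    LoopRun B m trialTest (.seq bodyProg (.incr 17)) s fun s' =>
      MainInv n d k t A s' ∧ s'.reals 25 0 0 ≤ s.reals 25 0 0 := by
  induction m generalizing s with
  | zero => exact .done (by rw [holds_trialTest h.input]; lia) ⟨h, le_rfl⟩
  | succ m ih =>
    refine .step (by rw [holds_trialTest h.input]; lia)
      ((run_bodyProg_incr h hk1 hnB hdB hTB).mono fun s₁ _ ⟨_, h₁, hcount, hle, _⟩ => ?_)
    obtain ⟨s', τ, he, ht, h', hle'⟩ := ih h₁ (by lia)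
    exact ⟨s', τ, he, ht, h', hle'.trans hle⟩

-- The trials use disjoint blocks of coins, and each reaches `b` with probability at least `δ` from
-- any memory satisfying `MainInv`; one success suffices because the stored loss never increases.
open Classical in
theorem le_coinAvg_bodyProg (hk1 : 1 ≤ k) (hnB : n ≤ B) (hdB : d ≤ B) (hTB : 2 * n * n + 1 ≤ B)
    {M : Matrix (Fin n) (Fin d) ℝ} (hM : M.rank ≤ k) {b : ℝ}
    (hb : 12336 * k * ∑ j ∈ range d, colLoss n A (entries M) j ≤ b) {m : ℕ}
    (h : MainInv n d k t A s) (hm : s.nats 17 0 + m = trialCount d t) (ρ : ℕ → Bool) :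
    1 - (1 - (1 / 2) ^ roundCount d) ^ m ≤ coinAvg (m * coinCount d k d) (fun ω =>
      if LoopRun B m trialTest (.seq bodyProg (.incr 17)) (s.withCoins ω)
        (fun s' => s'.reals 25 0 0 ≤ b) then 1 else 0) ρ := by
  set δ : ℝ := (1 / 2) ^ roundCount d with hδ
  have hδ0 : 0 ≤ δ := by positivity
  have hδ1 : δ ≤ 1 := pow_le_one₀ (by norm_num) (by norm_num)
  set K := coinCount d k d with hK
  induction m generalizing s with
  | zero =>
    rw [pow_zero, sub_self, zero_mul, coinAvg]
    split_ifs <;> norm_num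
  | succ m ih =>
    rw [show (m + 1) * K = K + m * K by ring, coinAvg_append _ _ _ _ ρ]
    set p : ℝ := 1 - (1 - δ) ^ m with hp
    have hp1 : 0 ≤ 1 - p := by
      rw [hp, sub_sub_cancel]
      exact pow_nonneg (by linarith) m
    set E : (ℕ → Bool) → Prop := fun ω => Run B trialProg (s.withCoins ω)
      fun s₁ => lossOn n d A (s₁.reals 2) (range d) ≤ b with hE
    -- Condition on the first trial: success settles the matter, failure leaves the probability `p`
    -- for the remaining `m` trials.
    have hkey : ∀ ω, p + (1 - p) * (if E (appendCoins K ω markedTape) then 1 else 0) ≤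
        coinAvg (m * K) (fun ω' =>
          if LoopRun B (m + 1) trialTest (.seq bodyProg (.incr 17))
            (s.withCoins (appendCoins K ω ω')) (fun s' => s'.reals 25 0 0 ≤ b) then 1 else 0) ρ := by
      intro ω
      obtain ⟨s₁, ⟨h₁, hcount, hE₁⟩, hrun⟩ := Run.exists_split (B := B)
        (p := .seq bodyProg (.incr 17)) (s := s) (K := K) (Q := fun ω s' => MainInv n d k t A s' ∧
          s'.nats 17 0 = s.nats 17 0 + 1 ∧ (E ω → s'.reals 25 0 0 ≤ b)) (fun ω =>
        (run_bodyProg_incr (h.withCoins ω) hk1 hnB hdB hTB).mono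
          fun s' _ ⟨hc, h', hcount, _, hb'⟩ => ⟨hc, h', hcount, hb' b⟩) ω
      have hstep : ∀ ω' (Q : State → Prop),
          LoopRun B m trialTest (.seq bodyProg (.incr 17)) (s₁.withCoins ω') Q →
          LoopRun B (m + 1) trialTest (.seq bodyProg (.incr 17))
            (s.withCoins (appendCoins K ω ω')) Q := by
        intro ω' Q hQ
        refine .step ?_ ((hrun ω').mono fun s' _ hs' => by rwa [hs'])
        rw [BExpr.holds_withCoins, holds_trialTest h.input]
        lia
      by_cases hgood : E (appendCoins K ω markedTape)
      · rw [if_pos hgood, mul_one, add_sub_cancel]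
        refine (coinAvg_const (m * K) 1 ρ).ge.trans (coinAvg_mono (fun ω' => ?_) ρ)
        obtain ⟨s', τ, he, ht, -, hle⟩ := loopRun_bodyProg hk1 hnB hdB hTB (h₁.withCoins ω')
          (m := m) (by change s₁.nats 17 0 + m = _; lia)
        rw [if_pos (hstep ω' _ ⟨s', τ, he, ht, hle.trans (hE₁ hgood)⟩)]
      · rw [if_neg hgood, mul_zero, add_zero]
        refine (ih h₁ (by lia)).trans (coinAvg_mono (fun ω' => ?_) ρ)
        split_ifs with h1 h2 h2
        · exact le_rfl
        · exact absurd (hstep ω' _ h1) h2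
        · norm_num
        · exact le_rfl
    refine le_trans ?_ (coinAvg_mono hkey ρ)
    rw [coinAvg_add, coinAvg_const, coinAvg_mul,
      coinAvg_append_const K (fun ω => if E ω then 1 else 0) markedTape ρ]
    have h1 := le_coinAvg_trialProg h.input hk1 hnB hdB hTB hM hb markedTape
    have h2 := mul_le_mul_of_nonneg_left h1 hp1
    refine le_trans (le_of_eq ?_) (add_le_add_right h2 p)
    rw [hp, pow_succ]
    ring

/-- The initial memory apart from the tape. -/
structure IsInitial (n d k t : ℕ) (A : ℕ → ℕ → ℝ) (s : State) : Prop where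
  input : HasInput n d k t A s
  nats : ∀ i, s.nats 1 i = 0
  reals₁ : ∀ i j, s.reals 1 i j = 0
  reals₂ : ∀ i j, s.reals 2 i j = 0

theorem run_initProg (h : IsInitial n d k t A s) (hnB : n ≤ B) (hdB : d ≤ B) :
    Run B initProg s fun s' => MainInv n d k t A s' ∧ s'.nats 17 0 = 0 := by
  refine .seq ((run_lossProg h.input hnB hdB).mono fun s₁ hA₁ h₁ => .seq (.setReal (.setNat ?_)))
  simp only [NExpr.eval, RExpr.eval]
  set s₂ := (s₁.setReal 25 0 0 (s₁.reals 26 0 0)).setNat 17 0 0 with hs₂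
  have o : ∀ a, a ≠ 17 → s₂.nats a = s₁.nats a := fun a ha => State.setNat_nats_of_ne _ _ _ ha
  have o' : ∀ a, a ≠ 25 → s₂.reals a = s₁.reals a := fun a ha =>
    State.setReal_reals_of_ne _ _ _ _ ha
  have e1 : s₂.reals 1 = s.reals 1 := by rw [o' 1 (by decide), hA₁.reals 1 (by decide)]
  have en : s₂.nats 1 = s.nats 1 := by rw [o 1 (by decide), hA₁.nats 1 (by decide)]
  refine ⟨⟨h.input.congr ?_ ?_, ?_, ?_, ?_⟩, by simp [hs₂, State.setNat_nats]⟩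
  · rw [o 0 (by decide), hA₁.nats 0 (by decide)]
  · rw [o' 0 (by decide), hA₁.reals 0 (by decide)]
  · intro j _ m _ _
    rw [e1, h.reals₁]
  · have : memSet d (s₂.nats 1) = ∅ := by
      rw [en, eq_empty_iff_forall_notMem]
      intro j hj
      exact (mem_memSet.1 hj).2 (h.nats j)
    rw [this]
    simp
  · have : s₂.reals 25 0 0 = s₁.reals 26 0 0 := by simp [hs₂, State.setReal_reals]
    rw [this, h₁]
    -- The loss was computed from the array of trial coefficients rather than from the output array,
    -- but initially both are zero.
    refine lossOn_congr fun j _ m _ => ?_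
    rw [e1, h.reals₁, h.reals₂]

theorem run_mainProg (h : IsInitial n d k t A s) (hk1 : 1 ≤ k) (hnB : n ≤ B) (hdB : d ≤ B)
    (hTB : 2 * n * n + 1 ≤ B) (hRB : trialCount d t ≤ B) :
    Run B mainProg s (MainInv n d k t A) := by
  refine .seq ((run_initProg h hnB hdB).mono fun s₁ _ ⟨h₁, h17⟩ => ?_)
  obtain ⟨s', τ, he, ht, h', -⟩ := loopRun_bodyProg hk1 hnB hdB hTB h₁ (m := trialCount d t)
    (by lia)
  exact LoopRun.run ⟨s', τ, he, ht, h'⟩ hRB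

/-- By `two_pow_roundCount_le` the success probability of a trial is at least `1 / (2 d ^ 3 + 1)`,
so a batch of `2 d ^ 3 + 1` trials fails with probability at most `exp (-1) ≤ 1 / 2`, and there are
`t` batches. -/
theorem one_sub_pow_trialCount_le (d t : ℕ) :
    (1 - (1 / 2 : ℝ) ^ roundCount d) ^ trialCount d t ≤ (1 / 2) ^ t := by
  set δ : ℝ := (1 / 2) ^ roundCount d with hδ
  have hδ1 : δ ≤ 1 := pow_le_one₀ (by norm_num) (by norm_num)
  have h1 : (2 : ℝ) ^ roundCount d ≤ (2 * d * d * d + 1 : ℕ) := by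
    have : 2 ^ roundCount d ≤ 2 * d * d * d + 1 :=
      (two_pow_roundCount_le d).trans (le_of_eq (by ring))
    exact_mod_cast this
  have h2 : 1 ≤ δ * (2 * d * d * d + 1 : ℕ) := by
    calc (1 : ℝ) = δ * 2 ^ roundCount d := by rw [hδ, ← mul_pow]; norm_num
      _ ≤ _ := by gcongr
  rw [trialCount, pow_mul]
  refine pow_le_pow_left₀ (pow_nonneg (by linarith) _) ?_ t
  calc (1 - δ) ^ (2 * d * d * d + 1) ≤ Real.exp (-δ) ^ (2 * d * d * d + 1) :=
        pow_le_pow_left₀ (by linarith) (Real.one_sub_le_exp_neg δ) _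
    _ = Real.exp (-(δ * (2 * d * d * d + 1 : ℕ))) := by
        rw [← Real.exp_nat_mul]; congr 1; ring
    _ ≤ Real.exp (-1) := Real.exp_le_exp.2 (by linarith)
    _ ≤ 1 / 2 := by
        rw [Real.exp_neg, one_div]
        exact inv_anti₀ (by norm_num) (by linarith [Real.add_one_le_exp (1 : ℝ)])

open Classical in
theorem le_coinAvg_mainProg (h : IsInitial n d k t A s) (hk1 : 1 ≤ k) (hnB : n ≤ B) (hdB : d ≤ B)
    (hTB : 2 * n * n + 1 ≤ B) (hRB : trialCount d t ≤ B) {M : Matrix (Fin n) (Fin d) ℝ}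
    (hM : M.rank ≤ k) {b : ℝ} (hb : 12336 * k * ∑ j ∈ range d, colLoss n A (entries M) j ≤ b)
    (ρ : ℕ → Bool) :
    1 - (1 / 2) ^ t ≤ coinAvg (trialCount d t * coinCount d k d) (fun ω =>
      if Run B mainProg (s.withCoins ω) (fun s' => s'.reals 25 0 0 ≤ b) then 1 else 0) ρ := by
  obtain ⟨s₁, ⟨h₁, h₂⟩, hrun⟩ := Run.exists_split (B := B) (p := initProg) (s := s) (K := 0)
    (Q := fun _ s' => MainInv n d k t A s' ∧ s'.nats 17 0 = 0) (fun ω =>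
      (run_initProg (⟨h.input.congr rfl rfl, h.nats, h.reals₁, h.reals₂⟩ :
        IsInitial n d k t A (s.withCoins ω)) hnB hdB).mono
        fun s' hA' h' => ⟨hA'.coins (by decide), h'⟩) ρ
  refine (sub_le_sub_left (one_sub_pow_trialCount_le d t) 1).trans
    ((le_coinAvg_bodyProg hk1 hnB hdB hTB hM hb h₁ (by lia) ρ).trans
      (coinAvg_mono (fun ω => ?_) ρ))
  split_ifs with h3 h4 h4
  · exact le_rfl
  · refine absurd (.seq ?_) h4
    have := hrun ω
    rw [appendCoins_zero] at this
    refine this.mono fun s' _ hs' => ?_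
    rw [hs']
    exact h3.run hRB
  · norm_num
  · exact le_rfl

end HuberCSS

/-! ### Interpretation of the output -/

namespace HuberCSS

open Finset RealRAM

theorem card_outputS (d : ℕ) (s : State) : #(outputS d s) = #(memSet d (s.nats 1)) := by
  simp only [outputS, memSet, card_filter, sum_range]

theorem sum_colLoss {n d : ℕ} (A M : Matrix (Fin n) (Fin d) ℝ) :
    ∑ j ∈ range d, colLoss n (entries A) (entries M) j = huberLoss (A - M) := by
  simp only [huberLoss, colLoss, vecLoss, sum_range, entries_fin, Matrix.sub_apply]
  exact sum_comm

/-- The coefficient rows outside the chosen set vanish, so restricting the product to that set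
changes nothing and the stored number is the loss of the output. -/
theorem MainInv.huberLoss_output {n d k t : ℕ} {A : Matrix (Fin n) (Fin d) ℝ} {s : State}
    (h : MainInv n d k t (entries A) s) :
    huberLoss (A - colSubmatrix A (outputS d s) * outputX d s) = s.reals 25 0 0 := by
  rw [h.loss]
  simp only [huberLoss, lossOn, vecLoss, colResidual, sum_range, entries_fin, Matrix.sub_apply,
    Matrix.mul_apply, colSubmatrix, Matrix.submatrix_apply, id, outputX]
  rw [sum_comm]
  refine sum_congr rfl fun j _ => sum_congr rfl fun i _ => ?_
  rw [sum_coe_sort (outputS d s) fun m => A i m * s.reals 1 m j]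
  congr 2
  refine sum_subset (subset_univ _) fun m _ hm => ?_
  rw [h.supp j j.2 m m.2, mul_zero]
  intro hm'
  exact hm (mem_filter.2 ⟨mem_univ _, (mem_memSet.1 hm').2⟩)

theorem isInitial_input {n d : ℕ} (A : Matrix (Fin n) (Fin d) ℝ) (k t : ℕ) {T : ℕ}
    (ω : Fin T → Bool) : IsInitial n d k t (entries A) (input A k t ω) := by
  refine ⟨⟨rfl, rfl, rfl, rfl, ?_⟩, fun _ => rfl, fun i j => ?_, fun i j => ?_⟩
  · funext i j
    simp [input, entries]
  · simp [input]
  · simp [input]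

/-- Among finitely many real values, those below all bounds of a family are those below some bound
of the family. -/
theorem exists_forall_le_of_le {Ω ι : Type*} [Finite Ω] [Nonempty ι] (f : Ω → ℝ) (L : ι → ℝ) :
    ∃ i, ∀ ω, f ω ≤ L i → ∀ j, f ω ≤ L j := by
  by_contra! hcon
  obtain ⟨ω, -, j, hj⟩ := hcon (Classical.arbitrary ι)
  obtain ⟨ω₀, ⟨j₀, hj₀⟩, hmin⟩ := (Set.toFinite {ω | ∃ j, L j < f ω}).exists_minimalFor f _ ⟨ω, j, hj⟩
  obtain ⟨ω₁, h₁, j₁, hj₁⟩ := hcon j₀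
  exact absurd (hmin ⟨j₁, hj₁⟩ (h₁.trans hj₀.le)) (not_le.2 (h₁.trans_lt hj₀))

end HuberCSS

open RealRAM HuberCSS in
theorem theoremA2 :
    ∃ (P : Prog) (C : ℝ) (q : Polynomial ℕ),
      ∀ (n d k t : ℕ), 1 ≤ k → ∀ A : Matrix (Fin n) (Fin d) ℝ,
        (∀ ω : Fin (q.eval (n + d + t)) → Bool,
          HaltsWithin P (input A k t ω) (q.eval (n + d + t)) fun s =>
            ((outputS d s).card : ℝ) ≤ C * k * Real.log (max d 2)) ∧
        1 - (1 / 2 : ℝ) ^ t ≤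
          coinProb (q.eval (n + d + t)) fun ω =>
            HaltsWithin P (input A k t ω) (q.eval (n + d + t)) fun s =>
              ∀ B : Matrix (Fin n) (Fin d) ℝ, B.rank ≤ k →
                huberLoss (A - colSubmatrix A (outputS d s) * outputX d s) ≤
                  C * k * huberLoss (A - B) := by
  obtain ⟨time, htime⟩ := mainProg.exists_timeBound_poly
  -- The polynomial is the time bound for loops of length at most `B` plus a bound on the number of
  -- coins, so the tape is long enough. The constant `12336` also covers `256 * 6 = 1536`, needed
  -- for the size of the set.
  refine ⟨mainProg, 12336, time.comp ((2 * .X * .X * .X + 1) * .X + 2 * .X * .X + 1 + .X) +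
    (2 * .X * .X * .X + 1) * .X * (.X * (.X * .X)), fun n d k t hk A => ?_⟩
  set q := time.comp ((2 * .X * .X * .X + 1) * .X + 2 * .X * .X + 1 + .X) +
    (2 * .X * .X * .X + 1) * .X * (.X * (.X * .X)) with hq
  set m := n + d + t with hm
  set T := q.eval m with hT
  obtain ⟨B, hB⟩ : ∃ B, B = (2 * m * m * m + 1) * m + 2 * m * m + 1 + m := ⟨_, rfl⟩
  have hTeq : T = mainProg.timeBound B + (2 * m * m * m + 1) * m * (m * (m * m)) := by
    rw [hT, hq, htime, hB]
    simp
  have hn : n ≤ m := by lia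
  have hd : d ≤ m := by lia
  have ht : t ≤ m := by lia
  have hnB : n ≤ B := by rw [hB]; exact hn.trans (Nat.le_add_left _ _)
  have hdB : d ≤ B := by rw [hB]; exact hd.trans (Nat.le_add_left _ _)
  have hR : trialCount d t ≤ (2 * m * m * m + 1) * m := by unfold trialCount; gcongr
  have hRB : trialCount d t ≤ B := by lia
  have hTB : 2 * n * n + 1 ≤ B := by
    have : 2 * n * n ≤ 2 * m * m := by gcongr
    lia
  have hcoins : trialCount d t * coinCount d k d ≤ T := by
    have : trialCount d t * coinCount d k d ≤ (2 * m * m * m + 1) * m * (m * (m * m)) := by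
      gcongr
      exact (coinCount_le hk le_rfl).trans (by gcongr)
    lia
  have hhalts : ∀ {s : State} {Q : State → Prop}, Run B mainProg s Q → HaltsWithin mainProg s T Q := by
    rintro s Q ⟨s', τ, he, hτ, h⟩
    exact ⟨s', τ, he, by lia, h⟩
  have hrun : ∀ ω : Fin T → Bool, Run B mainProg (input A k t ω) (MainInv n d k t (entries A)) :=
    fun ω => run_mainProg (isInitial_input A k t ω) hk hnB hdB hTB hRB
  constructor
  · refine fun ω => hhalts ((hrun ω).mono fun s _ h => ?_)
    have h1 : ((outputS d s).card : ℝ) ≤ 256 * k * roundCount d := by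
      rw [card_outputS]
      exact_mod_cast h.size
    have h2 := mul_le_mul_of_nonneg_left (roundCount_le_log d) (by positivity : (0 : ℝ) ≤ 256 * k)
    have h3 : 0 ≤ k * Real.log (max d 2) :=
      mul_nonneg k.cast_nonneg (Real.log_nonneg (one_le_two.trans (le_max_right _ _)))
    linarith
  · choose s' τ he hτ h' using hrun
    have : Nonempty {M : Matrix (Fin n) (Fin d) ℝ // M.rank ≤ k} := ⟨0, by simp⟩
    -- The event must hold for all competitors at once, but the probability bound concerns a fixed
    -- one. As there are finitely many tapes, one `M` is as hard to beat as all others together, and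
    -- no minimiser of the loss need exist.
    obtain ⟨⟨M, hM⟩, hmin⟩ := exists_forall_le_of_le (fun ω => (s' ω).reals 25 0 0)
      fun M : {M : Matrix (Fin n) (Fin d) ℝ // M.rank ≤ k} => 12336 * k * huberLoss (A - M.1)
    have hprob := le_coinAvg_add (fun ρ => le_coinAvg_mainProg
      (isInitial_input A k t fun _ : Fin 0 => false) hk hnB hdB hTB hRB hM
      (b := 12336 * k * huberLoss (A - M)) (by rw [sum_colLoss]) ρ)
      (T - trialCount d t * coinCount d k d) fun _ => false
    rw [Nat.add_sub_cancel' hcoins, ← coinProb_eq] at hprob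
    refine hprob.trans (coinProb_mono fun ω hω => ?_)
    refine ⟨s' ω, τ ω, he ω, by have := hτ ω; lia, fun M' hM' => ?_⟩
    rw [(h' ω).huberLoss_output]
    obtain ⟨s₁, τ₁, he₁, -, h₁⟩ := hω
    obtain rfl := (he ω).det he₁
    exact hmin ω h₁ ⟨M', hM'⟩
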